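/- **Setting.** Let $q$ be a prime power, $m,N\ge 1$, $n=n_{\mathrm{guess}}+n_{\mathrm{dual}}$, $A=(A_{\mathrm{guess}}\mid A_{\mathrm{dual}})\in\mathbb Z_q^{m\times n}$ with $A_{\mathrm{guess}}\in\mathbb Z_q^{m\times n_{\mathrm{guess}}}$, $\mathbf s=(\mathbf s_{\mathrm{guess}},\mathbf s_{\mathrm{dual}})\in\mathbb Z_q^n$, $\mathbf e\in\mathbb Z^m$, $\mathbf b=A\mathbf s+\mathbf e \bmod q$, and let $s,\delta>0$, $\varepsilon_{\mathrm{tail}}\in(0,1)$, $\beta\in\mathbb N$. For $M\in\mathbb Z_q^{m\times k}$ put $\mathcal L_q(M)=\{\mathbf z\in\mathbb Z^m:\exists \mathbf x,\ \mathbf z\equiv M\mathbf x \bmod q\}$ and $\mathcal L_q^\perp(M)=\{\mathbf z\in\mathbb Z^m: M^{\top}\mathbf z\equiv 0 \bmod q\}$. Write $\rho_\sigma(\mathbf x)=\exp(-\pi\|\mathbf x\|^2/\sigma^2)$ (also for real numbers), $\rho_\sigma(S)=\sum_{\mathbf x\in S}\rho_\sigma(\mathbf x)$, and $\mathcal D_{S,\sigma}(\mathbf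 x)=\rho_\sigma(\mathbf x)/\rho_\sigma(S)$ for $\mathbf x\in S$ (and $0$ outside $S$). Let $\lambda_1$ denote the length of a shortest nonzero vector and put $\tau=\frac1s\sqrt{m/(2\pi)}$, $\lambda=\lambda_1(\mathcal L_q(A))$. **Conditions.** Assume * $A_{\mathrm{guess}}\mathbf t\in A_{\mathrm{dual}}\mathbb Z_q^{n_{\mathrm{dual}}}$ implies $\mathbf t=0$ (automatic if $A$ has full column rank); * $\lambda\ge \tau+\|\mathbf e\|$ and $\rho_{1/s}(\mathbf e)-\rho_{1/s}(\lambda-\|\mathbf e\|-\tau)>2\delta$. Let $B$ be a BKZ-$\beta$-reduced basis of $\mathcal L=\mathcal L_q^\perp(A_{\mathrm{dual}})$, produced by a subroutine from $A_{\mathrm{dual}}$ at cost at most $T_{\mathrm{BKZ}}(m,\beta)$, with Gram–Schmidt vectors $\widehat{\mathbf b}_1,\dots,\widehat{\mathbf b}_m$. Let $$R\ \ge\ qs\Big(\sqrt{\tfrac{m}{2\pi}}+\sqrt{\tfrac{\log(N/\varepsilon_{\mathrm{tail}})}{\pi}}\Big),\qquad \mathcal S_R=\{\mathbf w\in\mathcal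 L:\|\mathbf w\|\le R\},\qquad \mathcal X_R=\{\mathbf x\in\mathbb Z^m: B\mathbf x\in\mathcal S_R\},$$ $$\Delta_R=\frac{\rho_{qs}(\mathcal S_R)}{\prod_{i=1}^m\rho_{qs/\|\widehat{\mathbf b}_i\|}(\mathbb Z)},\qquad \alpha_R=\frac{\rho_{qs}(\mathcal S_R)}{\rho_{qs}(\mathcal L)} .$$ **Model.** Let $Q_R$ be Klein's distribution for $B$, width $qs$ and centre $0$, conditioned on $\mathcal X_R$; let $Q(\mathcal X_R)$ be the Klein mass of $\mathcal X_R$, $p_R=\Delta_R/Q(\mathcal X_R)$, $\pi_R(\mathbf x)=\mathcal D_{\mathcal S_R,qs}(B\mathbf x)$ and $a(\mathbf x)=p_R\,\pi_R(\mathbf x)/Q_R(\mathbf x)$. The quantum rejection sampler (QRS) is given an arbitrary unitary $O$ on $\mathbb C^{\mathcal X_R}$ with $O|0\rangle=\sum_{\mathbf x}\sqrt{Q_R(\mathbf x)}\,|\mathbf x\rangle$, where $|0\rangle$ is a designated basis state. It applies $O$, the rotation $R_a$ of an accept coin with acceptance probability $a(\mathbf x)$, and a rotation of an auxiliary coin whose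 bias depends only on $p_R$; then it performs amplitude amplification with the number of rounds $k=\lceil \pi/(4\arcsin\sqrt{p_R})-\tfrac12\rceil$, the auxiliary bias being chosen so that the initial success probability is $\sin^2(\pi/(2(2k+1)))$. Finally it measures and outputs $B\mathbf x$. Each use of $O$, $O^\dagger$, $R_a$, $R_a^\dagger$, of a coin rotation or of a reflection costs one operation; each arithmetic operation or comparison on integers, residues modulo $q$, and real or complex numbers, each evaluation of a root of unity, and each memory access costs one operation. **Attack.** The dual attack obtains $B$ from the subroutine, draws $\mathbf w_1,\dots,\mathbf w_N$ by $N$ independent runs of QRS, and then, starting from the guess $\bot$ and $F_{\max}=0$, goes through all $\widetilde{\mathbf s}\in\mathbb Z_q^{n_{\mathrm{guess}}}$; whenever $F(\widetilde{\mathbf s})=\sum_{j}\cos\big(2\pi\langle \mathbf w_j,\mathbf b-A_{\mathrm{guess}}\widetilde{\mathbf s}\rangle/q\big)\ge F_{\max}$ it sets $F_{\max}=F(\widetilde{\mathbf s})$ and replaces the guess by $\widetilde{\mathbf s}$. It returns the last guess. The values $F$ are computed all at once, exactly, by a fast Fourier transform over $\mathbb Z_q^{n_{\mathrm{guess}}}$.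 **Theorem.** There are absolute constants $c,C>0$ and $k_0\in\mathbb N$ such that, in every such situation: 1. all gates of the QRS circuit are unitary, and $(\mathbf w_1,\dots,\mathbf w_N)$ has exactly the law $\mathcal D_{\mathcal S_R,qs}^{N}$; 2. the search based on the Fourier transform returns the same result as the loop over all guesses, for every list of samples; 3. the attack returns $\mathbf s_{\mathrm{guess}}$ with probability at least $1-q^m2^{-cN\delta^2}-\varepsilon_{\mathrm{tail}}$; 4. in every execution its cost is at most $$C(m+n)^{k_0}\big(N+q^{n_{\mathrm{guess}}}\log_2 q\big)+T_{\mathrm{BKZ}}(m,\beta)+N\cdot\frac{C}{\sqrt{\Delta_R}};$$ 5. $d_{\mathrm{TV}}(\mathcal D_{\mathcal L,qs},\mathcal D_{\mathcal S_R,qs})=1-\alpha_R\le\varepsilon_{\mathrm{tail}}/N$ and $d_{\mathrm{TV}}(\mathcal D_{\mathcal L,qs}^{N},\mathcal D_{\mathcal S_R,qs}^{N})\le\varepsilon_{\mathrm{tail}}$. -/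

import Mathlib

open Real Matrix

noncomputable section

namespace DualAttack

/-! ## Lattices, norms and Gaussians -/

/-- An integer vector viewed in Euclidean space. -/
def toE {m : ℕ} (z : Fin m → ℤ) : EuclideanSpace ℝ (Fin m) :=
  WithLp.toLp 2 fun i => (z i : ℝ)

/-- Reduction of an integer vector modulo `q`. -/
def modQ {m : ℕ} (q : ℕ) (z : Fin m → ℤ) : Fin m → ZMod q := fun i => (z i : ZMod q)

/-- The `q`-ary lattice `L_q(M) = {z ∈ ℤ^m : z ≡ M x mod q for some x}`. -/
def qaryLattice {m q : ℕ} {ι : Type} [Fintype ι] (M : Matrix (Fin m) ι (ZMod q)) :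
    Submodule ℤ (Fin m → ℤ) where
  carrier := {z | ∃ x : ι → ZMod q, modQ q z = M *ᵥ x}
  zero_mem' := ⟨0, by ext i; simp [modQ]⟩
  add_mem' := by
    rintro a b ⟨x, hx⟩ ⟨y, hy⟩
    refine ⟨x + y, ?_⟩
    rw [mulVec_add, ← hx, ← hy]
    ext i; simp [modQ]
  smul_mem' := by
    rintro c a ⟨x, hx⟩
    refine ⟨(c : ZMod q) • x, ?_⟩
    rw [mulVec_smul, ← hx]
    ext i; simp [modQ]

/-- The dual `q`-ary lattice `L_q^⊥(M) = {z ∈ ℤ^m : Mᵀ z ≡ 0 mod q}`. -/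
def dualQaryLattice {m q : ℕ} {ι : Type} [Fintype ι] (M : Matrix (Fin m) ι (ZMod q)) :
    Submodule ℤ (Fin m → ℤ) where
  carrier := {z | Mᵀ *ᵥ modQ q z = 0}
  zero_mem' := by
    have : modQ q (0 : Fin m → ℤ) = 0 := by ext i; simp [modQ]
    simp [this]
  add_mem' := by
    intro a b ha hb
    have : modQ q (a + b) = modQ q a + modQ q b := by ext i; simp [modQ]
    change Mᵀ *ᵥ modQ q a = 0 at ha
    change Mᵀ *ᵥ modQ q b = 0 at hb
    change Mᵀ *ᵥ modQ q (a + b) = 0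
    rw [this, mulVec_add, ha, hb, add_zero]
  smul_mem' := by
    intro c a ha
    have : modQ q (c • a) = (c : ZMod q) • modQ q a := by ext i; simp [modQ]
    change Mᵀ *ᵥ modQ q a = 0 at ha
    change Mᵀ *ᵥ modQ q (c • a) = 0
    rw [this, mulVec_smul, ha, smul_zero]

/-- The first minimum: the length of a shortest nonzero vector. -/
def firstMin {m : ℕ} (L : Submodule ℤ (Fin m → ℤ)) : ℝ :=
  sInf {r | ∃ z ∈ L, z ≠ 0 ∧ ‖toE z‖ = r}

/-- The Gaussian weight `ρ_σ(t) = exp(-π t² / σ²)` of a real number, or of a vector of norm `t`. -/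
def rho (σ t : ℝ) : ℝ := exp (-π * t ^ 2 / σ ^ 2)

/-- `ρ_σ(S)` for a set `S` of integer vectors. -/
def rhoSet {m : ℕ} (σ : ℝ) (S : Set (Fin m → ℤ)) : ℝ := ∑' z : S, rho σ ‖toE z.1‖

/-- `ρ_{σ,c}(ℤ)`. -/
def rhoInt (σ c : ℝ) : ℝ := ∑' k : ℤ, rho σ ((k : ℝ) - c)

open Classical in
/-- The mass function of the discrete Gaussian `D_{S,σ}` centred at the origin. -/
def discreteGaussian {m : ℕ} (S : Set (Fin m → ℤ)) (σ : ℝ) (z : Fin m → ℤ) : ℝ :=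
  if z ∈ S then rho σ ‖toE z‖ / rhoSet σ S else 0

/-- The mass function of `N` independent samples from `μ`. -/
def productMass {α : Type} (μ : α → ℝ) (N : ℕ) (W : Fin N → α) : ℝ := ∏ j, μ (W j)

/-- Total variation distance of two mass functions on a countable set. -/
def tvDist {Ω : Type} (μ ν : Ω → ℝ) : ℝ := 1 / 2 * ∑' x, |μ x - ν x|

/-- The lattice points in the closed Euclidean ball of radius `R`. -/
def truncated {m : ℕ} (L : Submodule ℤ (Fin m → ℤ)) (R : ℝ) : Set (Fin m → ℤ) :=
  {z | z ∈ L ∧ ‖toE z‖ ≤ R}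

/-- The retained Gaussian mass `α_R`. -/
def retainedMass {m : ℕ} (L : Submodule ℤ (Fin m → ℤ)) (σ R : ℝ) : ℝ :=
  rhoSet σ (truncated L R) / rhoSet σ (L : Set (Fin m → ℤ))

/-! ## Bases, Gram–Schmidt vectors, BKZ reduction -/

section Basis

variable {m : ℕ} {L : Submodule ℤ (Fin m → ℤ)} (B : Module.Basis (Fin m) ℤ L)

/-- The `i`-th basis vector in Euclidean space. -/
def bvec (i : Fin m) : EuclideanSpace ℝ (Fin m) := toE (B i : Fin m → ℤ)

/-- The Gram–Schmidt vectors of the basis. -/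
def gs (i : Fin m) : EuclideanSpace ℝ (Fin m) :=
  InnerProductSpace.gramSchmidt ℝ (bvec B) i

/-- The projection orthogonal to the basis vectors before the `i`-th one. -/
def projFrom (i : Fin m) (v : EuclideanSpace ℝ (Fin m)) : EuclideanSpace ℝ (Fin m) :=
  (Submodule.span ℝ (bvec B '' Set.Iio i))ᗮ.starProjection v

/-- BKZ reduction with block size `β`: the basis is size-reduced, and each Gram–Schmidt vector
is a shortest nonzero vector of the lattice generated by the projected block
`π_i(b_i), …, π_i(b_{min(i+β-1,m)})`. -/
def IsBKZReduced (β : ℕ) : Prop :=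
  (∀ i j : Fin m, j < i → |inner ℝ (gs B j) (bvec B i) / ‖gs B j‖ ^ 2| ≤ 1 / 2) ∧
  (∀ (i : Fin m) (y : Fin m → ℤ), y ≠ 0 →
    (∀ j : Fin m, y j ≠ 0 → i ≤ j ∧ (j : ℕ) < i + β) →
    ‖gs B i‖ ≤ ‖∑ j, (y j : ℝ) • projFrom B i (bvec B j)‖)

/-- The lattice vector `B x`. -/
def latVec (x : Fin m → ℤ) : Fin m → ℤ := ((∑ i, x i • B i : L) : Fin m → ℤ)

/-- The coefficient-space truncation `X_R = {x ∈ ℤ^m : ‖B x‖ ≤ R}`. -/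
abbrev Coeffs (R : ℝ) : Type := {x : Fin m → ℤ // ‖toE (latVec B x)‖ ≤ R}

theorem abs_le_norm_toE (z : Fin m → ℤ) (i : Fin m) : |(z i : ℝ)| ≤ ‖toE z‖ := by
  have h := PiLp.norm_apply_le (toE z) i
  simpa [toE] using h

theorem finite_coeffs (R : ℝ) : Finite (Coeffs B R) := by
  have hfin : Set.Finite {z : Fin m → ℤ | ‖toE z‖ ≤ R} := by
    refine (Set.Finite.pi' (t := fun _ : Fin m => Set.Icc (-⌈R⌉) ⌈R⌉)
      (fun _ => Set.finite_Icc _ _)).subset ?_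
    intro z hz i
    have h1 : |(z i : ℝ)| ≤ ⌈R⌉ := (abs_le_norm_toE z i).trans (le_trans hz (Int.le_ceil R))
    rw [abs_le] at h1
    exact ⟨by exact_mod_cast h1.1, by exact_mod_cast h1.2⟩
  have hinj : Function.Injective (latVec B) := by
    intro x y hxy
    have h2 : (∑ i, x i • B i : L) = ∑ i, y i • B i := Subtype.ext hxy
    rw [← B.equivFun_symm_apply, ← B.equivFun_symm_apply] at h2
    exact B.equivFun.symm.injective h2
  exact (hfin.preimage hinj.injOn).to_subtype

instance (R : ℝ) : Fintype (Coeffs B R) :=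
  have := finite_coeffs B R
  Fintype.ofFinite _

/-! ## Klein's distribution and the truncated proposal -/

/-- The conditional centre `μ_i(x_{>i})` of Klein's sampler for the lattice `B ℤ^m` and
centre `0`, in terms of `r_ij = ⟨b̂_i, b_j⟩ / ‖b̂_i‖`. -/
def kleinCenter (x : Fin m → ℤ) (i : Fin m) : ℝ :=
  -(∑ j ∈ Finset.Ioi i, inner ℝ (gs B i) (bvec B j) * (x j : ℝ)) / ‖gs B i‖ ^ 2

/-- Klein's distribution `Q` on coefficient vectors. -/
def kleinMass (σ : ℝ) (x : Fin m → ℤ) : ℝ :=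
  ∏ i, rho (σ / ‖gs B i‖) ((x i : ℝ) - kleinCenter B x i) /
    rhoInt (σ / ‖gs B i‖) (kleinCenter B x i)

/-- `Q(X_R)`. -/
def kleinBall (σ R : ℝ) : ℝ := ∑ x : Coeffs B R, kleinMass B σ x.1

/-- The truncated Klein distribution `Q_R`. -/
def kleinTrunc (σ R : ℝ) (x : Coeffs B R) : ℝ := kleinMass B σ x.1 / kleinBall B σ R

/-- The truncated lattice Gaussian `π_R` on coefficient vectors. -/
def targetTrunc (σ R : ℝ) (x : Coeffs B R) : ℝ :=
  rho σ ‖toE (latVec B x.1)‖ / ∑ y : Coeffs B R, rho σ ‖toE (latVec B y.1)‖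

/-- `Δ_R = ρ_σ(L ∩ B_m(R)) / ∏ᵢ ρ_{σ/‖b̂ᵢ‖}(ℤ)`. -/
def DeltaR (σ R : ℝ) : ℝ := rhoSet σ (truncated L R) / ∏ i, rhoInt (σ / ‖gs B i‖) 0

/-- `p_R = Δ_R / Q(X_R)`. -/
def pR (σ R : ℝ) : ℝ := DeltaR B σ R / kleinBall B σ R

/-- The acceptance probability `a(x) = p_R π_R(x) / Q_R(x)`. -/
def accept (σ R : ℝ) (x : Coeffs B R) : ℝ :=
  pR B σ R * (targetTrunc B σ R x / kleinTrunc B σ R x)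

/-- The truncated Klein oracle: a unitary on the space with basis `X_R` that maps the
initial basis state to `∑ₓ √Q_R(x) |x⟩`. -/
structure KleinOracle (σ R : ℝ) where
  init : Coeffs B R
  U : Matrix (Coeffs B R) (Coeffs B R) ℂ
  unitary : U ∈ Matrix.unitaryGroup (Coeffs B R) ℂ
  prepares : ∀ x, U x init = ((√(kleinTrunc B σ R x) : ℝ) : ℂ)

/-! ## Quantum rejection sampling in the oracle model -/

/-- The elementary operations of the oracle model: the preparation oracle and its inverse,
the acceptance rotation and its inverse, the two reflections, and a fixed rotation of an
auxiliary coin (it lowers the success amplitude to a value at which amplitude amplification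
is exact). -/
inductive Gate
  | prep | prepInv | accRot | accRotInv | auxRot | auxRotInv | reflInit | reflGood

/-- The rotation that sends `|0⟩` to `√(1-a) |0⟩ + √a |1⟩`. -/
def rot (a : ℝ) : Matrix Bool Bool ℂ := fun i j =>
  match i, j with
  | false, false => ((√(1 - a) : ℝ) : ℂ)
  | false, true => -((√a : ℝ) : ℂ)
  | true, false => ((√a : ℝ) : ℂ)
  | true, true => ((√(1 - a) : ℝ) : ℂ)

/-- Basis of the registers: coefficient register, accept coin, auxiliary coin. -/
abbrev Reg (R : ℝ) : Type := Coeffs B R × Bool × Bool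

variable {B}

/-- The number of amplification rounds: the least `k` with
`π / (2 (2k+1)) ≤ arcsin √p`. -/
def rounds (p : ℝ) : ℕ := ⌈π / (4 * arcsin √p) - 1 / 2⌉₊

/-- The bias of the auxiliary coin: it makes the initial success probability
`sin² (π / (2 (2k+1)))`. -/
def auxBias (p : ℝ) : ℝ := sin (π / (2 * (2 * (rounds p : ℝ) + 1))) ^ 2 / p

/-- The unitary of a gate. -/
def gateMatrix {σ R : ℝ} (O : KleinOracle B σ R) : Gate → Matrix (Reg B R) (Reg B R) ℂ
  | .prep => fun i j => if i.2 = j.2 then O.U i.1 j.1 else 0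
  | .prepInv => fun i j => if i.2 = j.2 then O.Uᴴ i.1 j.1 else 0
  | .accRot => fun i j =>
      if i.1 = j.1 ∧ i.2.2 = j.2.2 then rot (accept B σ R i.1) i.2.1 j.2.1 else 0
  | .accRotInv => fun i j =>
      if i.1 = j.1 ∧ i.2.2 = j.2.2 then (rot (accept B σ R i.1))ᴴ i.2.1 j.2.1 else 0
  | .auxRot => fun i j =>
      if i.1 = j.1 ∧ i.2.1 = j.2.1 then rot (auxBias (pR B σ R)) i.2.2 j.2.2 else 0
  | .auxRotInv => fun i j =>
      if i.1 = j.1 ∧ i.2.1 = j.2.1 then (rot (auxBias (pR B σ R)))ᴴ i.2.2 j.2.2 else 0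
  | .reflInit => Matrix.diagonal fun i => if i = (O.init, false, false) then -1 else 1
  | .reflGood => Matrix.diagonal fun i => if i.2 = (true, true) then -1 else 1

/-- The preparation `A = R_a (O ⊗ I)`, together with the auxiliary coin. -/
def prepCircuit : List Gate := [.prep, .accRot, .auxRot]

/-- One amplification round `A S_0 A† S_Π`, in order of application. -/
def roundCircuit : List Gate :=
  [.reflGood, .auxRotInv, .accRotInv, .prepInv, .reflInit, .prep, .accRot, .auxRot]

/-- The quantum rejection sampling circuit for success parameter `p`. -/
def qrsCircuit (p : ℝ) : List Gate :=
  prepCircuit ++ (List.replicate (rounds p) roundCircuit).flatten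

/-- The state after running the circuit from the initial basis state. -/
def qrsState {σ R : ℝ} (O : KleinOracle B σ R) : Reg B R → ℂ :=
  (qrsCircuit (pR B σ R)).foldl (fun ψ G => gateMatrix O G *ᵥ ψ)
    (Pi.single (O.init, false, false) 1)

end Basis

/-- Measurement of a state in the computational basis (Born rule; for a vector that is not of
norm one the given outcome `i₀` is returned). -/
def measure {ι : Type} [Fintype ι] (ψ : ι → ℂ) (i₀ : ι) : PMF ι := by
  classical
  exact if h : ∑ i, ENNReal.ofReal (‖ψ i‖ ^ 2) = 1 then PMF.ofFintype _ h else PMF.pure i₀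

/-! ## Step counting -/

/-- A value together with the number of elementary operations spent on it. -/
structure Timed (α : Type) where
  val : α
  cost : ℕ

instance : Monad Timed where
  pure a := ⟨a, 0⟩
  bind x f := ⟨(f x.val).val, x.cost + (f x.val).cost⟩

/-- One elementary operation: an arithmetic operation or comparison on integers, residues
modulo `q`, real or complex numbers, the evaluation of a root of unity, or a memory access
(together with the bounded number of index computations and reads that it needs). -/
def op {α : Type} (a : α) : Timed α := ⟨a, 1⟩

/-- Fill an array: one write for each entry, plus the cost of the entries. -/
def tabulate {ι α : Type} [Fintype ι] (f : ι → Timed α) : Timed (ι → α) :=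
  ⟨fun i => (f i).val, ∑ i, ((f i).cost + 1)⟩

/-- Fill an array of length `n` of complex numbers. -/
def array (n : ℕ) (f : ℕ → Timed ℂ) : Timed (ℕ → ℂ) :=
  ⟨fun i => if i < n then (f i).val else 0, ∑ i ∈ Finset.range n, ((f i).cost + 1)⟩

/-- A sum: one addition for each term, plus the cost of the terms. -/
def timedSum {ι α : Type} [Fintype ι] [AddCommMonoid α] (f : ι → Timed α) : Timed α :=
  ⟨∑ i, (f i).val, ∑ i, ((f i).cost + 1)⟩

/-- `N` independent runs of a randomized procedure. -/
def repeatRuns {α : Type} (p : PMF (Timed α)) : (N : ℕ) → PMF (Timed (Fin N → α))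
  | 0 => PMF.pure ⟨Fin.elim0, 0⟩
  | N + 1 => p.bind fun a => (repeatRuns p N).map fun W =>
      ⟨Fin.cons a.val W.val, a.cost + W.cost⟩

/-- The sampler: run the circuit, measure, and output `w = B x`. Every gate of the circuit counts
as one operation. -/
def qrsSample {m : ℕ} {L : Submodule ℤ (Fin m → ℤ)} {B : Module.Basis (Fin m) ℤ L} {σ R : ℝ}
    (O : KleinOracle B σ R) : PMF (Timed (Fin m → ℤ)) :=
  (measure (qrsState O) (O.init, false, false)).map fun r =>
    let w : Timed (Fin m → ℤ) :=
      tabulate fun k => timedSum fun i => op (r.1.1 i * (B i : Fin m → ℤ) k)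
    ⟨w.val, (qrsCircuit (pR B σ R)).length + w.cost⟩

/-! ## Discrete Fourier transform over `(ℤ/q)^g` in quasi-linear time -/

/-- `exp(2πi a / n)`. -/
def root (n : ℕ) (a : ℤ) : ℂ := Complex.exp (2 * π * Complex.I * (a : ℂ) / (n : ℂ))

/-- Radix-2 fast Fourier transform of length `2^t`:
`X_k = ∑_{j < 2^t} x_j exp(2πi sgn j k / 2^t)`. -/
def fft (sgn : ℤ) : (t : ℕ) → (ℕ → ℂ) → Timed (ℕ → ℂ)
  | 0, x => pure x
  | t + 1, x => do
      let E ← fft sgn t fun i => x (2 * i)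
      let O ← fft sgn t fun i => x (2 * i + 1)
      array (2 ^ (t + 1)) fun k => do
        let w ← op (root (2 ^ (t + 1)) (sgn * k))
        let y ← op (w * O (k % 2 ^ t))
        op (E (k % 2 ^ t) + y)

/-- The chirp `exp(2πi sgn (j choose 2) / q)`. -/
def chirp (q : ℕ) (sgn : ℤ) (j : ℕ) : Timed ℂ := do
  let c ← op (j * (j - 1) / 2 : ℕ)
  op (root q (sgn * c))

/-- The transform `X_k = ∑_j x_j exp(-2πi j k / q)` of length `q`, by the chirp transform: since
`j k = C(j+k,2) - C(j,2) - C(k,2)`, it is a convolution, which is computed by radix-2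
transforms of length at least `2 q`. -/
def dftLine {q : ℕ} [NeZero q] (x : ZMod q → ℂ) : Timed (ZMod q → ℂ) := do
  let t := Nat.clog 2 q + 1
  let Y ← array (2 ^ t) fun j =>
    if j < q then do
      let c ← chirp q 1 (q - 1 - j)
      op (c * x ((q - 1 - j : ℕ) : ZMod q))
    else op 0
  let H ← array (2 ^ t) fun j => chirp q (-1) j
  let FY ← fft 1 t Y
  let FH ← fft 1 t H
  let P ← array (2 ^ t) fun j => op (FY j * FH j)
  let Z ← fft (-1) t P
  tabulate fun k : ZMod q => do
    let c ← chirp q 1 k.val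
    let z ← op (Z (q - 1 + k.val) / 2 ^ t)
    op (c * z)

/-- The transform `X_t = ∑_u T_u exp(-2πi ⟨u, t⟩ / q)` over `(ℤ/q)^g`, one coordinate at a
time. -/
def dftAll {q : ℕ} [NeZero q] :
    (g : ℕ) → ((Fin g → ZMod q) → ℂ) → Timed ((Fin g → ZMod q) → ℂ)
  | 0, T => pure T
  | g + 1, T => do
      let S ← tabulate fun a : ZMod q => dftAll g fun u => T (Fin.cons a u)
      let V ← tabulate fun u : Fin g → ZMod q => dftLine fun a => S a u
      tabulate fun t : Fin (g + 1) → ZMod q => op (V (Fin.tail t) (t 0))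

/-! ## The dual attack -/

section Attack

variable {m g d q : ℕ} [NeZero q]

/-- The score `F(t) = ∑_j cos(2π y_j / q)` with `y_j = ⟨w_j, b - A_guess t⟩ mod q`. -/
def score (A : Matrix (Fin m) (Fin g ⊕ Fin d) (ZMod q)) (b : Fin m → ZMod q) {N : ℕ}
    (W : Fin N → Fin m → ℤ) (t : Fin g → ZMod q) : ℝ :=
  ∑ j, cos (2 * π * ((modQ q (W j) ⬝ᵥ (b - A.toCols₁ *ᵥ t)).val : ℝ) / q)

open Classical in
/-- The search loop of the attack, given the samples: start with `⊥` and `F_max = 0`, go through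
all guesses, and replace the current guess whenever `F ≥ F_max`. -/
def attackOutput (A : Matrix (Fin m) (Fin g ⊕ Fin d) (ZMod q)) (b : Fin m → ZMod q) {N : ℕ}
    (W : Fin N → Fin m → ℤ) : Option (Fin g → ZMod q) :=
  ((Finset.univ : Finset (Fin g → ZMod q)).toList.foldl
    (fun (st : Option (Fin g → ZMod q) × ℝ) t =>
      if score A b W t ≥ st.2 then (some t, score A b W t) else st) (none, 0)).1

/-- The table `T_u = ∑_{j : A_guessᵀ w_j = u} exp(2πi ⟨w_j, b⟩ / q)`, filled in one pass over the
samples. -/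
def fillTable (A : Matrix (Fin m) (Fin g ⊕ Fin d) (ZMod q)) (b : Fin m → ZMod q) {N : ℕ}
    (W : Fin N → Fin m → ℤ) : Timed ((Fin g → ZMod q) → ℂ) := do
  let T₀ ← tabulate fun _ : Fin g → ZMod q => op (0 : ℂ)
  (List.ofFn W).foldlM (fun T w => do
    let wq ← tabulate fun i => op (w i : ZMod q)
    let u ← tabulate fun k : Fin g => timedSum fun i => op (A i (Sum.inl k) * wq i)
    let v ← timedSum fun i => op (wq i * b i)
    let c ← op (root q (v.val : ℤ))
    let y ← op (T u + c)
    op (Function.update T u y)) T₀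

open Classical in
/-- The same search, with all the scores computed at once by a Fourier transform. -/
def search (A : Matrix (Fin m) (Fin g ⊕ Fin d) (ZMod q)) (b : Fin m → ZMod q) {N : ℕ}
    (W : Fin N → Fin m → ℤ) : Timed (Option (Fin g → ZMod q)) := do
  let T ← fillTable A b W
  let X ← dftAll g T
  let best ← (Finset.univ : Finset (Fin g → ZMod q)).toList.foldlM
    (fun (st : Option (Fin g → ZMod q) × ℝ) t => do
      let F ← op (X t).re
      let c ← op (decide (F ≥ st.2))
      if c then op (some t, F) else op st) (none, 0)
  pure best.1

/-- The end-to-end attack: reduce a basis of `L_q^⊥(A_dual)` with the subroutine `bkz`, draw `N`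
samples by quantum rejection sampling with the truncated Klein oracle of that basis,
and search. -/
def dualAttack (A : Matrix (Fin m) (Fin g ⊕ Fin d) (ZMod q)) (b : Fin m → ZMod q) (N : ℕ)
    {σ R : ℝ}
    (bkz : (M : Matrix (Fin m) (Fin d) (ZMod q)) →
      Timed (Module.Basis (Fin m) ℤ (dualQaryLattice M)))
    (oracle : ∀ B : Module.Basis (Fin m) ℤ (dualQaryLattice A.toCols₂), KleinOracle B σ R) :
    PMF (Timed (Option (Fin g → ZMod q))) :=
  let B := bkz A.toCols₂
  (repeatRuns (qrsSample (oracle B.val)) N).map fun W =>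
    let out := search A b W.val
    ⟨out.val, B.cost + W.cost + out.cost⟩

end Attack

end DualAttack

end

open DualAttack

/-!
The search succeeds because the mean score of a guess is a normalized Gaussian sum. For `w` drawn
from the discrete Gaussian of width `qs` on `L_q^⊥(M)`, Poisson summation gives `E cos(2π⟨w, v⟩ /
q) = ρ_{1/s}(v + L_q(M)) / ρ_{1/s}(L_q(M))` (`mean_cos_eq`). Since the indicator of `L_q^⊥(M)` is
an average of characters modulo `q`, only the one-dimensional Poisson formula and orthogonality of
characters on `(ℤ/q)^d` are needed; cosets of `L_q(M)` enter through `spanMass`, a finite sum of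
Gaussian masses of cosets of `qℤ^m`. For the secret, `v` is a lattice point plus `e`, and the
symmetry of the lattice bounds the mean below by `ρ_{1/s}(e)` (`rho_mul_spanMass_le`). For any
other guess the coset avoids a ball around the origin, and Banaszczyk's argument bounds the mean
above by `ρ_{1/s}(r - τ)` (`spanMass_le_rho_of_far`). A Chernoff bound and a union bound over the
guesses (`one_sub_card_mul_exp_le`) show that the score of the secret is the largest one. The same
tail bound, applied to `L_q^⊥(M)` itself, controls the loss by truncation
(`one_sub_retainedMass_le`), because the distance between a distribution and its conditioning on
an event is the mass of the complement (`tvDist_conditional`).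

The sampler is exact. In Gram–Schmidt coordinates the Gaussian weight of `B x` is the product of
the numerators of Klein's distribution, so the acceptance probability is a quotient of shifted and
unshifted Gaussian sums over `ℤ` and lies in `[0, 1]` (`accept_le_one`). Every amplification round
is, up to sign, a rotation by `2θ` in the plane spanned by the accepted and the rejected component
of the prepared state (`exists_amplified`). The auxiliary coin makes `θ = π / (2(2k+1))`, so that
after `k` rounds the state is the accepted component, normalized, and its measurement has the
target law (`qrsSample_law`). Klein's distribution has total mass at most one, hence `Δ_R ≤ p_R`
and `k = O(1 / √Δ_R)`.

The search is correct because the chirp identity `jk = C(j+k,2) - C(j,2) - C(k,2)` turns a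
transform of length `q` into a convolution, which does not wrap around at length `2^t ≥ 2q`
(`dftLine_val`).
-/

namespace DualAttack

/-! ### Sums over product index sets -/

/-- Absolute summability and evaluation of a product function on `Fin n → α`. -/
theorem summable_norm_pi_prod {α 𝕜 : Type*} [RCLike 𝕜] :
    ∀ {n : ℕ} (f : Fin n → α → 𝕜), (∀ i, Summable fun a => ‖f i a‖) →
      (Summable fun z : Fin n → α => ‖∏ i, f i (z i)‖) ∧
        ∑' z : Fin n → α, ∏ i, f i (z i) = ∏ i, ∑' a, f i a
  | 0, f, _ => by
    refine ⟨(hasSum_fintype _).summable, ?_⟩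
    rw [tsum_fintype]
    simp
  | n + 1, f, hf => by
    obtain ⟨h1, h2⟩ := summable_norm_pi_prod (fun i : Fin n => f i.succ) fun i => hf i.succ
    have hs := summable_mul_of_summable_norm (hf 0) h1
    have hsn : Summable fun p : α × (Fin n → α) => ‖f 0 p.1 * ∏ i, f (Fin.succ i) (p.2 i)‖ := by
      simpa [norm_mul] using (hf 0).mul_of_nonneg h1 (fun _ => norm_nonneg _) fun _ => norm_nonneg _
    constructor
    · rw [← (Fin.consEquiv fun _ => α).summable_iff]
      refine hsn.congr fun p => ?_
      simp [Fin.prod_univ_succ, Fin.consEquiv]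
    · rw [← (Fin.consEquiv fun _ => α).tsum_eq, Fin.prod_univ_succ, ← h2,
        tsum_mul_tsum_of_summable_norm (hf 0) h1]
      refine tsum_congr fun p => ?_
      simp [Fin.prod_univ_succ, Fin.consEquiv]

theorem summable_pi_prod {α 𝕜 : Type*} [RCLike 𝕜] {n : ℕ} (f : Fin n → α → 𝕜)
    (hf : ∀ i, Summable fun a => ‖f i a‖) : Summable fun z : Fin n → α => ∏ i, f i (z i) :=
  (summable_norm_pi_prod f hf).1.of_norm

theorem tsum_pi_prod {α 𝕜 : Type*} [RCLike 𝕜] {n : ℕ} (f : Fin n → α → 𝕜)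
    (hf : ∀ i, Summable fun a => ‖f i a‖) :
    ∑' z : Fin n → α, ∏ i, f i (z i) = ∏ i, ∑' a, f i a :=
  (summable_norm_pi_prod f hf).2

/-! ### One-dimensional Gaussian sums -/

theorem rho_pos (σ t : ℝ) : 0 < rho σ t := exp_pos _

theorem rho_zero (σ : ℝ) : rho σ 0 = 1 := by simp [rho]

theorem rho_le_one (σ t : ℝ) : rho σ t ≤ 1 := by
  rw [rho, exp_le_one_iff, neg_mul, neg_div, neg_nonpos]
  positivity

theorem rho_anti {σ a b : ℝ} (ha : 0 ≤ a) (hab : a ≤ b) : rho σ b ≤ rho σ a := by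
  rw [rho, rho, exp_le_exp, neg_mul, neg_mul, neg_div, neg_div, neg_le_neg_iff]
  gcongr

theorem rho_mono_width {σ τ : ℝ} (hσ : 0 < σ) (h : σ ≤ τ) (t : ℝ) : rho σ t ≤ rho τ t := by
  rw [rho, rho, exp_le_exp, neg_mul, neg_div, neg_div, neg_le_neg_iff]
  gcongr

theorem rho_mul (σ t : ℝ) {r : ℝ} (hr : r ≠ 0) : rho (σ * r) (t * r) = rho σ t := by
  rw [rho, rho, mul_pow, mul_pow, ← mul_assoc, mul_div_mul_right _ _ (pow_ne_zero 2 hr)]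

/-- The shifted Gaussian is dominated by a centred one of larger width, since
`(k + c)² ≥ k² / 2 - c²`. -/
theorem summable_rho_int {σ : ℝ} (hσ : 0 < σ) (c : ℝ) :
    Summable fun k : ℤ => rho σ ((k : ℝ) + c) := by
  have h := summable_pow_mul_jacobiTheta₂_term_bound 0 (T := 1 / (2 * σ ^ 2)) (by positivity) 0
  refine Summable.of_nonneg_of_le (fun _ => (rho_pos _ _).le) (fun k => ?_)
    (h.mul_left (exp (π * c ^ 2 / σ ^ 2)))
  simp only [pow_zero, one_mul, mul_zero, zero_mul, sub_zero]
  rw [rho, ← exp_add, exp_le_exp]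
  have : (k : ℝ) ^ 2 / 2 - c ^ 2 ≤ (k + c) ^ 2 := by nlinarith [sq_nonneg ((k : ℝ) + 2 * c)]
  have h2 : π / σ ^ 2 * ((k : ℝ) ^ 2 / 2 - c ^ 2) ≤ π / σ ^ 2 * (k + c) ^ 2 := by gcongr
  have e1 : -π * ((k : ℝ) + c) ^ 2 / σ ^ 2 = -(π / σ ^ 2 * (k + c) ^ 2) := by ring
  have e2 : π * c ^ 2 / σ ^ 2 + -π * (1 / (2 * σ ^ 2) * (k : ℝ) ^ 2) =
      -(π / σ ^ 2 * ((k : ℝ) ^ 2 / 2 - c ^ 2)) := by field_simp; ring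
  rw [e1, e2]
  linarith

theorem summable_rho_int' {σ : ℝ} (hσ : 0 < σ) : Summable fun k : ℤ => rho σ k := by
  simpa using summable_rho_int hσ 0

/-- Poisson summation for the Gaussian on `ℤ`, with a frequency shift `x`. -/
theorem tsum_rho_mul_exp {σ : ℝ} (hσ : 0 < σ) (x : ℝ) :
    ∑' k : ℤ, (rho σ k : ℂ) * Complex.exp (2 * π * Complex.I * k * x) =
      (σ * ∑' k : ℤ, rho (1 / σ) ((k : ℝ) + x) : ℝ) := by
  have ha : 0 < ((1 / σ ^ 2 : ℝ) : ℂ).re := by rw [Complex.ofReal_re]; positivity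
  have h := Complex.tsum_exp_neg_quadratic ha (-Complex.I * x)
  have hsq : (((1 / σ ^ 2 : ℝ) : ℂ)) ^ (1 / 2 : ℂ) = ((1 / σ : ℝ) : ℂ) := by
    rw [show (1 / 2 : ℂ) = ((1 / 2 : ℝ) : ℂ) by push_cast; rfl,
        ← Complex.ofReal_cpow (by positivity),
      ← Real.sqrt_eq_rpow, Real.sqrt_div zero_le_one, Real.sqrt_one, Real.sqrt_sq hσ.le]
  rw [hsq] at h
  have hσc : (σ : ℂ) ≠ 0 := by exact_mod_cast hσ.ne'
  -- Negating the summation index matches the sign of the phase in Mathlib's formula.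
  rw [← (Equiv.neg ℤ).tsum_eq]
  calc _ = ∑' n : ℤ, Complex.exp (-π * ((1 / σ ^ 2 : ℝ) : ℂ) * (n : ℂ) ^ 2 +
        2 * π * (-Complex.I * x) * n) := by
        refine tsum_congr fun k => ?_
        rw [rho, Complex.ofReal_exp, ← Complex.exp_add]
        congr 1
        simp only [Equiv.neg_apply]
        push_cast
        field_simp
    _ = _ := by
        rw [h, Complex.ofReal_mul, Complex.ofReal_tsum]
        congr 1
        · push_cast; simp
        · refine tsum_congr fun k => ?_
          rw [rho, Complex.ofReal_exp]
          congr 1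
          push_cast
          have : (k : ℂ) + Complex.I * (-Complex.I * x) = k + x := by
            rw [← mul_assoc, mul_neg, Complex.I_mul_I]; ring
          rw [this]
          field_simp

/-- A shift does not increase the Gaussian sum over `ℤ`: on the Fourier side it only multiplies the
positive terms by phases. -/
theorem tsum_rho_shift_le {σ : ℝ} (hσ : 0 < σ) (c : ℝ) :
    ∑' k : ℤ, rho σ ((k : ℝ) + c) ≤ ∑' k : ℤ, rho σ k := by
  have hi : 0 < 1 / σ := by positivity
  have h1 := tsum_rho_mul_exp hi c
  have h0 := tsum_rho_mul_exp hi 0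
  simp only [one_div_one_div] at h1 h0
  have hsum := summable_rho_int' hi
  have key : ‖∑' k : ℤ, (rho (1 / σ) k : ℂ) * Complex.exp (2 * π * Complex.I * k * c)‖ ≤
      ∑' k : ℤ, rho (1 / σ) k := by
    have hn : ∀ k : ℤ, ‖(rho (1 / σ) k : ℂ) * Complex.exp (2 * π * Complex.I * k * c)‖ =
        rho (1 / σ) k := fun k => by
      rw [norm_mul, show 2 * π * Complex.I * k * c = ((2 * π * k * c : ℝ) : ℂ) * Complex.I by
        push_cast; ring, Complex.norm_exp_ofReal_mul_I, mul_one, Complex.norm_real,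
        Real.norm_of_nonneg (rho_pos _ _).le]
    refine (norm_tsum_le_tsum_norm (hsum.congr fun k => (hn k).symm)).trans_eq (tsum_congr hn)
  have hz : ∑' k : ℤ, rho (1 / σ) k = 1 / σ * ∑' k : ℤ, rho σ k := by
    have : ((∑' k : ℤ, rho (1 / σ) k : ℝ) : ℂ) = ((1 / σ * ∑' k : ℤ, rho σ k : ℝ) : ℂ) := by
      simpa [Complex.ofReal_tsum] using h0
    exact_mod_cast this
  rw [h1, hz, Complex.norm_real, Real.norm_of_nonneg
    (mul_nonneg hi.le (tsum_nonneg fun _ => (rho_pos _ _).le))] at key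
  exact le_of_mul_le_mul_left key hi

/-- The sum of a Gaussian against a character of `ℤ/q` is a Gaussian sum over a residue class. -/
theorem tsum_rho_mul_stdAddChar {q : ℕ} [NeZero q] {s : ℝ} (hs : 0 < s) (a : ZMod q) :
    ∑' k : ℤ, (rho (q * s) k : ℂ) * ZMod.stdAddChar ((k : ZMod q) * a) =
      (q * s * ∑' k : ℤ, (if (k : ZMod q) = a then rho (1 / s) k else 0) : ℝ) := by
  have hq : (0 : ℝ) < q := by exact_mod_cast Nat.pos_of_ne_zero (NeZero.ne q)
  have h := tsum_rho_mul_exp (mul_pos hq hs) (a.val / q)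
  convert h using 2
  · funext k
    congr 1
    have : (k : ZMod q) * a = ((k * a.val : ℤ) : ZMod q) := by simp
    rw [this, ZMod.stdAddChar_coe]
    congr 1
    push_cast
    ring
  · congr 1
    have hinj : Function.Injective fun k : ℤ => (q : ℤ) * k + a.val := fun x y hxy => by
      simpa [NeZero.ne q] using hxy
    rw [← hinj.tsum_eq]
    · refine tsum_congr fun k => ?_
      have : (((q : ℤ) * k + a.val : ℤ) : ZMod q) = a := by simp
      rw [if_pos this, ← rho_mul (1 / (q * s)) _ hq.ne']
      congr 1
      · field_simp
      · push_cast; field_simp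
    · intro k hk
      have hk' : (k : ZMod q) = a := by
        by_contra hne
        simp [hne] at hk
      have h2 : ((k - a.val : ℤ) : ZMod q) = 0 := by simp [hk']
      obtain ⟨j, hj⟩ := (ZMod.intCast_zmod_eq_zero_iff_dvd _ _).1 h2
      exact ⟨j, by simp only; linarith⟩

/-! ### Gaussian sums over `q`-ary lattices and their cosets -/

theorem norm_toE_sq {m : ℕ} (z : Fin m → ℤ) : ‖toE z‖ ^ 2 = ∑ i, (z i : ℝ) ^ 2 := by
  rw [EuclideanSpace.norm_sq_eq]
  simp [toE]

theorem toE_zero {m : ℕ} : toE (0 : Fin m → ℤ) = 0 := by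
  ext i; simp [toE]

theorem toE_add {m : ℕ} (z w : Fin m → ℤ) : toE (z + w) = toE z + toE w := by
  ext i; simp [toE]

theorem toE_sub {m : ℕ} (z w : Fin m → ℤ) : toE (z - w) = toE z - toE w := by
  ext i; simp [toE]

theorem modQ_add {m q : ℕ} (z w : Fin m → ℤ) : modQ q (z + w) = modQ q z + modQ q w := by
  ext i; simp [modQ]

theorem modQ_sub {m q : ℕ} (z w : Fin m → ℤ) : modQ q (z - w) = modQ q z - modQ q w := by
  ext i; simp [modQ]

theorem rho_norm_toE {m : ℕ} (σ : ℝ) (z : Fin m → ℤ) :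
    rho σ ‖toE z‖ = ∏ i, rho σ (z i) := by
  simp only [rho]
  rw [norm_toE_sq, ← Real.exp_sum, Finset.mul_sum, Finset.sum_div]

theorem summable_rho_toE {m : ℕ} {σ : ℝ} (hσ : 0 < σ) :
    Summable fun z : Fin m → ℤ => rho σ ‖toE z‖ := by
  simp_rw [rho_norm_toE]
  exact summable_pi_prod (fun _ k => rho σ (k : ℤ)) fun _ => (summable_rho_int' hσ).norm

theorem summable_ite_of_nonneg {ι : Type*} {f : ι → ℝ} (hf : Summable f) (h0 : ∀ i, 0 ≤ f i)
    (P : ι → Prop) [DecidablePred P] : Summable fun i => if P i then f i else 0 :=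
  hf.of_nonneg_of_le (fun i => by split_ifs <;> simp [h0]) fun i => by
    split_ifs <;> simp [h0]

/-- `ρ_σ` of the set of integer vectors congruent to `u` modulo `q`. -/
noncomputable def cosetMass {m q : ℕ} (σ : ℝ) (u : Fin m → ZMod q) : ℝ :=
  ∑' z : Fin m → ℤ, if modQ q z = u then rho σ ‖toE z‖ else 0

/-- `ρ_σ(v + L_q(M))`, where each coset of `qℤ^m` is counted as often as it is represented
as `v + M x`. -/
noncomputable def spanMass {m d q : ℕ} [NeZero q] (σ : ℝ) (M : Matrix (Fin m) (Fin d) (ZMod q))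
    (v : Fin m → ZMod q) : ℝ := ∑ x : Fin d → ZMod q, cosetMass σ (v + M *ᵥ x)

section Coset

variable {m d q : ℕ}

theorem summable_coset {σ : ℝ} (hσ : 0 < σ) (u : Fin m → ZMod q) :
    Summable fun z : Fin m → ℤ => if modQ q z = u then rho σ ‖toE z‖ else 0 :=
  summable_ite_of_nonneg (summable_rho_toE hσ) (fun _ => (rho_pos _ _).le) _

theorem cosetMass_eq_prod {σ : ℝ} (hσ : 0 < σ) (u : Fin m → ZMod q) :
    cosetMass σ u = ∏ i, ∑' k : ℤ, if (k : ZMod q) = u i then rho σ k else 0 := by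
  rw [← tsum_pi_prod (fun i (k : ℤ) => if (k : ZMod q) = u i then rho σ k else 0) fun i =>
    (summable_ite_of_nonneg (summable_rho_int' hσ) (fun _ => (rho_pos _ _).le) _).norm, cosetMass]
  refine tsum_congr fun z => ?_
  simp only [modQ, funext_iff]
  split_ifs with h
  · rw [rho_norm_toE]
    exact Finset.prod_congr rfl fun i _ => by rw [if_pos (h i)]
  · obtain ⟨i, hi⟩ := not_forall.1 h
    exact (Finset.prod_eq_zero (Finset.mem_univ i) (if_neg hi)).symm

theorem cosetMass_nonneg (σ : ℝ) (u : Fin m → ZMod q) : 0 ≤ cosetMass σ u :=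
  tsum_nonneg fun z => by split_ifs <;> simp [(rho_pos _ _).le]

theorem cosetMass_zero_pos {σ : ℝ} (hσ : 0 < σ) : 0 < cosetMass σ (0 : Fin m → ZMod q) := by
  refine (summable_coset hσ _).tsum_pos (fun z => ?_) 0 ?_
  · split_ifs <;> simp [(rho_pos _ _).le]
  · rw [if_pos (by ext i; simp [modQ])]
    exact rho_pos _ _

theorem spanMass_zero_pos [NeZero q] {σ : ℝ} (hσ : 0 < σ) (M : Matrix (Fin m) (Fin d) (ZMod q)) :
    0 < spanMass σ M 0 :=
  Finset.sum_pos' (fun _ _ => cosetMass_nonneg _ _)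
    ⟨0, Finset.mem_univ _, by simpa using cosetMass_zero_pos hσ⟩

theorem stdAddChar_dotProduct [NeZero q] {ι : Type*} [Fintype ι] (u v : ι → ZMod q) :
    (ZMod.stdAddChar (u ⬝ᵥ v) : ℂ) = ∏ i, ZMod.stdAddChar (u i * v i) := by
  classical
  rw [dotProduct]
  induction (Finset.univ : Finset ι) using Finset.induction_on with
  | empty => simp
  | insert i t hi ih => rw [Finset.sum_insert hi, Finset.prod_insert hi, AddChar.map_add_eq_mul, ih]

/-- Orthogonality of characters on `(ℤ/q)^d`. -/
theorem sum_stdAddChar_dotProduct [NeZero q] (a : Fin d → ZMod q) :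
    ∑ x : Fin d → ZMod q, (ZMod.stdAddChar (a ⬝ᵥ x) : ℂ) = if a = 0 then (q : ℂ) ^ d else 0 := by
  simp_rw [stdAddChar_dotProduct]
  rw [← Fintype.prod_sum fun i x => (ZMod.stdAddChar (a i * x) : ℂ)]
  have h : ∀ i, ∑ x : ZMod q, (ZMod.stdAddChar (a i * x) : ℂ) = if a i = 0 then (q : ℂ) else 0 := by
    intro i
    have := AddChar.sum_mulShift (a i) (ZMod.isPrimitive_stdAddChar q)
    simpa [mul_comm, ZMod.card] using this
  simp_rw [h]
  split_ifs with h0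
  · simp [h0]
  · obtain ⟨i, hi⟩ := Function.ne_iff.1 h0
    exact Finset.prod_eq_zero (Finset.mem_univ i) (if_neg hi)

theorem tsum_rho_mul_character [NeZero q] {s : ℝ} (hs : 0 < s) (u : Fin m → ZMod q) :
    ∑' w : Fin m → ℤ, (rho (q * s) ‖toE w‖ : ℂ) * ZMod.stdAddChar (modQ q w ⬝ᵥ u) =
      ((q * s) ^ m * cosetMass (1 / s) u : ℝ) := by
  have hq : (0 : ℝ) < q := by exact_mod_cast Nat.pos_of_ne_zero (NeZero.ne q)
  rw [cosetMass_eq_prod (by positivity)]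
  have hsum : ∀ i, Summable fun k : ℤ =>
      ‖(rho (q * s) k : ℂ) * ZMod.stdAddChar ((k : ZMod q) * u i)‖ := fun i => by
    refine (summable_rho_int' (mul_pos hq hs)).congr fun k => ?_
    rw [norm_mul, AddChar.norm_apply, mul_one, Complex.norm_real,
      Real.norm_of_nonneg (rho_pos _ _).le]
  have h := tsum_pi_prod _ hsum
  simp_rw [tsum_rho_mul_stdAddChar hs] at h
  rw [← Complex.ofReal_prod, Finset.prod_mul_distrib] at h
  simp only [Finset.prod_const, Finset.card_univ, Fintype.card_fin] at h
  rw [← h]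
  refine tsum_congr fun w => ?_
  rw [rho_norm_toE, stdAddChar_dotProduct, Complex.ofReal_prod, ← Finset.prod_mul_distrib]
  rfl

theorem summable_rho_mul_character [NeZero q] {σ : ℝ} (hσ : 0 < σ) (u : Fin m → ZMod q) :
    Summable fun w : Fin m → ℤ => (rho σ ‖toE w‖ : ℂ) * ZMod.stdAddChar (modQ q w ⬝ᵥ u) := by
  refine Summable.of_norm ((summable_rho_toE hσ).congr fun w => ?_)
  rw [norm_mul, AddChar.norm_apply, mul_one, Complex.norm_real,
      Real.norm_of_nonneg (rho_pos _ _).le]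

theorem mem_dualQaryLattice {M : Matrix (Fin m) (Fin d) (ZMod q)} {w : Fin m → ℤ} :
    w ∈ dualQaryLattice M ↔ Mᵀ *ᵥ modQ q w = 0 := Iff.rfl

open Classical in
/-- The Poisson summation formula for `L_q^⊥(M)`, whose dual lattice is `q⁻¹ L_q(M)`. It reduces
to the one-dimensional formula because the indicator of `L_q^⊥(M)` is an average of characters
modulo `q`. -/
theorem poisson_dualQaryLattice [NeZero q] {s : ℝ} (hs : 0 < s)
    (M : Matrix (Fin m) (Fin d) (ZMod q)) (v : Fin m → ZMod q) :
    (q : ℂ) ^ d * ∑' w : Fin m → ℤ, (if w ∈ dualQaryLattice M then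
      (rho (q * s) ‖toE w‖ : ℂ) * ZMod.stdAddChar (modQ q w ⬝ᵥ v) else 0) =
      ((q * s) ^ m * spanMass (1 / s) M v : ℝ) := by
  have hq : (0 : ℝ) < q := by exact_mod_cast Nat.pos_of_ne_zero (NeZero.ne q)
  rw [spanMass, Finset.mul_sum, Complex.ofReal_sum]
  simp_rw [← tsum_rho_mul_character hs]
  rw [← Summable.tsum_finsetSum fun x _ => summable_rho_mul_character (mul_pos hq hs) _,
    ← tsum_mul_left]
  refine tsum_congr fun w => ?_
  have hx : ∀ x, (ZMod.stdAddChar (modQ q w ⬝ᵥ (v + M *ᵥ x)) : ℂ) =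
      ZMod.stdAddChar (modQ q w ⬝ᵥ v) * ZMod.stdAddChar ((Mᵀ *ᵥ modQ q w) ⬝ᵥ x) := fun x => by
    rw [dotProduct_add, AddChar.map_add_eq_mul, dotProduct_mulVec, mulVec_transpose]
  simp_rw [hx, ← mul_assoc]
  rw [← Finset.mul_sum, sum_stdAddChar_dotProduct]
  simp only [mem_dualQaryLattice]
  split_ifs
  · ring
  · simp

theorem re_stdAddChar [NeZero q] (a : ZMod q) :
    (ZMod.stdAddChar a : ℂ).re = cos (2 * π * (a.val : ℝ) / q) := by
  have h : ((a.val : ℤ) : ZMod q) = a := by simp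
  rw [← h, ZMod.stdAddChar_coe, h]
  rw [show 2 * π * Complex.I * ((a.val : ℤ) : ℂ) / q =
      ((2 * π * (a.val : ℝ) / q : ℝ) : ℂ) * Complex.I by
    push_cast; ring, Complex.exp_ofReal_mul_I_re]

open Classical in
theorem poisson_dualQaryLattice_cos [NeZero q] {s : ℝ} (hs : 0 < s)
    (M : Matrix (Fin m) (Fin d) (ZMod q)) (v : Fin m → ZMod q) :
    (q : ℝ) ^ d * ∑' w : Fin m → ℤ, (if w ∈ dualQaryLattice M then
      rho (q * s) ‖toE w‖ * cos (2 * π * ((modQ q w ⬝ᵥ v).val : ℝ) / q) else 0) =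
      (q * s) ^ m * spanMass (1 / s) M v := by
  have hq : (0 : ℝ) < q := by exact_mod_cast Nat.pos_of_ne_zero (NeZero.ne q)
  have h := congrArg Complex.re (poisson_dualQaryLattice hs M v)
  rw [Complex.ofReal_re] at h
  rw [← h, ← Complex.ofReal_natCast, ← Complex.ofReal_pow, Complex.re_ofReal_mul, Complex.re_tsum]
  · congr 1
    refine tsum_congr fun w => ?_
    split_ifs
    · rw [Complex.re_ofReal_mul, re_stdAddChar]
    · simp
  · refine Summable.of_norm_bounded (summable_rho_toE (mul_pos hq hs)) fun w => ?_
    split_ifs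
    · rw [norm_mul, AddChar.norm_apply, mul_one, Complex.norm_real,
        Real.norm_of_nonneg (rho_pos _ _).le]
    · simp [(rho_pos _ _).le]

open Classical in
theorem poisson_dualQaryLattice_zero [NeZero q] {s : ℝ} (hs : 0 < s)
    (M : Matrix (Fin m) (Fin d) (ZMod q)) :
    (q : ℝ) ^ d * ∑' w : Fin m → ℤ, (if w ∈ dualQaryLattice M then rho (q * s) ‖toE w‖ else 0) =
      (q * s) ^ m * spanMass (1 / s) M 0 := by
  simpa using poisson_dualQaryLattice_cos hs M 0

open Classical in
theorem rhoSet_eq_tsum (σ : ℝ) (S : Set (Fin m → ℤ)) :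
    rhoSet σ S = ∑' z : Fin m → ℤ, if z ∈ S then rho σ ‖toE z‖ else 0 := by
  rw [rhoSet, tsum_subtype S fun z => rho σ ‖toE z‖]
  rfl

theorem summable_rhoSet {σ : ℝ} (hσ : 0 < σ) (S : Set (Fin m → ℤ)) :
    Summable fun z : S => rho σ ‖toE z.1‖ := (summable_rho_toE hσ).subtype S

theorem rhoSet_pos {σ : ℝ} (hσ : 0 < σ) {S : Set (Fin m → ℤ)} (h0 : 0 ∈ S) : 0 < rhoSet σ S :=
  (summable_rhoSet hσ S).tsum_pos (fun _ => (rho_pos _ _).le) ⟨0, h0⟩ (rho_pos _ _)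

/-- The mean score of the samples is the normalized periodic Gaussian of `L_q(M)`. -/
theorem mean_cos_eq [NeZero q] {s : ℝ} (hs : 0 < s)
    (M : Matrix (Fin m) (Fin d) (ZMod q)) (v : Fin m → ZMod q) :
    ∑' w : Fin m → ℤ, discreteGaussian (dualQaryLattice M : Set (Fin m → ℤ)) (q * s) w *
      cos (2 * π * ((modQ q w ⬝ᵥ v).val : ℝ) / q) =
          spanMass (1 / s) M v / spanMass (1 / s) M 0 := by
  classical
  have hq : (0 : ℝ) < q := by exact_mod_cast Nat.pos_of_ne_zero (NeZero.ne q)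
  have h1 := poisson_dualQaryLattice_cos hs M v
  have h0 := poisson_dualQaryLattice_zero hs M
  have hz := rhoSet_eq_tsum (q * s) (dualQaryLattice M : Set (Fin m → ℤ))
  simp only [SetLike.mem_coe] at hz
  rw [← hz] at h0
  have hp : 0 < rhoSet (q * s) (dualQaryLattice M : Set (Fin m → ℤ)) :=
    rhoSet_pos (mul_pos hq hs) (zero_mem _)
  have hsp := spanMass_zero_pos (one_div_pos.2 hs) M
  have hl : ∀ w, discreteGaussian (dualQaryLattice M : Set (Fin m → ℤ)) (q * s) w *
      cos (2 * π * ((modQ q w ⬝ᵥ v).val : ℝ) / q) =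
      (if w ∈ dualQaryLattice M then
      rho (q * s) ‖toE w‖ * cos (2 * π * ((modQ q w ⬝ᵥ v).val : ℝ) / q) else 0) /
        rhoSet (q * s) (dualQaryLattice M : Set (Fin m → ℤ)) := fun w => by
    simp only [discreteGaussian, SetLike.mem_coe]
    split_ifs <;> ring
  simp_rw [hl]
  rw [tsum_div_const, div_eq_div_iff hp.ne' hsp.ne']
  have hqs : 0 < (q * s) ^ m := by positivity
  have hqd : 0 < (q : ℝ) ^ d := by positivity
  refine mul_left_cancel₀ hqs.ne' (mul_left_cancel₀ hqd.ne' ?_)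
  linear_combination (q * s) ^ m * spanMass (1 / s) M 0 * h1 -
      (q * s) ^ m * spanMass (1 / s) M v * h0

end Coset

/-! ### Shifts, widenings and tails of Gaussian sums -/

section MeanBounds

variable {m d q : ℕ}

/-- By the parallelogram law this is `cosh ≥ 1`. -/
theorem two_mul_rho_mul_rho_le (σ : ℝ) (z e : Fin m → ℤ) :
    2 * (rho σ ‖toE e‖ * rho σ ‖toE z‖) ≤ rho σ ‖toE (z + e)‖ + rho σ ‖toE (z - e)‖ := by
  rw [toE_add, toE_sub]
  simp only [rho]
  rw [norm_add_sq_real, norm_sub_sq_real, ← exp_add]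
  set a := ‖toE z‖ ^ 2
  set b := ‖toE e‖ ^ 2
  set c := inner ℝ (toE z) (toE e)
  have e1 : -π * (a + 2 * c + b) / σ ^ 2 = (-π * b / σ ^ 2 + -π * a / σ ^ 2) +
      -(2 * π * c / σ ^ 2) := by
    ring
  have e2 : -π * (a - 2 * c + b) / σ ^ 2 = (-π * b / σ ^ 2 + -π * a / σ ^ 2) +
      2 * π * c / σ ^ 2 := by
    ring
  rw [e1, e2, exp_add _ (-(2 * π * c / σ ^ 2)), exp_add _ (2 * π * c / σ ^ 2), ← mul_add,
    mul_comm 2]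
  gcongr
  linarith [add_one_le_exp (-(2 * π * c / σ ^ 2)), add_one_le_exp (2 * π * c / σ ^ 2)]

theorem cosetMass_modQ_add (σ : ℝ) (e : Fin m → ℤ) (u : Fin m → ZMod q) :
    cosetMass σ (modQ q e + u) =
      ∑' z : Fin m → ℤ, if modQ q z = u then rho σ ‖toE (z + e)‖ else 0 := by
  rw [cosetMass, ← (Equiv.addRight e).tsum_eq]
  refine tsum_congr fun z => ?_
  simp [modQ_add, add_comm (modQ q e)]

theorem cosetMass_modQ_sub (σ : ℝ) (e : Fin m → ℤ) (u : Fin m → ZMod q) :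
    cosetMass σ (modQ q e + -u) =
      ∑' z : Fin m → ℤ, if modQ q z = u then rho σ ‖toE (z - e)‖ else 0 := by
  rw [cosetMass, ← (Equiv.subLeft e).tsum_eq]
  refine tsum_congr fun z => ?_
  have h : (modQ q (e - z) = modQ q e + -u) ↔ modQ q z = u := by
    rw [modQ_sub, sub_eq_add_neg, add_right_inj, neg_inj]
  have h2 : ‖toE (e - z)‖ = ‖toE (z - e)‖ := by rw [toE_sub, toE_sub, norm_sub_rev]
  simp [h, h2]

variable [NeZero q] (M : Matrix (Fin m) (Fin d) (ZMod q))

theorem spanMass_mulVec_add (σ : ℝ) (y : Fin d → ZMod q) (v : Fin m → ZMod q) :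
    spanMass σ M (M *ᵥ y + v) = spanMass σ M v := by
  rw [spanMass, spanMass, ← Equiv.sum_comp (Equiv.addLeft y) fun x => cosetMass σ (v + M *ᵥ x)]
  refine Finset.sum_congr rfl fun x _ => ?_
  simp only [Equiv.coe_addLeft, mulVec_add]
  congr 1
  abel

/-- A shift by `e` costs the Gaussian mass of a lattice at most the factor `ρ_σ(e)`, since the
lattice is symmetric. -/
theorem rho_mul_spanMass_le {σ : ℝ} (hσ : 0 < σ) (e : Fin m → ℤ) :
    rho σ ‖toE e‖ * spanMass σ M 0 ≤ spanMass σ M (modQ q e) := by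
  have hS := summable_rho_toE (m := m) hσ
  have hadd : Summable fun z : Fin m → ℤ => rho σ ‖toE (z + e)‖ :=
    (Equiv.summable_iff (f := fun z => rho σ ‖toE z‖) (Equiv.addRight e)).2 hS
  have hsub : Summable fun z : Fin m → ℤ => rho σ ‖toE (z - e)‖ :=
    (Equiv.summable_iff (f := fun z => rho σ ‖toE z‖) (Equiv.subRight e)).2 hS
  -- The coset sum is averaged with its image under `z ↦ -z`.
  have h2 : 2 * spanMass σ M (modQ q e) =
      ∑ x, (cosetMass σ (modQ q e + M *ᵥ x) + cosetMass σ (modQ q e + -(M *ᵥ x))) := by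
    rw [Finset.sum_add_distrib, two_mul]
    congr 1
    rw [spanMass, ← Equiv.sum_comp (Equiv.neg (Fin d → ZMod q)) fun x =>
        cosetMass σ (modQ q e + M *ᵥ x)]
    simp [mulVec_neg]
  have h3 : 2 * (rho σ ‖toE e‖ * spanMass σ M 0) ≤ 2 * spanMass σ M (modQ q e) := by
    rw [h2, spanMass, Finset.mul_sum, Finset.mul_sum]
    refine Finset.sum_le_sum fun x _ => ?_
    rw [cosetMass_modQ_add, cosetMass_modQ_sub, cosetMass, zero_add, ← Summable.tsum_add
      (summable_ite_of_nonneg hadd (fun _ => (rho_pos _ _).le) _)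
      (summable_ite_of_nonneg hsub (fun _ => (rho_pos _ _).le) _), ← tsum_mul_left, ← tsum_mul_left]
    refine Summable.tsum_le_tsum (fun z => ?_)
      (((summable_coset hσ _).mul_left _).mul_left _)
      ((summable_ite_of_nonneg hadd (fun _ => (rho_pos _ _).le) _).add
      (summable_ite_of_nonneg hsub (fun _ => (rho_pos _ _).le) _))
    split_ifs
    · exact two_mul_rho_mul_rho_le σ z e
    · simp
  linarith

/-- Shifting a lattice does not increase its Gaussian mass, since the transform is positive. -/
theorem spanMass_le_zero {σ : ℝ} (hσ : 0 < σ) (v : Fin m → ZMod q) :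
    spanMass σ M v ≤ spanMass σ M 0 := by
  classical
  have hq : (0 : ℝ) < q := by exact_mod_cast Nat.pos_of_ne_zero (NeZero.ne q)
  have hs : 0 < 1 / σ := by positivity
  have h1 := poisson_dualQaryLattice_cos hs M v
  have h0 := poisson_dualQaryLattice_zero hs M
  rw [one_div_one_div] at h1 h0
  refine le_of_mul_le_mul_left (a := ((q : ℝ) * (1 / σ)) ^ m) ?_ (by positivity)
  rw [← h1, ← h0]
  have hS := summable_rho_toE (m := m) (mul_pos hq hs)
  refine mul_le_mul_of_nonneg_left (Summable.tsum_le_tsum (fun w => ?_) ?_ ?_) (by positivity)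
  · split_ifs
    · exact mul_le_of_le_one_right (rho_pos _ _).le (cos_le_one _)
    · rfl
  · refine Summable.of_norm_bounded hS fun w => ?_
    split_ifs
    · rw [norm_mul, Real.norm_of_nonneg (rho_pos _ _).le]
      exact mul_le_of_le_one_right (rho_pos _ _).le (abs_cos_le_one _)
    · simp [(rho_pos _ _).le]
  · exact summable_ite_of_nonneg hS (fun _ => (rho_pos _ _).le) _

/-- Widening the Gaussian by `κ` multiplies the mass of `L_q(M)` by at most `κ^m`: on the dual side
the Gaussian becomes narrower, and only the volume factor grows. -/
theorem spanMass_scale {σ κ : ℝ} (hσ : 0 < σ) (hκ : 1 ≤ κ) :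
    spanMass (κ * σ) M 0 ≤ κ ^ m * spanMass σ M 0 := by
  classical
  have hq : (0 : ℝ) < q := by exact_mod_cast Nat.pos_of_ne_zero (NeZero.ne q)
  have hκ0 : 0 < κ := by linarith
  have h0 := poisson_dualQaryLattice_zero (one_div_pos.2 hσ) M
  have h1 := poisson_dualQaryLattice_zero (one_div_pos.2 (mul_pos hκ0 hσ)) M
  rw [one_div_one_div] at h1 h0
  have hle : (1 / (κ * σ)) ≤ 1 / σ := by
    apply one_div_le_one_div_of_le hσ
    nlinarith
  have h2 : ((q : ℝ) * (1 / (κ * σ))) ^ m * spanMass (κ * σ) M 0 ≤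
      ((q : ℝ) * (1 / σ)) ^ m * spanMass σ M 0 := by
    rw [← h1, ← h0]
    refine mul_le_mul_of_nonneg_left (Summable.tsum_le_tsum (fun w => ?_)
      (summable_ite_of_nonneg (summable_rho_toE (by positivity)) (fun _ => (rho_pos _ _).le) _)
      (summable_ite_of_nonneg (summable_rho_toE (by positivity)) (fun _ => (rho_pos _ _).le) _))
      (by positivity)
    split_ifs
    · exact rho_mono_width (by positivity) (by gcongr) _
    · rfl
  have e1 : ((q : ℝ) * (1 / σ)) ^ m = ((q : ℝ) * (1 / (κ * σ))) ^ m * κ ^ m := by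
    rw [← mul_pow]; congr 1; field_simp
  rw [e1, mul_assoc] at h2
  exact le_of_mul_le_mul_left h2 (by positivity)

/-- The analogue of `spanMass_scale` for `L_q^⊥(M)`, with the two sides of the Poisson formula
interchanged. -/
theorem rhoSet_scale {σ κ : ℝ} (hσ : 0 < σ) (hκ : 1 ≤ κ) :
    rhoSet (κ * σ) (dualQaryLattice M : Set (Fin m → ℤ)) ≤
      κ ^ m * rhoSet σ (dualQaryLattice M : Set (Fin m → ℤ)) := by
  classical
  have hq : (0 : ℝ) < q := by exact_mod_cast Nat.pos_of_ne_zero (NeZero.ne q)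
  have hκ0 : 0 < κ := by linarith
  have h0 := poisson_dualQaryLattice_zero (div_pos hσ hq) M
  have h1 := poisson_dualQaryLattice_zero (div_pos (mul_pos hκ0 hσ) hq) M
  rw [mul_div_cancel₀ _ hq.ne', one_div_div] at h1 h0
  simp_rw [rhoSet_eq_tsum, SetLike.mem_coe]
  refine le_of_mul_le_mul_left (a := (q : ℝ) ^ d) ?_ (by positivity)
  rw [h1, mul_left_comm, h0, mul_pow, mul_assoc]
  refine mul_le_mul_of_nonneg_left (mul_le_mul_of_nonneg_left ?_ (by positivity)) (by positivity)
  refine Finset.sum_le_sum fun x _ => ?_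
  refine Summable.tsum_le_tsum (fun w => ?_) (summable_coset (by positivity) _)
    (summable_coset (by positivity) _)
  split_ifs
  · refine rho_mono_width (by positivity) ?_ _
    gcongr
    nlinarith
  · rfl

/-- Outside a ball of radius `r`, widening a Gaussian gains an exponential factor. -/
theorem rho_le_exp_mul_rho {σ κ r t : ℝ} (hκ : 1 ≤ κ) (hr : 0 ≤ r) (h : r ≤ t) :
    rho σ t ≤ exp (-π * (1 - (1 / κ) ^ 2) * r ^ 2 / σ ^ 2) * rho (κ * σ) t := by
  rw [rho, rho, ← exp_add, exp_le_exp]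
  have h1 : (1 / κ) ^ 2 ≤ 1 := by
    have : 1 / κ ≤ 1 := (div_le_one (by linarith)).2 hκ
    have h0 : 0 ≤ 1 / κ := by positivity
    nlinarith
  have h2 : r ^ 2 ≤ t ^ 2 := by gcongr
  have h3 : π / σ ^ 2 * (1 - (1 / κ) ^ 2) * r ^ 2 ≤ π / σ ^ 2 * (1 - (1 / κ) ^ 2) * t ^ 2 := by
    have : 0 ≤ 1 - (1 / κ) ^ 2 := by linarith
    gcongr
  have e1 : -π * t ^ 2 / (κ * σ) ^ 2 = -(π / σ ^ 2 * (1 / κ) ^ 2 * t ^ 2) := by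
    rw [mul_pow, div_pow, ← div_div]; ring
  have e2 : -π * (1 - (1 / κ) ^ 2) * r ^ 2 / σ ^ 2 =
      -(π / σ ^ 2 * (1 - (1 / κ) ^ 2) * r ^ 2) := by ring
  have e3 : -π * t ^ 2 / σ ^ 2 = -(π / σ ^ 2 * t ^ 2) := by ring
  rw [e1, e2, e3]
  linarith

/-- The optimization behind Banaszczyk's tail bound: the widening factor `κ = r / τ` turns the
product of the loss `κ^m` and of the gain at radius `r` into `ρ_σ(r - τ)`. -/
theorem pow_mul_exp_le_rho (hm : 0 < m) {σ r : ℝ} (hσ : 0 < σ) (hr : σ * √(m / (2 * π)) ≤ r) :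
    (r / (σ * √(m / (2 * π)))) ^ m *
      exp (-π * (1 - (1 / (r / (σ * √(m / (2 * π))))) ^ 2) * r ^ 2 / σ ^ 2) ≤
      rho σ (r - σ * √(m / (2 * π))) := by
  have hm' : (0 : ℝ) < m := by exact_mod_cast hm
  set τ := σ * √(m / (2 * π)) with hτ
  have hτ0 : 0 < τ := by positivity
  have hr0 : 0 < r := by linarith
  have hτ2 : τ ^ 2 = σ ^ 2 * (m / (2 * π)) := by rw [hτ, mul_pow, sq_sqrt (by positivity)]
  have hmτ : (m : ℝ) = π / σ ^ 2 * (2 * τ ^ 2) := by rw [hτ2]; field_simp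
  rw [one_div_div, ← exp_log (show 0 < (r / τ) ^ m by positivity), ← exp_add, rho, exp_le_exp,
      log_pow]
  have hlog : log (r / τ) ≤ r / τ - 1 := log_le_sub_one_of_pos (by positivity)
  have e1 : -π * (1 - (τ / r) ^ 2) * r ^ 2 / σ ^ 2 = -(π / σ ^ 2 * (r ^ 2 - τ ^ 2)) := by
    field_simp
  have e2 : -π * (r - τ) ^ 2 / σ ^ 2 = -(π / σ ^ 2 * (r - τ) ^ 2) := by ring
  rw [e1, e2, hmτ]
  have h3 : π / σ ^ 2 * (2 * τ ^ 2) * log (r / τ) ≤ π / σ ^ 2 * (2 * τ ^ 2) * (r / τ - 1) := by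
    gcongr
  have e3 : π / σ ^ 2 * (2 * τ ^ 2) * (r / τ - 1) = π / σ ^ 2 * (2 * τ * r - 2 * τ ^ 2) := by
    field_simp
  have e4 : π / σ ^ 2 * (2 * τ * r - 2 * τ ^ 2) + -(π / σ ^ 2 * (r ^ 2 - τ ^ 2)) =
    -(π / σ ^ 2 * (r - τ) ^ 2) := by ring
  linarith

/-- Banaszczyk's tail bound for a shift of `L_q(M)`. -/
theorem spanMass_le_rho_of_far (hm : 0 < m) {σ r : ℝ} (hσ : 0 < σ) (hr : σ * √(m / (2 * π)) ≤ r)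
    (v : Fin m → ZMod q)
    (hfar : ∀ (z : Fin m → ℤ) (x : Fin d → ZMod q), modQ q z = v + M *ᵥ x → r ≤ ‖toE z‖) :
    spanMass σ M v ≤ rho σ (r - σ * √(m / (2 * π))) * spanMass σ M 0 := by
  have hm' : (0 : ℝ) < m := by exact_mod_cast hm
  have hτ0 : 0 < σ * √(m / (2 * π)) := by positivity
  have hκ : 1 ≤ r / (σ * √(m / (2 * π))) := (one_le_div hτ0).2 hr
  have hb := pow_mul_exp_le_rho hm hσ hr
  have hr0 : 0 < r := hτ0.trans_le hr
  set κ := r / (σ * √(m / (2 * π)))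
  set E := exp (-π * (1 - (1 / κ) ^ 2) * r ^ 2 / σ ^ 2)
  have hκ0 : 0 < κ := by linarith
  calc spanMass σ M v ≤ E * spanMass (κ * σ) M v := by
        rw [spanMass, spanMass, Finset.mul_sum]
        refine Finset.sum_le_sum fun x _ => ?_
        rw [cosetMass, cosetMass, ← tsum_mul_left]
        refine Summable.tsum_le_tsum (fun z => ?_) (summable_coset hσ _)
          ((summable_coset (by positivity) _).mul_left _)
        split_ifs with h
        · exact rho_le_exp_mul_rho hκ hr0.le (hfar z x h)
        · simp
    _ ≤ E * (κ ^ m * spanMass σ M 0) := by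
        gcongr
        exact (spanMass_le_zero M (by positivity) v).trans (spanMass_scale M hσ hκ)
    _ = κ ^ m * E * spanMass σ M 0 := by ring
    _ ≤ _ := mul_le_mul_of_nonneg_right hb (spanMass_zero_pos hσ M).le

/-- Banaszczyk's tail bound for `L_q^⊥(M)`. -/
theorem rhoSet_tail_le (hm : 0 < m) {σ R : ℝ} (hσ : 0 < σ) (hR : σ * √(m / (2 * π)) ≤ R) :
    rhoSet σ (dualQaryLattice M : Set (Fin m → ℤ)) - rhoSet σ (truncated (dualQaryLattice M) R) ≤
      rho σ (R - σ * √(m / (2 * π))) * rhoSet σ (dualQaryLattice M : Set (Fin m → ℤ)) := by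
  classical
  have hm' : (0 : ℝ) < m := by exact_mod_cast hm
  have hτ0 : 0 < σ * √(m / (2 * π)) := by positivity
  have hκ : 1 ≤ R / (σ * √(m / (2 * π))) := (one_le_div hτ0).2 hR
  have hb := pow_mul_exp_le_rho hm hσ hR
  have hr0 : 0 < R := hτ0.trans_le hR
  set κ := R / (σ * √(m / (2 * π)))
  set E := exp (-π * (1 - (1 / κ) ^ 2) * R ^ 2 / σ ^ 2)
  have hκ0 : 0 < κ := by linarith
  have hL0 : 0 < rhoSet σ (dualQaryLattice M : Set (Fin m → ℤ)) := rhoSet_pos hσ (zero_mem _)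
  have hS : ∀ {σ : ℝ} (_ : 0 < σ) (S : Set (Fin m → ℤ)),
      Summable fun z : Fin m → ℤ => if z ∈ S then rho σ ‖toE z‖ else 0 := fun h S =>
    summable_ite_of_nonneg (summable_rho_toE h) (fun _ => (rho_pos _ _).le) _
  calc _ ≤ E * rhoSet (κ * σ) (dualQaryLattice M : Set (Fin m → ℤ)) := by
        simp_rw [rhoSet_eq_tsum]
        rw [← Summable.tsum_sub (hS hσ _) (hS hσ _), ← tsum_mul_left]
        refine Summable.tsum_le_tsum (fun z => ?_) ((hS hσ _).sub (hS hσ _))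
          ((hS (by positivity) _).mul_left _)
        simp only [truncated, Set.mem_ofPred_eq, SetLike.mem_coe]
        by_cases hz : z ∈ dualQaryLattice M
        · by_cases hzR : ‖toE z‖ ≤ R
          · simp only [hz, hzR, and_self, if_true, sub_self]
            exact mul_nonneg (exp_pos _).le (rho_pos _ _).le
          · simp only [hz, hzR, and_false, if_true, if_false, sub_zero]
            exact rho_le_exp_mul_rho hκ hr0.le (not_le.1 hzR).le
        · simp [hz]
    _ ≤ E * (κ ^ m * rhoSet σ (dualQaryLattice M : Set (Fin m → ℤ))) := by
        gcongr
        exact rhoSet_scale M hσ hκ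
    _ = κ ^ m * E * rhoSet σ (dualQaryLattice M : Set (Fin m → ℤ)) := by ring
    _ ≤ _ := mul_le_mul_of_nonneg_right hb hL0.le

end MeanBounds

/-! ### Gram–Schmidt coordinates and Klein's distribution -/

section Klein

variable {m : ℕ}

/-- A basis of `L_q^⊥(M)` is linearly independent over `ℝ`, since the lattice contains `qℤ^m` and so
spans the space. -/
theorem linearIndependent_bvec {d q : ℕ} [NeZero q] {M : Matrix (Fin m) (Fin d) (ZMod q)}
    (B : Module.Basis (Fin m) ℤ (dualQaryLattice M)) : LinearIndependent ℝ (bvec B) := by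
  refine linearIndependent_of_top_le_span_of_card_eq_finrank ?_ (by simp)
  have hmem : ∀ z : dualQaryLattice M, toE z.1 ∈ Submodule.span ℝ (Set.range (bvec B)) := by
    intro z
    have hz : toE z.1 = ∑ i, ((B.repr z i : ℤ) : ℝ) • bvec B i := by
      have h := congrArg Subtype.val (B.sum_repr z)
      ext k
      have hk := congrFun h k
      simp only [Submodule.coe_sum, Submodule.coe_smul, Finset.sum_apply, Pi.smul_apply,
        smul_eq_mul] at hk
      simp only [toE, bvec, WithLp.ofLp_sum, WithLp.ofLp_smul, Finset.sum_apply, Pi.smul_apply,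
        smul_eq_mul]
      rw [← hk]
      push_cast
      rfl
    rw [hz]
    exact Submodule.sum_mem _ fun i _ => Submodule.smul_mem _ _ (Submodule.subset_span ⟨i, rfl⟩)
  have hqE : ∀ i : Fin m, EuclideanSpace.single i (1 : ℝ) ∈
      Submodule.span ℝ (Set.range (bvec B)) := by
    intro i
    have hL : (Pi.single i (q : ℤ) : Fin m → ℤ) ∈ dualQaryLattice M := by
      rw [mem_dualQaryLattice]
      have : modQ q (Pi.single i (q : ℤ)) = 0 := by
        ext k
        by_cases hk : k = i
        · subst hk; simp [modQ]
        · simp [modQ, hk]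
      rw [this, mulVec_zero]
    have h := Submodule.smul_mem _ ((q : ℝ)⁻¹) (hmem ⟨_, hL⟩)
    convert h using 1
    ext k
    have hq : (q : ℝ) ≠ 0 := by exact_mod_cast NeZero.ne q
    by_cases hk : k = i
    · subst hk; simp [toE, hq]
    · simp [toE, hk]
  intro v _
  have hv : v = ∑ i, v i • EuclideanSpace.single i (1 : ℝ) := by
    ext k
    simp [Pi.single_apply]
  rw [hv]
  exact Submodule.sum_mem _ fun i _ => Submodule.smul_mem _ _ (hqE i)

theorem gs_ne_zero {d q : ℕ} [NeZero q] {M : Matrix (Fin m) (Fin d) (ZMod q)}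
    (B : Module.Basis (Fin m) ℤ (dualQaryLattice M)) (i : Fin m) : gs B i ≠ 0 :=
  InnerProductSpace.gramSchmidt_ne_zero i (linearIndependent_bvec B)

variable {L : Submodule ℤ (Fin m → ℤ)} (B : Module.Basis (Fin m) ℤ L)

theorem toE_latVec (x : Fin m → ℤ) : toE (latVec B x) = ∑ j, (x j : ℝ) • bvec B j := by
  ext k
  simp [toE, bvec, latVec, WithLp.ofLp_sum, Finset.sum_apply]

theorem latVec_mem (x : Fin m → ℤ) : latVec B x ∈ L := Subtype.property _

theorem latVec_injective : Function.Injective (latVec B) := fun x y hxy => by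
  have h2 : (∑ i, x i • B i : L) = ∑ i, y i • B i := Subtype.ext hxy
  rw [← B.equivFun_symm_apply, ← B.equivFun_symm_apply] at h2
  exact B.equivFun.symm.injective h2

theorem exists_latVec_eq {z : Fin m → ℤ} (hz : z ∈ L) : ∃ x, latVec B x = z :=
  ⟨B.equivFun ⟨z, hz⟩, by rw [latVec, ← B.equivFun_symm_apply, LinearEquiv.symm_apply_apply]⟩

/-- The coordinates of `B x` with respect to the Gram–Schmidt vectors are `xᵢ - μᵢ(x)`, with the
centres of Klein's sampler. -/
theorem toE_latVec_eq_sum_gs (x : Fin m → ℤ) :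
    toE (latVec B x) = ∑ i, ((x i : ℝ) - kleinCenter B x i) • gs B i := by
  have hb : ∀ j, bvec B j = gs B j +
      ∑ i ∈ Finset.Iio j, (inner ℝ (gs B i) (bvec B j) / ‖gs B i‖ ^ 2) • gs B i := fun j => by
    simpa [gs] using InnerProductSpace.gramSchmidt_def'' ℝ (bvec B) j
  have h2 : ∀ i, ((x i : ℝ) - kleinCenter B x i) • gs B i = (x i : ℝ) • gs B i +
      ∑ j ∈ Finset.Ioi i, (x j : ℝ) • (inner ℝ (gs B i) (bvec B j) / ‖gs B i‖ ^ 2) • gs B i := by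
    intro i
    rw [kleinCenter, neg_div, sub_neg_eq_add, add_smul, Finset.sum_div, Finset.sum_smul]
    congr 1
    refine Finset.sum_congr rfl fun j _ => ?_
    rw [smul_smul]
    congr 1
    ring
  rw [toE_latVec]
  simp_rw [h2]
  rw [Finset.sum_add_distrib, Finset.sum_comm' (t' := Finset.univ)
    (s' := fun j => Finset.Iio j) (by simp), ← Finset.sum_add_distrib]
  refine Finset.sum_congr rfl fun j _ => ?_
  conv_lhs => rw [hb j]
  rw [smul_add, Finset.smul_sum]

theorem norm_toE_latVec_sq (x : Fin m → ℤ) :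
    ‖toE (latVec B x)‖ ^ 2 = ∑ i, (((x i : ℝ) - kleinCenter B x i) * ‖gs B i‖) ^ 2 := by
  rw [toE_latVec_eq_sum_gs, ← real_inner_self_eq_norm_sq, sum_inner]
  refine Finset.sum_congr rfl fun i _ => ?_
  rw [inner_sum, Finset.sum_eq_single i]
  · rw [real_inner_smul_left, real_inner_smul_right, real_inner_self_eq_norm_sq]
    ring
  · intro j _ hj
    rw [real_inner_smul_left, real_inner_smul_right,
      show inner ℝ (gs B i) (gs B j) = 0 from
        InnerProductSpace.gramSchmidt_orthogonal ℝ (bvec B) hj.symm]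
    ring
  · simp

variable (hgs : ∀ i, gs B i ≠ 0)
include hgs

/-- The Gaussian weight of `B x` is the numerator of Klein's mass function at `x`. -/
theorem rho_latVec_eq_prod (σ : ℝ) (x : Fin m → ℤ) :
    rho σ ‖toE (latVec B x)‖ = ∏ i, rho (σ / ‖gs B i‖) ((x i : ℝ) - kleinCenter B x i) := by
  have h : ∀ i, rho (σ / ‖gs B i‖) ((x i : ℝ) - kleinCenter B x i) =
      rho σ (((x i : ℝ) - kleinCenter B x i) * ‖gs B i‖) := fun i => by
    have hn : ‖gs B i‖ ≠ 0 := norm_ne_zero_iff.2 (hgs i)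
    rw [← rho_mul _ _ hn, div_mul_cancel₀ _ hn]
  simp_rw [h, rho]
  rw [norm_toE_latVec_sq, ← Real.exp_sum, Finset.mul_sum, Finset.sum_div]

omit hgs in
theorem rhoInt_pos {σ : ℝ} (hσ : 0 < σ) (c : ℝ) : 0 < rhoInt σ c :=
  (by simpa [sub_eq_add_neg] using summable_rho_int hσ (-c) :
    Summable fun k : ℤ => rho σ ((k : ℝ) - c)).tsum_pos (fun _ => (rho_pos _ _).le) 0 (rho_pos _ _)

omit hgs in
theorem rhoInt_le {σ : ℝ} (hσ : 0 < σ) (c : ℝ) : rhoInt σ c ≤ rhoInt σ 0 := by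
  simpa [rhoInt, sub_eq_add_neg] using tsum_rho_shift_le hσ (-c)

theorem width_pos {σ : ℝ} (hσ : 0 < σ) (i : Fin m) : 0 < σ / ‖gs B i‖ :=
  div_pos hσ (norm_pos_iff.2 (hgs i))

theorem kleinMass_pos {σ : ℝ} (hσ : 0 < σ) (x : Fin m → ℤ) : 0 < kleinMass B σ x :=
  Finset.prod_pos fun i _ => div_pos (rho_pos _ _) (rhoInt_pos (width_pos B hgs hσ i) _)

omit hgs in
/-- A chain of conditional weights, each depending only on the later coordinates and summing to at
most one over its own coordinate, has total mass at most one. -/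
theorem sum_pi_prod_le_one {α : Type*} [Fintype α] :
    ∀ {n : ℕ} (f : Fin n → (Fin n → α) → ℝ), (∀ i x, 0 ≤ f i x) →
      (∀ i x y, (∀ j, i ≤ j → x j = y j) → f i x = f i y) →
      (∀ i x, ∑ a, f i (Function.update x i a) ≤ 1) → ∑ x, ∏ i, f i x ≤ 1
  | 0, f, _, _, _ => by simp
  | n + 1, f, h0, hdep, h1 => by
    rcases isEmpty_or_nonempty α with hα | ⟨⟨a₀⟩⟩
    · simp
    rw [← (Fin.consEquiv fun _ : Fin (n + 1) => α).sum_comp, Fintype.sum_prod_type_right]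
    have hs : ∀ (a : α) (y : Fin n → α) (i : Fin n),
        f i.succ (Fin.cons a y) = f i.succ (Fin.cons a₀ y) := fun a y i => by
      refine hdep _ _ _ fun j hj => ?_
      obtain ⟨k, rfl⟩ := Fin.exists_succ_eq.2 (((Fin.succ_pos i).trans_le hj).ne')
      simp
    have hstep : ∀ y : Fin n → α, ∑ a : α, ∏ i,
        f i ((Fin.consEquiv fun _ : Fin (n + 1) => α) (a, y)) ≤
        ∏ i : Fin n, f i.succ (Fin.cons a₀ y) := fun y => by
      simp only [Fin.consEquiv, Equiv.coe_fn_mk, Fin.prod_univ_succ, hs]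
      rw [← Finset.sum_mul]
      refine mul_le_of_le_one_left (Finset.prod_nonneg fun i _ => h0 _ _) ?_
      simpa [Fin.update_cons_zero] using h1 0 (Fin.cons a₀ y)
    refine (Finset.sum_le_sum fun y _ => hstep y).trans ?_
    refine sum_pi_prod_le_one (fun i (y : Fin n → α) => f i.succ (Fin.cons a₀ y)) (fun _ _ =>
        h0 _ _)
      (fun i x y hxy => hdep _ _ _ fun j hj => ?_) fun i x => ?_
    · obtain ⟨k, rfl⟩ := Fin.exists_succ_eq.2 (((Fin.succ_pos i).trans_le hj).ne')
      simpa using hxy k (Fin.succ_le_succ_iff.1 hj)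
    · simpa [Fin.cons_update] using h1 i.succ (Fin.cons a₀ x)

omit hgs in
theorem kleinCenter_congr {x y : Fin m → ℤ} {i : Fin m} (h : ∀ j, i < j → x j = y j) :
    kleinCenter B x i = kleinCenter B y i := by
  rw [kleinCenter, kleinCenter]
  congr 2
  exact Finset.sum_congr rfl fun j hj => by rw [h j (Finset.mem_Ioi.1 hj)]

/-- Klein's distribution has total mass at most one. -/
theorem kleinBall_le_one {σ : ℝ} (hσ : 0 < σ) (R : ℝ) : kleinBall B σ R ≤ 1 := by
  classical
  obtain ⟨K, hK⟩ : ∃ K : Finset ℤ, ∀ (x : Coeffs B R) (i : Fin m), x.1 i ∈ K :=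
    ⟨Finset.univ.biUnion fun x : Coeffs B R => Finset.univ.image x.1, fun x i => by
      simp only [Finset.mem_biUnion, Finset.mem_univ, Finset.mem_image, true_and]
      exact ⟨x, i, rfl⟩⟩
  have h := sum_pi_prod_le_one (α := K) (fun i x => rho (σ / ‖gs B i‖)
      ((x i : ℝ) - kleinCenter B (fun j => x j) i) /
    rhoInt (σ / ‖gs B i‖) (kleinCenter B (fun j => x j) i))
    (fun i x => (div_pos (rho_pos _ _) (rhoInt_pos (width_pos B hgs hσ i) _)).le)
    (fun i x y hxy => by
      rw [hxy i le_rfl, kleinCenter_congr B (y := fun j => (y j : ℤ)) fun j hj =>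
          by rw [hxy j hj.le]])
    (fun i x => by
      have hc : ∀ a : K, kleinCenter B (fun j => (Function.update x i a j : ℤ)) i =
          kleinCenter B (fun j => x j) i := fun a =>
        kleinCenter_congr B fun j hj => by rw [Function.update_of_ne hj.ne']
      simp only [hc, Function.update_self]
      rw [← Finset.sum_div, div_le_one (rhoInt_pos (width_pos B hgs hσ i) _), rhoInt]
      rw [Finset.sum_coe_sort K fun a : ℤ =>
          rho (σ / ‖gs B i‖) ((a : ℝ) - kleinCenter B (fun j => x j) i)]
      exact Summable.sum_le_tsum _ (fun _ _ => (rho_pos _ _).le)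
        (by simpa [sub_eq_add_neg] using summable_rho_int (width_pos B hgs hσ i) _))
  refine le_trans ?_ h
  let φ : Coeffs B R → (Fin m → K) := fun x i => ⟨x.1 i, hK x i⟩
  have hφ : Function.Injective φ := fun x y hxy => Subtype.ext (funext fun i =>
    congrArg Subtype.val (congrFun hxy i))
  rw [kleinBall]
  calc _ = ∑ y ∈ Finset.univ.map ⟨φ, hφ⟩, kleinMass B σ fun i => y i := by
        rw [Finset.sum_map]; rfl
    _ ≤ ∑ y : Fin m → K, kleinMass B σ fun i => y i :=
        Finset.sum_le_univ_sum_of_nonneg fun _ => (kleinMass_pos B hgs hσ _).le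
    _ = _ := rfl

omit hgs in
theorem latVec_zero : latVec B 0 = 0 := by simp [latVec]

/-- The zero coefficient vector. -/
noncomputable def zeroCoeff {R : ℝ} (hR : 0 ≤ R) : Coeffs B R := ⟨0, by
  rw [latVec_zero, toE_zero, norm_zero]; exact hR⟩

theorem kleinBall_pos {σ R : ℝ} (hσ : 0 < σ) (hR : 0 ≤ R) : 0 < kleinBall B σ R :=
  Finset.sum_pos (fun x _ => kleinMass_pos B hgs hσ x.1) ⟨zeroCoeff B hR, Finset.mem_univ _⟩

omit hgs in
theorem sum_coeffs_eq_tsum (f : (Fin m → ℤ) → ℝ) (R : ℝ) :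
    ∑ x : Coeffs B R, f (latVec B x.1) = ∑' z : truncated L R, f z.1 := by
  let e : Coeffs B R ≃ truncated L R := Equiv.ofBijective
    (fun x => ⟨latVec B x.1, latVec_mem B _, x.2⟩)
    ⟨fun x y h => Subtype.ext (latVec_injective B (by
      have h' := congrArg Subtype.val h
      exact h')), fun z => by
      obtain ⟨x, hx⟩ := exists_latVec_eq B z.2.1
      exact ⟨⟨x, by rw [hx]; exact z.2.2⟩, Subtype.ext hx⟩⟩
  rw [← e.tsum_eq, tsum_fintype]
  rfl

omit hgs in
theorem sum_rho_coeffs (σ R : ℝ) :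
    ∑ x : Coeffs B R, rho σ ‖toE (latVec B x.1)‖ = rhoSet σ (truncated L R) :=
  sum_coeffs_eq_tsum B (fun z => rho σ ‖toE z‖) R

omit hgs in
theorem zero_mem_truncated {R : ℝ} (hR : 0 ≤ R) : (0 : Fin m → ℤ) ∈ truncated L R :=
  ⟨zero_mem _, by rw [toE_zero, norm_zero]; exact hR⟩

theorem DeltaR_pos {σ R : ℝ} (hσ : 0 < σ) (hR : 0 ≤ R) : 0 < DeltaR B σ R :=
  div_pos (rhoSet_pos hσ (zero_mem_truncated hR))
    (Finset.prod_pos fun i _ => rhoInt_pos (width_pos B hgs hσ i) _)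

/-- The cost bound in terms of `Δ_R` rests on this inequality. -/
theorem DeltaR_le_pR {σ R : ℝ} (hσ : 0 < σ) (hR : 0 ≤ R) : DeltaR B σ R ≤ pR B σ R :=
  le_div_self (DeltaR_pos B hgs hσ hR).le (kleinBall_pos B hgs hσ hR) (kleinBall_le_one B hgs hσ R)

theorem pR_pos {σ R : ℝ} (hσ : 0 < σ) (hR : 0 ≤ R) : 0 < pR B σ R :=
  (DeltaR_pos B hgs hσ hR).trans_le (DeltaR_le_pR B hgs hσ hR)

theorem kleinTrunc_pos {σ R : ℝ} (hσ : 0 < σ) (hR : 0 ≤ R) (x : Coeffs B R) :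
    0 < kleinTrunc B σ R x := div_pos (kleinMass_pos B hgs hσ _) (kleinBall_pos B hgs hσ hR)

theorem sum_kleinTrunc {σ R : ℝ} (hσ : 0 < σ) (hR : 0 ≤ R) :
    ∑ x : Coeffs B R, kleinTrunc B σ R x = 1 := by
  simp_rw [kleinTrunc]
  rw [← Finset.sum_div]
  exact div_self (kleinBall_pos B hgs hσ hR).ne'

omit hgs in
theorem sum_targetTrunc {σ R : ℝ} (hσ : 0 < σ) (hR : 0 ≤ R) :
    ∑ x : Coeffs B R, targetTrunc B σ R x = 1 := by
  simp_rw [targetTrunc, sum_rho_coeffs]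
  rw [← Finset.sum_div, sum_rho_coeffs]
  exact div_self (rhoSet_pos hσ (zero_mem_truncated hR)).ne'

theorem accept_mul_kleinTrunc {σ R : ℝ} (hσ : 0 < σ) (hR : 0 ≤ R) (x : Coeffs B R) :
    accept B σ R x * kleinTrunc B σ R x = pR B σ R * targetTrunc B σ R x := by
  rw [accept, mul_assoc, div_mul_cancel₀ _ (kleinTrunc_pos B hgs hσ hR x).ne']

theorem accept_nonneg {σ R : ℝ} (hσ : 0 < σ) (hR : 0 ≤ R) (x : Coeffs B R) :
    0 ≤ accept B σ R x := by
  refine mul_nonneg (pR_pos B hgs hσ hR).le (div_nonneg ?_ (kleinTrunc_pos B hgs hσ hR x).le)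
  exact div_nonneg (rho_pos _ _).le (Finset.sum_nonneg fun _ _ => (rho_pos _ _).le)

/-- Klein's acceptance probability is a quotient of shifted and unshifted one-dimensional
Gaussian sums, hence at most one. -/
theorem accept_le_one {σ R : ℝ} (hσ : 0 < σ) (hR : 0 ≤ R) (x : Coeffs B R) :
    accept B σ R x ≤ 1 := by
  have hD : 0 < ∏ i, rhoInt (σ / ‖gs B i‖) 0 :=
    Finset.prod_pos fun i _ => rhoInt_pos (width_pos B hgs hσ i) _
  have hC : 0 < ∏ i, rhoInt (σ / ‖gs B i‖) (kleinCenter B x.1 i) :=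
    Finset.prod_pos fun i _ => rhoInt_pos (width_pos B hgs hσ i) _
  have hS : 0 < rhoSet σ (truncated L R) := rhoSet_pos hσ (zero_mem_truncated hR)
  have hQ := kleinBall_pos B hgs hσ hR
  have hr := rho_pos σ ‖toE (latVec B x.1)‖
  have hk : kleinMass B σ x.1 = rho σ ‖toE (latVec B x.1)‖ /
      ∏ i, rhoInt (σ / ‖gs B i‖) (kleinCenter B x.1 i) := by
    rw [rho_latVec_eq_prod B hgs, kleinMass, Finset.prod_div_distrib]
  have h : accept B σ R x = (∏ i, rhoInt (σ / ‖gs B i‖) (kleinCenter B x.1 i)) /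
      ∏ i, rhoInt (σ / ‖gs B i‖) 0 := by
    rw [accept, pR, DeltaR, targetTrunc, kleinTrunc, sum_rho_coeffs, hk]
    field_simp
  rw [h, div_le_one hD]
  exact Finset.prod_le_prod (fun i _ => (rhoInt_pos (width_pos B hgs hσ i) _).le)
    fun i _ => rhoInt_le (width_pos B hgs hσ i) _

/-- The overall acceptance probability is `p_R`. -/
theorem sum_accept {σ R : ℝ} (hσ : 0 < σ) (hR : 0 ≤ R) :
    ∑ x : Coeffs B R, accept B σ R x * kleinTrunc B σ R x = pR B σ R := by
  simp_rw [accept_mul_kleinTrunc B hgs hσ hR]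
  rw [← Finset.mul_sum, sum_targetTrunc B hσ hR, mul_one]

theorem pR_le_one {σ R : ℝ} (hσ : 0 < σ) (hR : 0 ≤ R) : pR B σ R ≤ 1 := by
  rw [← sum_accept B hgs hσ hR, ← sum_kleinTrunc B hgs hσ hR]
  exact Finset.sum_le_sum fun x _ =>
    mul_le_of_le_one_left (kleinTrunc_pos B hgs hσ hR x).le (accept_le_one B hgs hσ hR x)

end Klein

/-! ### The quantum rejection sampling circuit -/

theorem arcsin_sqrt_pos {p : ℝ} (h0 : 0 < p) : 0 < arcsin √p := arcsin_pos.2 (sqrt_pos.2 h0)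

/-- The rotation angle for which amplitude amplification is exact. -/
noncomputable def qrsAngle (p : ℝ) : ℝ := π / (2 * (2 * (rounds p : ℝ) + 1))

theorem qrsAngle_pos (p : ℝ) : 0 < qrsAngle p := by
  unfold qrsAngle
  positivity

theorem qrsAngle_le_pi_div_two (p : ℝ) : qrsAngle p ≤ π / 2 := by
  unfold qrsAngle
  gcongr
  linarith [(Nat.cast_nonneg (rounds p) : (0 : ℝ) ≤ _)]

theorem qrsAngle_mul (p : ℝ) : (2 * (rounds p : ℝ) + 1) * qrsAngle p = π / 2 := by
  unfold qrsAngle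
  field_simp

theorem qrsAngle_le_arcsin {p : ℝ} (h0 : 0 < p) : qrsAngle p ≤ arcsin √p := by
  have ha := arcsin_sqrt_pos h0
  have h1 : π / (4 * arcsin √p) - 1 / 2 ≤ (rounds p : ℝ) := Nat.le_ceil _
  have h2 : π / (4 * arcsin √p) * (4 * arcsin √p) = π := div_mul_cancel₀ _ (by positivity)
  rw [qrsAngle, div_le_iff₀ (by positivity)]
  nlinarith

theorem sin_qrsAngle_pos (p : ℝ) : 0 < sin (qrsAngle p) :=
  sin_pos_of_pos_of_lt_pi (qrsAngle_pos p) (by linarith [qrsAngle_le_pi_div_two p, pi_pos])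

/-- The number of rounds is large enough for the required initial success probability to be at
most `p`, so that the auxiliary coin can lower `p` to it. -/
theorem sin_qrsAngle_sq_le {p : ℝ} (h0 : 0 < p) (h1 : p ≤ 1) : sin (qrsAngle p) ^ 2 ≤ p := by
  have hle : sin (qrsAngle p) ≤ √p := by
    have h := sin_le_sin_of_le_of_le_pi_div_two (by linarith [qrsAngle_pos p, pi_pos])
      (arcsin_le_pi_div_two _) (qrsAngle_le_arcsin h0)
    rwa [sin_arcsin (by linarith [sqrt_nonneg p]) (sqrt_le_one.2 h1)] at h
  calc sin (qrsAngle p) ^ 2 ≤ √p ^ 2 := by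
        gcongr
        exact (sin_qrsAngle_pos p).le
    _ = p := sq_sqrt h0.le

theorem auxBias_eq (p : ℝ) : auxBias p = sin (qrsAngle p) ^ 2 / p := rfl

theorem auxBias_nonneg {p : ℝ} (h0 : 0 < p) : 0 ≤ auxBias p := by
  rw [auxBias_eq]; positivity

theorem auxBias_le_one {p : ℝ} (h0 : 0 < p) (h1 : p ≤ 1) : auxBias p ≤ 1 := by
  rw [auxBias_eq, div_le_one h0]
  exact sin_qrsAngle_sq_le h0 h1

theorem rounds_le {p : ℝ} (h0 : 0 < p) (h1 : p ≤ 1) : (rounds p : ℝ) ≤ 2 / √p := by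
  have ha := arcsin_sqrt_pos h0
  have hs : 0 < √p := sqrt_pos.2 h0
  have hs1 : √p ≤ 1 := sqrt_le_one.2 h1
  have hle : √p ≤ arcsin √p := by
    have h := sin_le ha.le
    rwa [sin_arcsin (by linarith) hs1] at h
  have h3 : π / (4 * arcsin √p) ≤ 1 / √p := by
    rw [div_le_div_iff₀ (by positivity) hs]
    nlinarith [pi_le_four]
  have h4 : 1 ≤ 1 / √p := (one_le_div hs).2 hs1
  have h5 : 0 ≤ π / (4 * arcsin √p) - 1 / 2 := by
    have : arcsin √p ≤ π / 2 := arcsin_le_pi_div_two _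
    rw [sub_nonneg, div_le_div_iff₀ (by norm_num) (by positivity)]
    linarith
  have h6 := (Nat.ceil_lt_add_one h5).le
  have h7 : (2 : ℝ) / √p = 1 / √p + 1 / √p := by ring
  rw [h7]
  exact h6.trans (by linarith)

theorem rot_mul_conjTranspose {a : ℝ} (h0 : 0 ≤ a) (h1 : a ≤ 1) : (rot a)ᴴ * rot a = 1 := by
  have e1 : ((√a : ℝ) : ℂ) * ((√a : ℝ) : ℂ) = a := by
    rw [← Complex.ofReal_mul, mul_self_sqrt h0]
  have e2 : ((√(1 - a) : ℝ) : ℂ) * ((√(1 - a) : ℝ) : ℂ) = 1 - a := by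
    rw [← Complex.ofReal_mul, mul_self_sqrt (by linarith)]; push_cast; rfl
  ext i j
  cases i <;> cases j <;>
    simp [rot, Matrix.mul_apply, Complex.conj_ofReal, e1, e2] <;> ring

/-- The conjugated reflection `A S₀ A†` is the reflection in the state `A|i₀⟩`. -/
theorem conj_reflection_mulVec {ι : Type*} [Fintype ι] [DecidableEq ι] {A : Matrix ι ι ℂ}
    (hA : A * Aᴴ = 1) (i₀ : ι) (φ : ι → ℂ) :
    A *ᵥ ((Matrix.diagonal fun i => if i = i₀ then (-1 : ℂ) else 1) *ᵥ (Aᴴ *ᵥ φ)) =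
      φ - (2 * (star (A *ᵥ Pi.single i₀ 1) ⬝ᵥ φ)) • (A *ᵥ Pi.single i₀ 1) := by
  have h1 : (Aᴴ *ᵥ φ) i₀ = star (A *ᵥ Pi.single i₀ 1) ⬝ᵥ φ := by
    rw [star_mulVec, ← dotProduct_mulVec, Pi.star_single, star_one, single_one_dotProduct]
  have h2 : ∀ χ : ι → ℂ, (Matrix.diagonal fun i => if i = i₀ then (-1 : ℂ) else 1) *ᵥ χ =
      χ - (2 * χ i₀) • Pi.single i₀ 1 := fun χ => by
    ext i
    rw [mulVec_diagonal]
    by_cases h : i = i₀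
    · subst h; simp; ring
    · simp [h]
  rw [h2, mulVec_sub, mulVec_smul, mulVec_mulVec, hA, one_mulVec, h1]

section Circuit

variable {m : ℕ} {L : Submodule ℤ (Fin m → ℤ)} {B : Module.Basis (Fin m) ℤ L} {σ R : ℝ}
  (O : KleinOracle B σ R)

theorem gateMatrix_prep_apply (i j : Reg B R) :
    gateMatrix O .prep i j = if i.2 = j.2 then O.U i.1 j.1 else 0 := rfl

theorem gateMatrix_accRot_apply (i j : Reg B R) : gateMatrix O .accRot i j =
    if i.1 = j.1 ∧ i.2.2 = j.2.2 then rot (accept B σ R i.1) i.2.1 j.2.1 else 0 := rfl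

theorem gateMatrix_auxRot_apply (i j : Reg B R) : gateMatrix O .auxRot i j =
    if i.1 = j.1 ∧ i.2.1 = j.2.1 then rot (auxBias (pR B σ R)) i.2.2 j.2.2 else 0 := rfl

theorem gateMatrix_prepInv : gateMatrix O .prepInv = (gateMatrix O .prep)ᴴ := by
  ext i j
  rw [conjTranspose_apply, gateMatrix_prep_apply, apply_ite star, star_zero]
  exact if_congr eq_comm rfl rfl

theorem gateMatrix_accRotInv : gateMatrix O .accRotInv = (gateMatrix O .accRot)ᴴ := by
  ext i j
  rw [conjTranspose_apply, gateMatrix_accRot_apply, apply_ite star, star_zero]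
  by_cases h : i.1 = j.1 ∧ i.2.2 = j.2.2
  · rw [if_pos ⟨h.1.symm, h.2.symm⟩, ← h.1]
    exact if_pos h
  · rw [if_neg fun hh => h ⟨hh.1.symm, hh.2.symm⟩]
    exact if_neg h

theorem gateMatrix_auxRotInv : gateMatrix O .auxRotInv = (gateMatrix O .auxRot)ᴴ := by
  ext i j
  rw [conjTranspose_apply, gateMatrix_auxRot_apply, apply_ite star, star_zero]
  exact if_congr (and_congr eq_comm eq_comm) rfl rfl

theorem prep_mulVec (ψ : Reg B R → ℂ) (i : Reg B R) :
    (gateMatrix O .prep *ᵥ ψ) i = ∑ y, O.U i.1 y * ψ (y, i.2) := by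
  simp only [mulVec, dotProduct, gateMatrix, Fintype.sum_prod_type (α₁ := Coeffs B R), ite_mul,
    zero_mul]
  refine Finset.sum_congr rfl fun y _ => ?_
  rw [Finset.sum_ite_eq]
  simp

theorem accRot_mulVec (ψ : Reg B R → ℂ) (i : Reg B R) :
    (gateMatrix O .accRot *ᵥ ψ) i = ∑ b, rot (accept B σ R i.1) i.2.1 b * ψ (i.1, b, i.2.2) := by
  simp only [mulVec, dotProduct, gateMatrix, Fintype.sum_prod_type, ite_mul, zero_mul, ite_and]
  rw [Finset.sum_eq_single i.1 (fun y _ hy => by simp [hy.symm]) (by simp)]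
  simp

theorem auxRot_mulVec (ψ : Reg B R → ℂ) (i : Reg B R) :
    (gateMatrix O .auxRot *ᵥ ψ) i =
      ∑ c, rot (auxBias (pR B σ R)) i.2.2 c * ψ (i.1, i.2.1, c) := by
  simp only [mulVec, dotProduct, gateMatrix, Fintype.sum_prod_type, ite_mul, zero_mul, ite_and]
  rw [Finset.sum_eq_single i.1 (fun y _ hy => by simp [hy.symm]) (by simp)]
  simp

/-- A gate that acts on one register, controlled by the others, is block diagonal. -/
theorem blockDiagonal_submatrix_mem_unitaryGroup {ι κ o : Type*} [Fintype ι] [DecidableEq ι]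
    [Fintype κ] [DecidableEq κ] [Fintype o] [DecidableEq o] (e : ι ≃ κ × o)
    (M : o → Matrix κ κ ℂ) (hM : ∀ k, (M k)ᴴ * M k = 1) :
    (Matrix.blockDiagonal M).submatrix e e ∈ Matrix.unitaryGroup ι ℂ := by
  rw [Matrix.mem_unitaryGroup_iff', star_eq_conjTranspose, conjTranspose_submatrix,
    submatrix_mul_equiv, blockDiagonal_conjTranspose, ← blockDiagonal_mul]
  simp_rw [hM]
  rw [show (fun _ : o => (1 : Matrix κ κ ℂ)) = 1 from rfl, blockDiagonal_one, submatrix_one_equiv]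

theorem prep_mem_unitaryGroup : gateMatrix O .prep ∈ Matrix.unitaryGroup (Reg B R) ℂ :=
  blockDiagonal_submatrix_mem_unitaryGroup (Equiv.refl (Reg B R)) (fun _ => O.U) fun _ =>
    Matrix.mem_unitaryGroup_iff'.1 O.unitary

theorem accRot_mem_unitaryGroup (h : ∀ x, 0 ≤ accept B σ R x ∧ accept B σ R x ≤ 1) :
    gateMatrix O .accRot ∈ Matrix.unitaryGroup (Reg B R) ℂ := by
  let e : Reg B R ≃ Bool × (Coeffs B R × Bool) :=
    ⟨fun i => (i.2.1, i.1, i.2.2), fun i => (i.2.1, i.1, i.2.2), fun _ => rfl, fun _ => rfl⟩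
  convert blockDiagonal_submatrix_mem_unitaryGroup e (fun k => rot (accept B σ R k.1)) fun k =>
    rot_mul_conjTranspose (h k.1).1 (h k.1).2
  ext i j
  rw [gateMatrix_accRot_apply, submatrix_apply, blockDiagonal_apply]
  exact if_congr (by rw [Prod.ext_iff]; exact Iff.rfl) rfl rfl

theorem auxRot_mem_unitaryGroup (h0 : 0 < pR B σ R) (h1 : pR B σ R ≤ 1) :
    gateMatrix O .auxRot ∈ Matrix.unitaryGroup (Reg B R) ℂ := by
  let e : Reg B R ≃ Bool × (Coeffs B R × Bool) :=
    ⟨fun i => (i.2.2, i.1, i.2.1), fun i => (i.2.1, i.2.2, i.1), fun _ => rfl, fun _ => rfl⟩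
  convert blockDiagonal_submatrix_mem_unitaryGroup e (fun _ => rot (auxBias (pR B σ R))) fun _ =>
    rot_mul_conjTranspose (auxBias_nonneg h0) (auxBias_le_one h0 h1)
  ext i j
  rw [gateMatrix_auxRot_apply, submatrix_apply, blockDiagonal_apply]
  exact if_congr (by rw [Prod.ext_iff]; exact Iff.rfl) rfl rfl

theorem reflection_mem_unitaryGroup {ι : Type*} [Fintype ι] [DecidableEq ι] (P : ι → Prop)
    [DecidablePred P] : (Matrix.diagonal fun i => if P i then (-1 : ℂ) else 1) ∈
      Matrix.unitaryGroup ι ℂ := by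
  rw [Matrix.mem_unitaryGroup_iff', star_eq_conjTranspose, diagonal_conjTranspose,
      diagonal_mul_diagonal,
    ← diagonal_one]
  congr 1
  funext i
  by_cases h : P i <;> simp [h]

theorem gateMatrix_mem_unitaryGroup (h : ∀ x, 0 ≤ accept B σ R x ∧ accept B σ R x ≤ 1)
    (h0 : 0 < pR B σ R) (h1 : pR B σ R ≤ 1) (G : Gate) :
    gateMatrix O G ∈ Matrix.unitaryGroup (Reg B R) ℂ := by
  cases G with
  | prep => exact prep_mem_unitaryGroup O
  | prepInv =>
    rw [gateMatrix_prepInv]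
    exact Unitary.star_mem (prep_mem_unitaryGroup O)
  | accRot => exact accRot_mem_unitaryGroup O h
  | accRotInv =>
    rw [gateMatrix_accRotInv]
    exact Unitary.star_mem (accRot_mem_unitaryGroup O h)
  | auxRot => exact auxRot_mem_unitaryGroup O h0 h1
  | auxRotInv =>
    rw [gateMatrix_auxRotInv]
    exact Unitary.star_mem (auxRot_mem_unitaryGroup O h0 h1)
  | reflInit => exact reflection_mem_unitaryGroup _
  | reflGood => exact reflection_mem_unitaryGroup _

/-- The unitary `A` of the preparation circuit. -/
noncomputable def prepMatrix : Matrix (Reg B R) (Reg B R) ℂ :=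
  gateMatrix O .auxRot * gateMatrix O .accRot * gateMatrix O .prep

/-- The prepared state `A|i₀⟩`. -/
noncomputable def prepState : Reg B R → ℂ := prepMatrix O *ᵥ Pi.single (O.init, false, false) 1

/-- The component of a state on which both coins accept. -/
noncomputable def goodPart (ψ : Reg B R → ℂ) : Reg B R → ℂ :=
  fun i => if i.2 = (true, true) then ψ i else 0

/-- The accepted amplitudes of the prepared state; the rejected ones are not needed. -/
theorem prepState_good (x : Coeffs B R) : prepState O (x, true, true) =
    ((√(auxBias (pR B σ R)) * (√(accept B σ R x) * √(kleinTrunc B σ R x)) : ℝ) : ℂ) := by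
  rw [prepState, prepMatrix, ← mulVec_mulVec, ← mulVec_mulVec, auxRot_mulVec]
  simp only [accRot_mulVec, prep_mulVec, Fintype.sum_bool]
  have h : ∀ b c, ∑ y, O.U x y * (Pi.single (O.init, false, false) (1 : ℂ) : Reg B R → ℂ)
      (y, b, c) =
      if b = false ∧ c = false then ((√(kleinTrunc B σ R x) : ℝ) : ℂ) else 0 := fun b c => by
    rw [Finset.sum_eq_single O.init]
    · rw [O.prepares]
      by_cases hb : b = false <;> by_cases hc : c = false <;> simp [hb, hc]
    · intro y _ hy
      simp [hy]
    · simp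
  simp only [h, rot]
  push_cast
  simp

variable (h : ∀ x, 0 ≤ accept B σ R x ∧ accept B σ R x ≤ 1)
  (h0 : 0 < pR B σ R) (h1 : pR B σ R ≤ 1)
  (hQ : ∀ x, 0 ≤ kleinTrunc B σ R x)
  (hsum : ∑ x : Coeffs B R, accept B σ R x * kleinTrunc B σ R x = pR B σ R)

include h h0 h1 in
theorem prepMatrix_mem_unitaryGroup : prepMatrix O ∈ Matrix.unitaryGroup (Reg B R) ℂ :=
  mul_mem (mul_mem (auxRot_mem_unitaryGroup O h0 h1) (accRot_mem_unitaryGroup O h))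
    (prep_mem_unitaryGroup O)

include h h0 hQ in
theorem norm_prepState_good_sq (x : Coeffs B R) : ‖prepState O (x, true, true)‖ ^ 2 =
    auxBias (pR B σ R) * (accept B σ R x * kleinTrunc B σ R x) := by
  rw [prepState_good, Complex.norm_real, Real.norm_of_nonneg (by positivity), mul_pow, mul_pow,
    sq_sqrt (auxBias_nonneg h0), sq_sqrt (h x).1, sq_sqrt (hQ x)]

include h h0 hQ hsum in
/-- The initial success probability is `sin² (π / (2 (2k+1)))`. -/
theorem prepState_dotProduct_goodPart :
    star (prepState O) ⬝ᵥ goodPart (prepState O) = ((sin (qrsAngle (pR B σ R)) ^ 2 : ℝ) : ℂ) := by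
  have hs : star (prepState O) ⬝ᵥ goodPart (prepState O) =
      ((∑ x, ‖prepState O (x, true, true)‖ ^ 2 : ℝ) : ℂ) := by
    simp only [dotProduct, goodPart, Fintype.sum_prod_type (α₁ := Coeffs B R), Complex.ofReal_sum]
    refine Finset.sum_congr rfl fun x _ => ?_
    rw [Finset.sum_eq_single (true, true) (fun b _ hb => by simp [hb]) (by simp)]
    simp only [Pi.star_apply, if_true]
    rw [← Complex.normSq_eq_norm_sq, Complex.normSq_eq_conj_mul_self]
    rfl
  rw [hs]
  simp_rw [norm_prepState_good_sq O h h0 hQ]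
  rw [← Finset.mul_sum, hsum, auxBias_eq, div_mul_cancel₀ _ h0.ne']

include h h0 h1 in
theorem prepState_dotProduct_self : star (prepState O) ⬝ᵥ prepState O = 1 := by
  have hA := Matrix.mem_unitaryGroup_iff'.1 (prepMatrix_mem_unitaryGroup O h h0 h1)
  rw [star_eq_conjTranspose] at hA
  rw [prepState, star_mulVec, ← dotProduct_mulVec, mulVec_mulVec, hA, one_mulVec, Pi.star_single,
    star_one, single_one_dotProduct, Pi.single_eq_same]

theorem reflGood_mulVec (ψ : Reg B R → ℂ) :
    gateMatrix O .reflGood *ᵥ ψ = ψ - (2 : ℂ) • goodPart ψ := by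
  ext i
  rw [gateMatrix, mulVec_diagonal]
  simp only [goodPart, Pi.sub_apply, Pi.smul_apply, smul_eq_mul]
  split_ifs <;> ring

theorem foldl_prepCircuit (ψ : Reg B R → ℂ) :
    prepCircuit.foldl (fun ψ G => gateMatrix O G *ᵥ ψ) ψ = prepMatrix O *ᵥ ψ := by
  simp [prepCircuit, prepMatrix, mulVec_mulVec, Matrix.mul_assoc]

include h h0 h1 in
/-- One round is the product of the reflections in the good subspace and in the prepared state. -/
theorem foldl_roundCircuit (ψ : Reg B R → ℂ) :
    roundCircuit.foldl (fun ψ G => gateMatrix O G *ᵥ ψ) ψ =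
      (ψ - (2 : ℂ) • goodPart ψ) -
        (2 * (star (prepState O) ⬝ᵥ (ψ - (2 : ℂ) • goodPart ψ))) • prepState O := by
  have hA := Matrix.mem_unitaryGroup_iff.1 (prepMatrix_mem_unitaryGroup O h h0 h1)
  rw [star_eq_conjTranspose] at hA
  rw [prepState, ← conj_reflection_mulVec hA, ← reflGood_mulVec O]
  have hr : (Matrix.diagonal fun i => if i = (O.init, false, false) then (-1 : ℂ) else 1) =
    gateMatrix O .reflInit := rfl
  rw [hr, prepMatrix]
  simp only [roundCircuit, List.foldl_cons, List.foldl_nil, gateMatrix_prepInv,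
      gateMatrix_accRotInv,
    gateMatrix_auxRotInv, conjTranspose_mul, mulVec_mulVec, Matrix.mul_assoc]

theorem goodPart_combo (a b : ℂ) (ψ : Reg B R → ℂ) :
    goodPart (a • goodPart ψ + b • (ψ - goodPart ψ)) = a • goodPart ψ := by
  ext i
  simp only [goodPart, Pi.add_apply, Pi.smul_apply, Pi.sub_apply, smul_eq_mul]
  split_ifs <;> ring

include h h0 h1 hQ hsum in
/-- Amplitude amplification: up to sign, each round rotates by `2θ` in the plane spanned by the
good and the bad component of the prepared state. -/
theorem exists_amplified (n : ℕ) : ∃ a b : ℝ,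
    sin (qrsAngle (pR B σ R)) * a = (-1) ^ n * sin ((2 * n + 1) * qrsAngle (pR B σ R)) ∧
    cos (qrsAngle (pR B σ R)) * b = (-1) ^ n * cos ((2 * n + 1) * qrsAngle (pR B σ R)) ∧
    (List.replicate n roundCircuit).flatten.foldl (fun ψ G => gateMatrix O G *ᵥ ψ) (prepState O) =
      (a : ℂ) • goodPart (prepState O) + (b : ℂ) • (prepState O - goodPart (prepState O)) := by
  induction n with
  | zero => exact ⟨1, 1, by simp, by simp, by simp⟩
  | succ n ih =>
    obtain ⟨a, b, ha, hb, hψ⟩ := ih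
    set θ := qrsAngle (pR B σ R)
    refine ⟨-a + 2 * a * sin θ ^ 2 - 2 * b * cos θ ^ 2, b + 2 * a * sin θ ^ 2 - 2 * b * cos θ ^ 2,
      ?_, ?_, ?_⟩
    · rw [show (2 * ((n + 1 : ℕ) : ℝ) + 1) * θ = (2 * n + 1) * θ + 2 * θ by push_cast; ring,
        sin_add,
        sin_two_mul, cos_two_mul', pow_succ]
      have e := sin_sq_add_cos_sq θ
      linear_combination (-1 + 2 * sin θ ^ 2) * ha - 2 * sin θ * cos θ * hb +
        ((-1) ^ n * sin ((2 * n + 1) * θ)) * e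
    · rw [show (2 * ((n + 1 : ℕ) : ℝ) + 1) * θ = (2 * n + 1) * θ + 2 * θ by push_cast; ring,
        cos_add,
        sin_two_mul, cos_two_mul', pow_succ]
      have e := sin_sq_add_cos_sq θ
      linear_combination (1 - 2 * cos θ ^ 2) * hb + 2 * sin θ * cos θ * ha -
        ((-1) ^ n * cos ((2 * n + 1) * θ)) * e
    · rw [List.replicate_succ', List.flatten_append, List.foldl_append, hψ]
      simp only [List.flatten_cons, List.flatten_nil, List.append_nil]
      rw [foldl_roundCircuit O h h0 h1, goodPart_combo]
      have hg := prepState_dotProduct_goodPart O h h0 hQ hsum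
      have hs := prepState_dotProduct_self O h h0 h1
      simp only [dotProduct_sub, dotProduct_add, dotProduct_smul, hg, hs, smul_eq_mul]
      have e : ((cos θ ^ 2 : ℝ) : ℂ) = 1 - ((sin θ ^ 2 : ℝ) : ℂ) := by
        rw [cos_sq']; push_cast; ring
      ext i
      simp only [Pi.add_apply, Pi.smul_apply, Pi.sub_apply, smul_eq_mul]
      push_cast at e ⊢
      rw [e]
      ring

open scoped ComplexOrder in
include h h0 h1 hQ hsum in
/-- After the prescribed number of rounds the state lies in the good subspace. -/
theorem qrsState_eq : ∃ a : ℝ, sin (qrsAngle (pR B σ R)) ^ 2 * a ^ 2 = 1 ∧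
    qrsState O = (a : ℂ) • goodPart (prepState O) := by
  obtain ⟨a, b, ha, hb, hψ⟩ := exists_amplified O h h0 h1 hQ hsum (rounds (pR B σ R))
  rw [qrsAngle_mul] at ha hb
  rw [sin_pi_div_two] at ha
  rw [cos_pi_div_two, mul_zero] at hb
  have hstate : qrsState O =
      (a : ℂ) • goodPart (prepState O) + (b : ℂ) • (prepState O - goodPart (prepState O)) := by
    rw [← hψ, qrsState, qrsCircuit, List.foldl_append, foldl_prepCircuit]
    rfl
  refine ⟨a, ?_, ?_⟩
  · rw [← mul_pow, ha, mul_one, ← pow_mul, mul_comm, pow_mul]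
    simp
  · rcases Nat.eq_zero_or_pos (rounds (pR B σ R)) with hk | hk
    · have hθ : qrsAngle (pR B σ R) = π / 2 := by simp [qrsAngle, hk]
      -- Without any round the angle is `π / 2`, so the bad component already vanishes.
      have hbad : prepState O - goodPart (prepState O) = 0 := by
        rw [← dotProduct_star_self_eq_zero]
        have hg := prepState_dotProduct_goodPart O h h0 hQ hsum
        have hs := prepState_dotProduct_self O h h0 h1
        rw [hθ, sin_pi_div_two] at hg
        have horth : star (goodPart (prepState O)) ⬝ᵥ (prepState O - goodPart (prepState O)) =
            0 := by
          refine Finset.sum_eq_zero fun i _ => ?_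
          simp only [Pi.star_apply, goodPart, Pi.sub_apply]
          split_ifs <;> simp
        rw [star_sub, sub_dotProduct, horth, dotProduct_sub, hg, hs]
        simp
      rw [hstate, hbad, smul_zero, add_zero]
    · have hcos : cos (qrsAngle (pR B σ R)) ≠ 0 := by
        refine (cos_pos_of_mem_Ioo ⟨by linarith [qrsAngle_pos (pR B σ R), pi_pos], ?_⟩).ne'
        unfold qrsAngle
        have : (1 : ℝ) ≤ rounds (pR B σ R) := by exact_mod_cast hk
        gcongr
        linarith
      have hb' : b = 0 := by simpa [hcos] using hb
      rw [hstate, hb']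
      simp

include h h0 h1 hQ hsum in
/-- The outcome probabilities: the auxiliary bias `sin² θ / p` cancels against the amplification
factor `1 / sin² θ`. -/
theorem norm_qrsState_sq (i : Reg B R) : ‖qrsState O i‖ ^ 2 =
    if i.2 = (true, true) then accept B σ R i.1 * kleinTrunc B σ R i.1 / pR B σ R else 0 := by
  obtain ⟨a, ha, hψ⟩ := qrsState_eq O h h0 h1 hQ hsum
  rw [hψ, Pi.smul_apply, goodPart]
  split_ifs with hi
  · obtain ⟨x, y⟩ := i
    simp only at hi
    subst hi
    rw [norm_smul, mul_pow, norm_prepState_good_sq O h h0 hQ, Complex.norm_real, Real.norm_eq_abs,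
      sq_abs, auxBias_eq]
    linear_combination (accept B σ R x * kleinTrunc B σ R x / pR B σ R) * ha
  · simp

end Circuit

/-! ### The law and the cost of the samples -/

/-- Independent runs have the product law. -/
theorem repeatRuns_map_val {α : Type} (p : PMF (Timed α)) (N : ℕ) (W : Fin N → α) :
    ((repeatRuns p N).map Timed.val) W = ∏ j, (p.map Timed.val) (W j) := by
  classical
  induction N with
  | zero =>
    rw [repeatRuns, PMF.pure_map, PMF.pure_apply, if_pos (Subsingleton.elim _ _)]
    simp
  | succ N ih =>
    have h1 : (repeatRuns p (N + 1)).map Timed.val = (p.map Timed.val).bind fun a =>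
        ((repeatRuns p N).map Timed.val).map (Fin.cons a) := by
      rw [repeatRuns, PMF.map_bind, PMF.bind_map]
      congr 1
      funext a
      rw [PMF.map_comp, Function.comp_apply, PMF.map_comp]
      rfl
    rw [h1, PMF.bind_apply, tsum_eq_single (W 0), Fin.prod_univ_succ]
    · congr 1
      rw [PMF.map_apply, tsum_eq_single (Fin.tail W), if_pos (Fin.cons_self_tail W).symm, ih]
      · rfl
      · intro V hV
        refine if_neg fun h => hV ?_
        rw [h, Fin.tail_cons]
    · intro a ha
      refine mul_eq_zero_of_right _ ?_
      rw [PMF.map_apply, ENNReal.tsum_eq_zero]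
      intro V
      refine if_neg fun h => ha ?_
      rw [h, Fin.cons_zero]

theorem repeatRuns_cost_le {α : Type} (p : PMF (Timed α)) (K : ℕ) (hK : ∀ r ∈ p.support, r.cost ≤ K)
    (N : ℕ) : ∀ r ∈ (repeatRuns p N).support, r.cost ≤ N * K := by
  induction N with
  | zero =>
    intro r hr
    rw [repeatRuns, PMF.mem_support_pure_iff] at hr
    simp [hr]
  | succ N ih =>
    intro r hr
    rw [repeatRuns, PMF.mem_support_bind_iff] at hr
    obtain ⟨a, ha, hr⟩ := hr
    rw [PMF.mem_support_map_iff] at hr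
    obtain ⟨W, hW, rfl⟩ := hr
    have h1 := hK a ha
    have h2 := ih W hW
    simp only
    rw [Nat.succ_mul]
    omega

theorem measure_apply_toReal {ι : Type} [Fintype ι] (ψ : ι → ℂ) (i₀ : ι) (h : ∑ i, ‖ψ i‖ ^ 2 = 1)
    (i : ι) : (DualAttack.measure ψ i₀ i).toReal = ‖ψ i‖ ^ 2 := by
  have h' : ∑ i, ENNReal.ofReal (‖ψ i‖ ^ 2) = 1 := by
    rw [← ENNReal.ofReal_sum_of_nonneg fun i _ => by positivity, h, ENNReal.ofReal_one]
  rw [DualAttack.measure, dif_pos h', PMF.ofFintype_apply, ENNReal.toReal_ofReal (by positivity)]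

section Sample

variable {m : ℕ} {L : Submodule ℤ (Fin m → ℤ)} {B : Module.Basis (Fin m) ℤ L} {σ R : ℝ}
  (O : KleinOracle B σ R)

theorem qrsSample_map_val : (qrsSample O).map Timed.val =
    (DualAttack.measure (qrsState O) (O.init, false, false)).map fun r => latVec B r.1.1 := by
  rw [qrsSample, PMF.map_comp]
  congr 1
  funext r
  ext k
  simp [tabulate, timedSum, op, latVec, Finset.sum_apply]

/-- A sample of the quantum rejection sampler has exactly the law `D_{L ∩ B(R), σ}`. -/
theorem qrsSample_law (hgs : ∀ i, gs B i ≠ 0) (hσ : 0 < σ) (hR : 0 ≤ R) (w : Fin m → ℤ) :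
    (((qrsSample O).map Timed.val) w).toReal = discreteGaussian (truncated L R) σ w := by
  classical
  have ha : ∀ x, 0 ≤ accept B σ R x ∧ accept B σ R x ≤ 1 := fun x =>
    ⟨accept_nonneg B hgs hσ hR x, accept_le_one B hgs hσ hR x⟩
  have hp := pR_pos B hgs hσ hR
  have hn : ∀ i, ‖qrsState O i‖ ^ 2 = if i.2 = (true, true) then targetTrunc B σ R i.1 else 0 := by
    intro i
    rw [norm_qrsState_sq O ha hp (pR_le_one B hgs hσ hR)
      (fun x => (kleinTrunc_pos B hgs hσ hR x).le) (sum_accept B hgs hσ hR),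
      accept_mul_kleinTrunc B hgs hσ hR, mul_div_cancel_left₀ _ hp.ne']
  -- Only the outcomes on which both coins accept contribute.
  have hsum : ∀ f : Coeffs B R → ℝ, ∑ i : Reg B R, (if i.2 = (true, true) then f i.1 else 0) =
      ∑ x, f x := fun f => by
    rw [Fintype.sum_prod_type (α₁ := Coeffs B R)]
    refine Finset.sum_congr rfl fun x _ => ?_
    rw [Finset.sum_eq_single (true, true) (fun b _ hb => by simp [hb]) (by simp)]
    simp
  have h1 : ∑ i, ‖qrsState O i‖ ^ 2 = 1 := by
    simp_rw [hn]
    rw [hsum, sum_targetTrunc B hσ hR]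
  rw [qrsSample_map_val, PMF.map_apply, tsum_fintype, ENNReal.toReal_sum fun i _ => by
    split_ifs
    · exact PMF.apply_ne_top _ _
    · simp]
  have h2 : ∀ i : Reg B R, (if w = latVec B i.1.1 then
      DualAttack.measure (qrsState O) (O.init, false, false) i else 0).toReal =
      if i.2 = (true, true) then
        (if w = latVec B i.1.1 then targetTrunc B σ R i.1 else 0) else 0 := by
    intro i
    by_cases hw : w = latVec B i.1.1
    · simp only [if_pos hw]
      rw [measure_apply_toReal _ _ h1, hn]
    · simp [hw]
  refine (Finset.sum_congr rfl fun i _ => by convert h2 i).trans ?_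
  rw [hsum fun x => if w = latVec B x.1 then targetTrunc B σ R x else 0, discreteGaussian]
  split_ifs with hw
  · obtain ⟨x, rfl⟩ := exists_latVec_eq B hw.1
    rw [Finset.sum_eq_single ⟨x, hw.2⟩]
    · rw [if_pos rfl, targetTrunc, sum_rho_coeffs]
    · intro y _ hy
      refine if_neg fun hxy => hy (Subtype.ext ?_)
      exact (latVec_injective B hxy).symm
    · simp
  · refine Finset.sum_eq_zero fun x _ => if_neg ?_
    rintro rfl
    exact hw ⟨latVec_mem B _, x.2⟩

theorem samples_law (hgs : ∀ i, gs B i ≠ 0) (hσ : 0 < σ) (hR : 0 ≤ R) {N : ℕ}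
    (W : Fin N → Fin m → ℤ) : (((repeatRuns (qrsSample O) N).map Timed.val) W).toReal =
      productMass (discreteGaussian (truncated L R) σ) N W := by
  rw [repeatRuns_map_val, ENNReal.toReal_prod, productMass]
  exact Finset.prod_congr rfl fun j _ => qrsSample_law O hgs hσ hR (W j)

theorem length_qrsCircuit (p : ℝ) : (qrsCircuit p).length = 3 + 8 * rounds p := by
  simp [qrsCircuit, prepCircuit, roundCircuit]
  ring

theorem qrsSample_cost : ∀ r ∈ (qrsSample O).support,
    r.cost ≤ 3 + 8 * rounds (pR B σ R) + m * (2 * m + 1) := by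
  intro r hr
  rw [qrsSample, PMF.mem_support_map_iff] at hr
  obtain ⟨i, -, rfl⟩ := hr
  rw [length_qrsCircuit]
  simp [tabulate, timedSum, op]
  ring_nf
  rfl

end Sample

/-! ### The fast Fourier transform -/

theorem root_add (n : ℕ) (a b : ℤ) : root n (a + b) = root n a * root n b := by
  rw [root, root, root, ← Complex.exp_add]
  congr 1
  push_cast
  ring

theorem root_nat_mul (n : ℕ) (k : ℕ) (a : ℤ) : root n (k * a) = root n a ^ k := by
  rw [root, root, ← Complex.exp_nat_mul]
  congr 1
  push_cast
  ring

theorem root_eq_zpow (n : ℕ) (a : ℤ) : root n a = Complex.exp (2 * π * Complex.I / n) ^ a := by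
  rw [root, ← Complex.exp_int_mul]
  congr 1
  ring

theorem root_eq_one_iff {n : ℕ} (hn : n ≠ 0) (a : ℤ) : root n a = 1 ↔ (n : ℤ) ∣ a := by
  rw [root_eq_zpow, (Complex.isPrimitiveRoot_exp n hn).zpow_eq_one_iff_dvd]

theorem root_congr {n : ℕ} (hn : n ≠ 0) {a b : ℤ} (h : (n : ℤ) ∣ a - b) : root n a = root n b := by
  rw [← sub_add_cancel a b, root_add, (root_eq_one_iff hn _).2 h, one_mul]

theorem root_two_mul {n : ℕ} (a : ℤ) : root (2 * n) (2 * a) = root n a := by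
  rw [root, root]
  congr 1
  push_cast
  rw [show (2 : ℂ) * π * Complex.I * (2 * a) = 2 * (2 * π * Complex.I * a) by ring]
  exact mul_div_mul_left _ _ two_ne_zero

theorem sum_root_mul {n : ℕ} (hn : n ≠ 0) (c : ℤ) :
    ∑ l ∈ Finset.range n, root n (l * c) = if (n : ℤ) ∣ c then (n : ℂ) else 0 := by
  simp_rw [root_nat_mul]
  split_ifs with h
  · simp [(root_eq_one_iff hn c).2 h]
  · have h1 : root n c ≠ 1 := fun h' => h ((root_eq_one_iff hn c).1 h')
    rw [geom_sum_eq h1, ← root_nat_mul, (root_eq_one_iff hn _).2 (dvd_mul_right _ _)]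
    simp

theorem sum_range_two_mul {M : Type*} [AddCommMonoid M] (f : ℕ → M) (n : ℕ) :
    ∑ j ∈ Finset.range (2 * n), f j =
      ∑ i ∈ Finset.range n, f (2 * i) + ∑ i ∈ Finset.range n, f (2 * i + 1) := by
  induction n with
  | zero => simp
  | succ n ih =>
    rw [Nat.mul_succ, Finset.sum_range_succ, Finset.sum_range_succ, ih, Finset.sum_range_succ,
      Finset.sum_range_succ]
    abel

theorem fft_succ_val (sgn : ℤ) (t : ℕ) (x : ℕ → ℂ) (k : ℕ) : (fft sgn (t + 1) x).val k =
    if k < 2 ^ (t + 1) then (fft sgn t fun i => x (2 * i)).val (k % 2 ^ t) +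
      root (2 ^ (t + 1)) (sgn * k) * (fft sgn t fun i =>
          x (2 * i + 1)).val (k % 2 ^ t) else 0 := rfl

/-- The radix-2 recursion computes the discrete Fourier transform of length `2^t`. The restriction
`k < 2^t` matters because the array is not periodic in `k`. -/
theorem fft_val (sgn : ℤ) : ∀ (t : ℕ) (x : ℕ → ℂ) (k : ℕ), k < 2 ^ t →
    (fft sgn t x).val k = ∑ j ∈ Finset.range (2 ^ t), x j * root (2 ^ t) (sgn * (j * k))
  | 0, x, k, hk => by
    obtain rfl : k = 0 := by simpa using hk
    have : (fft sgn 0 x).val 0 = x 0 := rfl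
    simp [this, root]
  | t + 1, x, k, hk => by
    have h2 : 2 ^ t ≠ 0 := by positivity
    have hmod : k % 2 ^ t < 2 ^ t := Nat.mod_lt _ (by positivity)
    have hr : ∀ j : ℕ, root (2 ^ t) (sgn * (j * ((k % 2 ^ t : ℕ) : ℤ))) =
        root (2 ^ t) (sgn * (j * k)) := fun j => by
      refine root_congr h2 ?_
      rw [← mul_sub, ← mul_sub]
      refine Dvd.dvd.mul_left (Dvd.dvd.mul_left ?_ _) _
      rw [dvd_sub_comm]
      exact (Nat.modEq_iff_dvd).1 (Nat.mod_modEq k (2 ^ t))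
    rw [fft_succ_val, if_pos hk, fft_val sgn t _ _ hmod, fft_val sgn t _ _ hmod, pow_succ',
        sum_range_two_mul,
      Finset.mul_sum]
    congr 1
    · refine Finset.sum_congr rfl fun j _ => ?_
      rw [hr, ← root_two_mul]
      congr 2
      push_cast
      ring
    · refine Finset.sum_congr rfl fun j _ => ?_
      rw [hr, mul_left_comm, ← root_two_mul (sgn * ((j : ℤ) * k)), ← root_add]
      congr 2
      push_cast
      ring

theorem fft_cost (sgn : ℤ) : ∀ (t : ℕ) (x : ℕ → ℂ), (fft sgn t x).cost = 4 * t * 2 ^ t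
  | 0, x => by rw [mul_zero, zero_mul]; rfl
  | t + 1, x => by
    have h : (fft sgn (t + 1) x).cost = (fft sgn t fun i => x (2 * i)).cost +
      ((fft sgn t fun i => x (2 * i + 1)).cost + ∑ _k ∈ Finset.range (2 ^ (t + 1)), 4) := rfl
    rw [h, fft_cost, fft_cost, Finset.sum_const, Finset.card_range, smul_eq_mul, pow_succ]
    ring

/-- Multiplying the transforms computes a cyclic convolution. -/
theorem fft_convolution (t : ℕ) (Y H : ℕ → ℂ) (k : ℕ) (hk : k < 2 ^ t) :
    (fft (-1) t fun l => if l < 2 ^ t then (fft 1 t Y).val l * (fft 1 t H).val l else 0).val k =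
      2 ^ t * ∑ i ∈ Finset.range (2 ^ t), ∑ j ∈ Finset.range (2 ^ t),
        if ((2 ^ t : ℕ) : ℤ) ∣ (i : ℤ) + j - k then Y i * H j else 0 := by
  have h2 : 2 ^ t ≠ 0 := by positivity
  rw [fft_val _ _ _ _ hk]
  have h1 : ∀ l ∈ Finset.range (2 ^ t),
      (if l < 2 ^ t then (fft 1 t Y).val l * (fft 1 t H).val l else 0) * root (2 ^ t)
          (-1 * (l * k)) =
      ∑ i ∈ Finset.range (2 ^ t), ∑ j ∈ Finset.range (2 ^ t),
        Y i * H j * root (2 ^ t) (l * ((i : ℤ) + j - k)) := by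
    intro l hl
    have hl' := Finset.mem_range.1 hl
    rw [if_pos hl', fft_val _ _ _ _ hl', fft_val _ _ _ _ hl', Finset.sum_mul_sum, Finset.sum_mul]
    refine Finset.sum_congr rfl fun i _ => ?_
    rw [Finset.sum_mul]
    refine Finset.sum_congr rfl fun j _ => ?_
    rw [show (l : ℤ) * ((i : ℤ) + j - k) = 1 * (i * l) + (1 * (j * l) + -1 * (l * k)) by ring,
        root_add,
      root_add]
    ring
  rw [Finset.sum_congr rfl h1, Finset.sum_comm, Finset.mul_sum]
  refine Finset.sum_congr rfl fun i _ => ?_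
  rw [Finset.sum_comm, Finset.mul_sum]
  refine Finset.sum_congr rfl fun j _ => ?_
  rw [← Finset.mul_sum, sum_root_mul h2]
  split_ifs
  · push_cast; ring
  · simp

theorem chirp_val (q : ℕ) (sgn : ℤ) (j : ℕ) :
    (chirp q sgn j).val = root q (sgn * (j.choose 2 : ℕ)) := by
  rw [Nat.choose_two_right]
  rfl

theorem choose_two_add (k a : ℕ) : (k + a).choose 2 = k.choose 2 + a.choose 2 + k * a := by
  induction a with
  | zero => simp
  | succ a ih =>
    rw [← Nat.add_assoc, Nat.choose_succ_succ' (k + a) 1, Nat.choose_succ_succ' a 1, ih,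
        Nat.choose_one_right,
      Nat.choose_one_right]
    ring

/-- The chirp identity `C(k,2) + C(a,2) - C(k+a,2) = -ak` in the exponent. -/
theorem root_chirp_identity (q a k : ℕ) : root q (1 * (k.choose 2 : ℕ)) *
    (root q (1 * (a.choose 2 : ℕ)) * root q (-1 * ((k + a).choose 2 : ℕ))) = root q (-(a * k)) := by
  rw [← root_add, ← root_add, choose_two_add]
  congr 1
  push_cast
  ring

theorem two_mul_le_two_pow_clog (q : ℕ) : 2 * q ≤ 2 ^ (Nat.clog 2 q + 1) := by
  rw [pow_succ']
  exact Nat.mul_le_mul_left 2 (Nat.le_pow_clog (by norm_num) q)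

variable {q : ℕ} [NeZero q]

theorem root_eq_stdAddChar (a : ℤ) : root q a = ZMod.stdAddChar ((a : ZMod q)) := by
  rw [ZMod.stdAddChar_coe, root]

theorem sum_zmod_eq_sum_range {M : Type*} [AddCommMonoid M] (f : ZMod q → M) :
    ∑ a, f a = ∑ j ∈ Finset.range q, f (j : ZMod q) := by
  refine Finset.sum_nbij' (fun a => a.val) (fun j => (j : ZMod q)) ?_ ?_ ?_ ?_ ?_
  · intro a _; exact Finset.mem_range.2 a.val_lt
  · intro j _; exact Finset.mem_univ _
  · intro a _; simp
  · intro j hj; exact ZMod.val_cast_of_lt (Finset.mem_range.1 hj)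
  · intro a _; simp

/-- The chirp transform computes the discrete Fourier transform of length `q`. -/
theorem dftLine_val (x : ZMod q → ℂ) (k : ZMod q) :
    (dftLine x).val k = ∑ a, x a * ZMod.stdAddChar (-(a * k)) := by
  have hq : 0 < q := Nat.pos_of_ne_zero (NeZero.ne q)
  set t := Nat.clog 2 q + 1 with ht
  have hn : 2 * q ≤ 2 ^ t := two_mul_le_two_pow_clog q
  set Y : ℕ → ℂ := fun j => if j < 2 ^ t then (if j < q then
    (chirp q 1 (q - 1 - j)).val * x ((q - 1 - j : ℕ) : ZMod q) else 0) else 0 with hY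
  set H : ℕ → ℂ := fun j => if j < 2 ^ t then (chirp q (-1) j).val else 0 with hH
  have hk : k.val < q := k.val_lt
  have hval : (dftLine x).val k = (chirp q 1 k.val).val * ((fft (-1) t fun l =>
      if l < 2 ^ t then (fft 1 t Y).val l * (fft 1 t H).val l else 0).val (q - 1 +
          k.val) / 2 ^ t) := by
    have hY' : (array (2 ^ t) fun j =>
        if j < q then do
          let c ← chirp q 1 (q - 1 - j)
          op (c * x ((q - 1 - j : ℕ) : ZMod q))
        else op 0).val = Y := by
      funext j
      simp only [array, hY]
      split_ifs <;> rfl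
    rw [← hY']
    rfl
  rw [hval, fft_convolution _ _ _ _ (by omega), mul_div_cancel_left₀ _ (pow_ne_zero _ two_ne_zero),
      chirp_val]
  have hinner : ∀ i ∈ Finset.range (2 ^ t), (∑ j ∈ Finset.range (2 ^ t),
      if ((2 ^ t : ℕ) : ℤ) ∣ (i : ℤ) + j - ((q - 1 + k.val : ℕ) : ℤ) then Y i * H j else 0) =
      if i < q then root q (1 * ((q - 1 - i).choose 2 : ℕ)) * x ((q - 1 - i : ℕ) : ZMod q) *
        root q (-1 * ((k.val + (q - 1 - i)).choose 2 : ℕ)) else 0 := by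
    intro i hi
    have hi' := Finset.mem_range.1 hi
    split_ifs with hiq
    -- Since `2^t ≥ 2q`, no index wraps around, and only `j = q - 1 + k - i` contributes.
    · rw [Finset.sum_eq_single (k.val + (q - 1 - i))]
      · have hd : (i : ℤ) + ((k.val + (q - 1 - i) : ℕ) : ℤ) - ((q - 1 + k.val : ℕ) : ℤ) = 0 :=
          by omega
        rw [hd, if_pos (dvd_zero _), hY, hH]
        simp only
        rw [if_pos hi', if_pos hiq, if_pos (by omega), chirp_val, chirp_val]
      · intro j hj hne
        have hj' := Finset.mem_range.1 hj
        refine if_neg fun ⟨c, hc⟩ => hne ?_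
        -- The index difference lies strictly between `-2^t` and `2^t`.
        have hlt : (i : ℤ) + j - ((q - 1 + k.val : ℕ) : ℤ) < ((2 ^ t : ℕ) : ℤ) := by omega
        have hgt : -((2 ^ t : ℕ) : ℤ) < (i : ℤ) + j - ((q - 1 + k.val : ℕ) : ℤ) := by omega
        have hpos : (0 : ℤ) < ((2 ^ t : ℕ) : ℤ) := by positivity
        have hc0 : c = 0 := by
          rw [hc] at hlt hgt
          have h1 : c < 1 := by nlinarith
          have h2 : -1 < c := by nlinarith
          omega
        rw [hc0, mul_zero] at hc
        omega
      · intro hj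
        exact absurd (Finset.mem_range.2 (by omega)) hj
    · refine Finset.sum_eq_zero fun j _ => ?_
      have : Y i = 0 := by simp [hY, hiq]
      simp [this]
  rw [Finset.sum_congr rfl hinner,
      ← Finset.sum_subset (Finset.range_subset_range.2 (by omega : q ≤ 2 ^ t))
    (fun i _ hi => if_neg fun h => hi (Finset.mem_range.2 h)), sum_zmod_eq_sum_range,
    ← Finset.sum_range_reflect _ q, Finset.mul_sum]
  refine Finset.sum_congr rfl fun i hi => ?_
  have hi' := Finset.mem_range.1 hi
  have he : q - 1 - (q - 1 - i) = i := by omega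
  rw [if_pos (by omega), he]
  have h3 := root_chirp_identity q i k.val
  have h4 : root q (-((i : ℤ) * k.val)) = ZMod.stdAddChar (-((i : ZMod q) * k)) := by
    rw [root_eq_stdAddChar]
    simp
  rw [← h4, ← h3]
  ring

theorem dftAll_succ_val (g : ℕ) (T : (Fin (g + 1) → ZMod q) → ℂ) (t : Fin (g + 1) → ZMod q) :
    (dftAll (g + 1) T).val t =
      (dftLine fun a => (dftAll g fun u => T (Fin.cons a u)).val (Fin.tail t)).val (t 0) := rfl

theorem dftAll_val : ∀ (g : ℕ) (T : (Fin g → ZMod q) → ℂ) (t : Fin g → ZMod q),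
    (dftAll g T).val t = ∑ u, T u * ZMod.stdAddChar (-(u ⬝ᵥ t))
  | 0, T, t => by
    have : (dftAll 0 T).val t = T t := rfl
    rw [this, Fintype.sum_unique, Subsingleton.elim t default]
    simp only [dotProduct, Finset.univ_eq_empty, Finset.sum_empty, neg_zero,
        AddChar.map_zero_eq_one, mul_one]
    exact congrArg T (Subsingleton.elim _ _)
  | g + 1, T, t => by
    rw [dftAll_succ_val, dftLine_val, ← (Fin.consEquiv fun _ : Fin (g + 1) => ZMod q).sum_comp,
      Fintype.sum_prod_type]
    refine Finset.sum_congr rfl fun a _ => ?_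
    rw [dftAll_val g, Finset.sum_mul]
    refine Finset.sum_congr rfl fun u _ => ?_
    simp only [Fin.consEquiv, Equiv.coe_fn_mk]
    rw [mul_assoc, ← AddChar.map_add_eq_mul]
    congr 2
    simp only [dotProduct, Fin.sum_univ_succ, Fin.cons_zero, Fin.cons_succ, Fin.tail]
    ring

/-! ### The search by Fourier transform -/

theorem foldlM_val {α β : Type} (f : β → α → Timed β) (l : List α) (s : β) :
    (l.foldlM f s).val = l.foldl (fun s a => (f s a).val) s := by
  induction l generalizing s with
  | nil => rfl
  | cons a l ih =>
    rw [List.foldlM_cons, List.foldl_cons, ← ih]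
    rfl

theorem foldlM_cost {α β : Type} (f : β → α → Timed β) (K : ℕ) (hK : ∀ s a, (f s a).cost = K)
    (l : List α) (s : β) : (l.foldlM f s).cost = l.length * K := by
  induction l generalizing s with
  | nil => rw [List.length_nil, zero_mul]; rfl
  | cons a l ih =>
    have h : ((a :: l).foldlM f s).cost = (f s a).cost + (l.foldlM f (f s a).val).cost := by
      rw [List.foldlM_cons]
      rfl
    rw [h, hK, ih, List.length_cons, Nat.succ_mul, add_comm]

section Search

variable {m g d q : ℕ} [NeZero q] (A : Matrix (Fin m) (Fin g ⊕ Fin d) (ZMod q))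
  (b : Fin m → ZMod q) {N : ℕ} (W : Fin N → Fin m → ℤ)

theorem fillTable_val (v : Fin g → ZMod q) : (fillTable A b W).val v =
    ∑ j, if A.toCols₁ᵀ *ᵥ modQ q (W j) = v then ZMod.stdAddChar (modQ q (W j) ⬝ᵥ b) else 0 := by
  set f : ((Fin g → ZMod q) → ℂ) → (Fin m → ℤ) → Timed ((Fin g → ZMod q) → ℂ) := fun T w => do
    let wq ← tabulate fun i => op (w i : ZMod q)
    let u ← tabulate fun k : Fin g => timedSum fun i => op (A i (Sum.inl k) * wq i)
    let v ← timedSum fun i => op (wq i * b i)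
    let c ← op (root q (v.val : ℤ))
    let y ← op (T u + c)
    op (Function.update T u y) with hf
  have h0 : (fillTable A b W).val = ((List.ofFn W).foldlM f 0).val := rfl
  have hstep : ∀ T w v, (f T w).val v =
      T v + if A.toCols₁ᵀ *ᵥ modQ q w = v then ZMod.stdAddChar (modQ q w ⬝ᵥ b) else 0 := by
    intro T w v
    have h1 : (f T w).val = Function.update T (A.toCols₁ᵀ *ᵥ modQ q w)
      (T (A.toCols₁ᵀ *ᵥ modQ q w) + root q ((modQ q w ⬝ᵥ b).val : ℤ)) := rfl
    rw [h1, root_eq_stdAddChar]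
    by_cases h : A.toCols₁ᵀ *ᵥ modQ q w = v
    · subst h
      simp
    · rw [Function.update_of_ne (Ne.symm h), if_neg h, add_zero]
  have hfold : ∀ (l : List (Fin m → ℤ)) (T : (Fin g → ZMod q) → ℂ),
      (l.foldlM f T).val v = T v + (l.map fun w =>
        if A.toCols₁ᵀ *ᵥ modQ q w = v then (ZMod.stdAddChar (modQ q w ⬝ᵥ b) : ℂ) else 0).sum := by
    intro l
    induction l with
    | nil => intro T; rw [foldlM_val]; simp
    | cons w l ih =>
      intro T
      rw [foldlM_val, List.foldl_cons, ← foldlM_val, ih, hstep, List.map_cons, List.sum_cons,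
          add_assoc]
  rw [h0, hfold, List.map_ofFn, List.sum_ofFn]
  simp

/-- The Fourier transform of the table gives all scores at once. -/
theorem re_dftAll_fillTable (t : Fin g → ZMod q) :
    ((dftAll g (fillTable A b W).val).val t).re = score A b W t := by
  rw [dftAll_val]
  simp_rw [fillTable_val, Finset.sum_mul]
  rw [Finset.sum_comm, score, Complex.re_sum]
  refine Finset.sum_congr rfl fun j _ => ?_
  rw [Finset.sum_eq_single (A.toCols₁ᵀ *ᵥ modQ q (W j)) (fun u _ hu => by simp [hu.symm]) (by simp),
    if_pos rfl, ← AddChar.map_add_eq_mul, re_stdAddChar]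
  congr 6
  rw [dotProduct_sub, sub_eq_add_neg, mulVec_transpose, dotProduct_mulVec]

theorem search_val : (search A b W).val = attackOutput A b W := by
  classical
  set f : Option (Fin g → ZMod q) × ℝ → (Fin g → ZMod q) → Timed (Option (Fin g → ZMod q) × ℝ) :=
    fun st t => do
      let F ← op ((dftAll g (fillTable A b W).val).val t).re
      let c ← op (decide (F ≥ st.2))
      if c then op (some t, F) else op st with hf
  have h0 : (search A b W).val =
      ((Finset.univ : Finset (Fin g → ZMod q)).toList.foldlM f (none, 0)).val.1 := by
    rw [search]
    congr!
  rw [h0, foldlM_val, attackOutput]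
  congr 2
  funext st t
  have h1 : (f st t).val = (if decide (((dftAll g (fillTable A b W).val).val t).re ≥ st.2) then
      op (some t, ((dftAll g (fillTable A b W).val).val t).re) else op st : Timed _).val := rfl
  rw [h1, re_dftAll_fillTable]
  by_cases h : score A b W t ≥ st.2 <;> simp [h, op]

theorem fillTable_cost : (fillTable A b W).cost =
    2 * q ^ g + N * (2 * m + (g * (2 * m + 1) + (2 * m + 3))) := by
  set f : ((Fin g → ZMod q) → ℂ) → (Fin m → ℤ) → Timed ((Fin g → ZMod q) → ℂ) := fun T w => do
    let wq ← tabulate fun i => op (w i : ZMod q)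
    let u ← tabulate fun k : Fin g => timedSum fun i => op (A i (Sum.inl k) * wq i)
    let v ← timedSum fun i => op (wq i * b i)
    let c ← op (root q (v.val : ℤ))
    let y ← op (T u + c)
    op (Function.update T u y) with hf
  have h0 : (fillTable A b W).cost =
      (∑ _u : Fin g → ZMod q, 2) + ((List.ofFn W).foldlM f 0).cost := rfl
  have hK : ∀ T w, (f T w).cost = 2 * m + (g * (2 * m + 1) + (2 * m + 3)) := by
    intro T w
    have h1 : (f T w).cost = (∑ _i : Fin m, 2) + ((∑ _k : Fin g, ((∑ _i : Fin m, 2) + 1)) +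
      ((∑ _i : Fin m, 2) + 3)) := rfl
    rw [h1]
    simp
    ring
  rw [h0, foldlM_cost _ _ hK, List.length_ofFn]
  simp [ZMod.card]
  ring

theorem search_cost : (search A b W).cost =
    (fillTable A b W).cost + ((dftAll g (fillTable A b W).val).cost + q ^ g * 3) := by
  classical
  set f : Option (Fin g → ZMod q) × ℝ → (Fin g → ZMod q) → Timed (Option (Fin g → ZMod q) × ℝ) :=
    fun st t => do
      let F ← op ((dftAll g (fillTable A b W).val).val t).re
      let c ← op (decide (F ≥ st.2))
      if c then op (some t, F) else op st with hf
  have hK : ∀ st t, (f st t).cost = 3 := by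
    intro st t
    have h1 : (f st t).cost = 1 + (1 +
        (if decide (((dftAll g (fillTable A b W).val).val t).re ≥ st.2)
      then op (some t, ((dftAll g (fillTable A b W).val).val t).re) else op st : Timed _).cost) :=
          rfl
    rw [h1]
    split_ifs <;> rfl
  have h0 : (search A b W).cost = (fillTable A b W).cost + ((dftAll g (fillTable A b W).val).cost +
      (((Finset.univ : Finset (Fin g → ZMod q)).toList.foldlM f (none, 0)).cost + 0)) := by
    rw [search]
    congr!
  rw [h0, foldlM_cost _ _ hK, Finset.length_toList, Finset.card_univ, Fintype.card_fun, ZMod.card,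
    Fintype.card_fin, add_zero]

end Search

/-! ### Cost bounds -/

section Cost

theorem one_le_logb_two {q : ℕ} (hq : 2 ≤ q) : 1 ≤ logb 2 (q : ℝ) := by
  rw [le_logb_iff_rpow_le (by norm_num) (by positivity), rpow_one]
  exact_mod_cast hq

variable {q : ℕ} [NeZero q]

/-- The cost in terms of the length `2^t` of the three radix-2 transforms. -/
theorem dftLine_cost_le (x : ZMod q → ℂ) : (dftLine x).cost ≤
    9 * 2 ^ (Nat.clog 2 q + 1) + 12 * (Nat.clog 2 q + 1) * 2 ^ (Nat.clog 2 q + 1) + 5 * q := by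
  set t := Nat.clog 2 q + 1 with ht
  have h : ∃ Y H P : ℕ → ℂ, (dftLine x).cost =
      (∑ j ∈ Finset.range (2 ^ t), ((if j < q then (do
          let c ← chirp q 1 (q - 1 - j)
          op (c * x ((q - 1 - j : ℕ) : ZMod q)) : Timed ℂ) else op 0).cost + 1)) +
      ((∑ _j ∈ Finset.range (2 ^ t), 3) + ((fft 1 t Y).cost + ((fft 1 t H).cost +
        ((∑ _j ∈ Finset.range (2 ^ t), 2) + ((fft (-1) t P).cost + ∑ _k : ZMod q, 5))))) :=
    ⟨_, _, _, rfl⟩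
  obtain ⟨Y, H, P, h⟩ := h
  rw [h, fft_cost, fft_cost, fft_cost]
  have h1 : ∑ j ∈ Finset.range (2 ^ t), ((if j < q then (do
          let c ← chirp q 1 (q - 1 - j)
          op (c * x ((q - 1 - j : ℕ) : ZMod q)) : Timed ℂ) else op 0).cost + 1) ≤
      ∑ _j ∈ Finset.range (2 ^ t), 4 := by
    refine Finset.sum_le_sum fun j _ => ?_
    split_ifs
    · exact le_rfl
    · exact (by decide : 1 + 1 ≤ 4)
  simp only [Finset.sum_const, Finset.card_range, Finset.card_univ, ZMod.card, smul_eq_mul] at h1 ⊢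
  nlinarith

/-- Since `2^t < 4q`, a transform of length `q` costs `O(q log q)`. -/
theorem dftLine_cost_le_logb (hq : 2 ≤ q) (x : ZMod q → ℂ) :
    ((dftLine x).cost : ℝ) ≤ 185 * (q * logb 2 q) := by
  have h := dftLine_cost_le x
  have hl := one_le_logb_two hq
  have hq0 : (0 : ℝ) < q := by positivity
  have hpos : 0 < Nat.clog 2 q := Nat.clog_pos (by norm_num) hq
  have hlt : 2 ^ (Nat.clog 2 q).pred < q := Nat.pow_pred_clog_lt_self (by norm_num) hq
  obtain ⟨c, hc⟩ : ∃ c, Nat.clog 2 q = c + 1 := ⟨_, (Nat.succ_pred_eq_of_pos hpos).symm⟩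
  rw [hc] at h hlt
  rw [Nat.pred_succ] at hlt
  have hc' : (c : ℝ) ≤ logb 2 q := by
    rw [le_logb_iff_rpow_le (by norm_num) hq0, rpow_natCast]
    exact_mod_cast hlt.le
  have hltR : (2 : ℝ) ^ c ≤ q := by exact_mod_cast hlt.le
  have hR : ((dftLine x).cost : ℝ) ≤ 9 * 2 ^ (c + 1 + 1) + 12 * (c + 1 + 1) * 2 ^ (c + 1 + 1) +
      5 * q := by
    exact_mod_cast h
  have hp : (2 : ℝ) ^ (c + 1 + 1) ≤ 4 * q := by
    rw [pow_succ, pow_succ]; linarith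
  have h1 : (12 * ((c : ℝ) + 1 + 1)) * 2 ^ (c + 1 + 1) ≤ (12 * (logb 2 q + 2)) * (4 * q) :=
    mul_le_mul (by linarith) hp (by positivity) (by linarith)
  have h2 : (q : ℝ) ≤ q * logb 2 q := le_mul_of_one_le_right hq0.le hl
  nlinarith

theorem dftAll_succ_cost (g : ℕ) (T : (Fin (g + 1) → ZMod q) → ℂ) :
    (dftAll (g + 1) T).cost = (∑ a : ZMod q, ((dftAll g fun u => T (Fin.cons a u)).cost + 1)) +
      ((∑ u : Fin g → ZMod q, ((dftLine fun a =>
          (dftAll g fun v => T (Fin.cons a v)).val u).cost + 1)) +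
        ∑ _t : Fin (g + 1) → ZMod q, 2) := rfl

theorem dftAll_cost_le (hq : 2 ≤ q) : ∀ (g : ℕ) (T : (Fin g → ZMod q) → ℂ),
    ((dftAll g T).cost : ℝ) ≤ 189 * g * ((q : ℝ) ^ g * logb 2 q)
  | 0, T => by
    have : (dftAll 0 T).cost = 0 := rfl
    simp [this]
  | g + 1, T => by
    have hl := one_le_logb_two hq
    have hq1 : (1 : ℝ) ≤ q := by exact_mod_cast (by omega : 1 ≤ q)
    rw [dftAll_succ_cost]
    push_cast
    have h1 : ∑ a : ZMod q, (((dftAll g fun u => T (Fin.cons a u)).cost : ℝ) + 1) ≤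
        q * (189 * g * ((q : ℝ) ^ g * logb 2 q) + 1) := by
      refine (Finset.sum_le_card_nsmul _ _ _ fun a _ =>
          add_le_add_left (dftAll_cost_le hq g _) 1).trans ?_
      simp [ZMod.card, mul_add]
    have h2 : ∑ u : Fin g → ZMod q,
        (((dftLine fun a => (dftAll g fun v => T (Fin.cons a v)).val u).cost : ℝ) + 1) ≤
        (q : ℝ) ^ g * (185 * (q * logb 2 q) + 1) := by
      refine (Finset.sum_le_card_nsmul _ _ _ fun a _ =>
        add_le_add_left (dftLine_cost_le_logb hq _) 1).trans ?_
      simp [ZMod.card, mul_add]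
    have h3 : ∑ _t : Fin (g + 1) → ZMod q, (2 : ℝ) = (q : ℝ) ^ g * q * 2 := by
      simp [ZMod.card, pow_succ]
    rw [h3]
    have hg1 : (1 : ℝ) ≤ (q : ℝ) ^ g := one_le_pow₀ hq1
    have e1 : (q : ℝ) ≤ (q : ℝ) ^ g * q * logb 2 q := by
      calc (q : ℝ) = 1 * q * 1 := by ring
        _ ≤ _ := by gcongr
    have e2 : (q : ℝ) ^ g ≤ (q : ℝ) ^ g * q * logb 2 q := by
      calc (q : ℝ) ^ g = (q : ℝ) ^ g * 1 * 1 := by ring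
        _ ≤ _ := by gcongr
    have e3 : (q : ℝ) ^ g * q ≤ (q : ℝ) ^ g * q * logb 2 q :=
      le_mul_of_one_le_right (by positivity) hl
    rw [pow_succ]
    linarith

end Cost

/-! ### Conditioning and total variation distance -/

section Conditioning

variable {Ω : Type} {μ : Ω → ℝ}

/-- The distance of a distribution to its conditioning on an event is the mass of the
complement. -/
theorem tvDist_conditional (h0 : ∀ x, 0 ≤ μ x) (h1 : HasSum μ 1) (P : Ω → Prop)
    [DecidablePred P] {a : ℝ} (ha : 0 < a)
    (hS : HasSum (fun x => if P x then μ x else 0) a) (ν : Ω → ℝ)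
    (hν : ∀ x, ν x = if P x then μ x / a else 0) : tvDist μ ν = 1 - a := by
  have ha1 : a ≤ 1 := hasSum_le (fun x => by split_ifs <;> simp [h0]) hS h1
  have hpt : ∀ x, |μ x - ν x| = (μ x - if P x then μ x else 0) +
      (1 / a - 1) * if P x then μ x else 0 := by
    intro x
    rw [hν]
    split_ifs
    · rw [abs_of_nonpos]
      · ring
      · exact sub_nonpos.2 (le_div_self (h0 x) ha ha1)
    · rw [sub_zero, abs_of_nonneg (h0 x)]
      ring
  rw [tvDist]
  simp_rw [hpt]
  rw [((h1.sub hS).add (hS.mul_left _)).tsum_eq]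
  field_simp
  ring

theorem productMass_nonneg {α : Type} {μ : α → ℝ} (h0 : ∀ x, 0 ≤ μ x) (N : ℕ) (W : Fin N → α) :
    0 ≤ productMass μ N W := Finset.prod_nonneg fun _ _ => h0 _

theorem hasSum_prod_pow {α : Type} {f : α → ℝ} {a : ℝ} (h0 : ∀ x, 0 ≤ f x) (h : HasSum f a)
    (N : ℕ) : HasSum (fun W : Fin N → α => ∏ j, f (W j)) (a ^ N) := by
  have hs : ∀ _ : Fin N, Summable fun x => ‖f x‖ := fun _ => by
    simpa [Real.norm_of_nonneg (h0 _)] using h.summable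
  have h1 := summable_pi_prod (fun _ : Fin N => f) hs
  have h2 := tsum_pi_prod (fun _ : Fin N => f) hs
  rw [h.tsum_eq, Finset.prod_const, Finset.card_univ, Fintype.card_fin] at h2
  rw [← h2]
  exact h1.hasSum

open Classical in
theorem prod_ite_mem {α : Type} (f : α → ℝ) (S : Set α) {N : ℕ} (W : Fin N → α) :
    (∏ j, if W j ∈ S then f (W j) else 0) = if ∀ j, W j ∈ S then ∏ j, f (W j) else 0 := by
  split_ifs with h
  · exact Finset.prod_congr rfl fun j _ => if_pos (h j)
  · obtain ⟨j, hj⟩ := not_forall.1 h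
    exact Finset.prod_eq_zero (Finset.mem_univ j) (if_neg hj)

theorem one_sub_pow_le {a : ℝ} (ha : 0 ≤ a) (N : ℕ) : 1 - a ^ N ≤ N * (1 - a) := by
  have := one_add_mul_le_pow (a := a - 1) (by linarith) N
  rw [add_sub_cancel] at this
  linarith

open Classical in
theorem productMass_conditional {α : Type} {μ ν : α → ℝ} {S : Set α} {a : ℝ}
    (hν : ∀ x, ν x = if x ∈ S then μ x / a else 0) {N : ℕ} (W : Fin N → α) :
    productMass ν N W = if ∀ j, W j ∈ S then productMass μ N W / a ^ N else 0 := by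
  rw [productMass]
  simp_rw [hν]
  rw [prod_ite_mem (fun x => μ x / a), Finset.prod_div_distrib]
  simp [productMass]

end Conditioning

/-! ### A Chernoff bound -/

section Chernoff

variable {α : Type} {μ : α → ℝ}

theorem summable_mul_of_abs_le {X : α → ℝ} {K : ℝ} (h0 : ∀ x, 0 ≤ μ x) (h1 : Summable μ)
    (hX : ∀ x, |X x| ≤ K) : Summable fun x => μ x * X x := by
  refine Summable.of_norm_bounded (h1.mul_right K) fun x => ?_
  rw [norm_mul, Real.norm_of_nonneg (h0 x)]
  exact mul_le_mul_of_nonneg_left (hX x) (h0 x)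

/-- A bounded centred variable is sub-Gaussian; the constant is not optimal. -/
theorem tsum_mul_exp_le (h0 : ∀ x, 0 ≤ μ x) (h1 : HasSum μ 1) {X : α → ℝ} (hX : ∀ x, |X x| ≤ 1)
    {E : ℝ} (hE : ∑' x, μ x * X x = E) {l : ℝ} (hl0 : 0 ≤ l) (hl : l ≤ 1 / 2) :
    (Summable fun x => μ x * exp (l * (X x - E))) ∧
      ∑' x, μ x * exp (l * (X x - E)) ≤ exp (l ^ 2) := by
  have hXs : Summable fun x => μ x * X x := summable_mul_of_abs_le h0 h1.summable hX
  have hX2 : ∀ x, |X x ^ 2| ≤ 1 := fun x => by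
    rw [abs_pow]; exact pow_le_one₀ (abs_nonneg _) (hX x)
  have hX2s : Summable fun x => μ x * X x ^ 2 := summable_mul_of_abs_le h0 h1.summable hX2
  have hE1 : |E| ≤ 1 := by
    rw [← hE, ← Real.norm_eq_abs, ← h1.tsum_eq]
    refine (norm_tsum_le_tsum_norm hXs.norm).trans (Summable.tsum_le_tsum (fun x =>
        ?_) hXs.norm h1.summable)
    rw [norm_mul, Real.norm_of_nonneg (h0 x)]
    exact mul_le_of_le_one_right (h0 x) (hX x)
  have hX2le : ∑' x, μ x * X x ^ 2 ≤ 1 := by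
    rw [← h1.tsum_eq]
    exact Summable.tsum_le_tsum (fun x =>
        mul_le_of_le_one_right (h0 x) ((le_abs_self _).trans (hX2 x)))
      hX2s h1.summable
  -- As `|X - E| ≤ 2` and `l ≤ 1/2`, the exponent lies where `exp y ≤ 1 + y + y²` holds.
  have hbd : ∀ x, |l * (X x - E)| ≤ 1 := fun x => by
    rw [abs_mul, abs_of_nonneg hl0]
    have : |X x - E| ≤ 2 := (abs_sub _ _).trans (by linarith [hX x])
    nlinarith [abs_nonneg (X x - E)]
  have hs : Summable fun x => μ x * exp (l * (X x - E)) := by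
    refine summable_mul_of_abs_le (K := exp 1) h0 h1.summable fun x => ?_
    rw [abs_of_pos (exp_pos _), exp_le_exp]
    exact (le_abs_self _).trans (hbd x)
  refine ⟨hs, ?_⟩
  have hexp : ∀ x, exp (l * (X x - E)) ≤ 1 + l * (X x - E) + (l * (X x - E)) ^ 2 := fun x => by
    have := (le_abs_self _).trans (abs_exp_sub_one_sub_id_le (hbd x))
    linarith
  have hsum : HasSum (fun x => (1 - l * E + l ^ 2 * E ^ 2) * μ x +
      (l - 2 * l ^ 2 * E) * (μ x * X x) +
      l ^ 2 * (μ x * X x ^ 2))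
      ((1 - l * E + l ^ 2 * E ^ 2) * 1 + (l - 2 * l ^ 2 * E) * E + l ^ 2 * ∑' x, μ x * X x ^ 2) :=
    ((h1.mul_left _).add ((hE ▸ hXs.hasSum).mul_left _)).add (hX2s.hasSum.mul_left _)
  calc ∑' x, μ x * exp (l * (X x - E)) ≤ _ := hasSum_le (fun x => by
        have := mul_le_mul_of_nonneg_left (hexp x) (h0 x)
        refine this.trans_eq ?_
        ring) hs.hasSum hsum
    _ = 1 - l ^ 2 * E ^ 2 + l ^ 2 * ∑' x, μ x * X x ^ 2 := by ring
    _ ≤ l ^ 2 + 1 := by nlinarith [sq_nonneg l, sq_nonneg (l * E)]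
    _ ≤ _ := add_one_le_exp _

open Classical in
/-- With high probability all of finitely many empirical means exceed their expectation by less
than `δ`. -/
theorem one_sub_card_mul_exp_le {ι : Type} [Fintype ι] (h0 : ∀ x, 0 ≤ μ x) (h1 : HasSum μ 1)
    (X : ι → α → ℝ) (hX : ∀ t x, |X t x| ≤ 1) {E : ι → ℝ} (hE : ∀ t, ∑' x, μ x * X t x = E t)
    {δ : ℝ} (hδ0 : 0 ≤ δ) (hδ : δ ≤ 1) (N : ℕ) :
    1 - Fintype.card ι * exp (-(N * δ ^ 2 / 4)) ≤ ∑' W : Fin N → α,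
      if ∀ t, ∑ j, X t (W j) < N * (E t + δ) then productMass μ N W else 0 := by
  have hP := hasSum_prod_pow h0 h1 N
  rw [one_pow] at hP
  have hP0 : ∀ W : Fin N → α, 0 ≤ productMass μ N W := productMass_nonneg h0 N
  -- Markov's inequality for the exponential moments with parameter `δ / 2`, which minimizes
  -- `N l² - l N δ`.
  have hY : ∀ t, HasSum (fun W : Fin N → α => exp (-(δ / 2 * (N * δ))) *
      ∏ j, (μ (W j) * exp (δ / 2 * (X t (W j) - E t))))
      (exp (-(δ / 2 * (N * δ))) * (∑' x, μ x * exp (δ / 2 * (X t x - E t))) ^ N) := fun t =>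
    (hasSum_prod_pow (fun x => mul_nonneg (h0 x) (exp_pos _).le)
      (tsum_mul_exp_le h0 h1 (hX t) (hE t) (by linarith) (by linarith)).1.hasSum N).mul_left _
  have hG : Summable fun W : Fin N → α =>
      if ∀ t, ∑ j, X t (W j) < N * (E t + δ) then productMass μ N W else 0 :=
    summable_ite_of_nonneg hP.summable hP0 _
  have hsum := hasSum_sum (s := Finset.univ) fun t (_ : t ∈ Finset.univ) => hY t
  have hle := hasSum_le (fun W => ?_) hP (hG.hasSum.add hsum)
  · have hcard : ∑ t, exp (-(δ / 2 * (N * δ))) * (∑' x, μ x * exp (δ / 2 * (X t x - E t))) ^ N ≤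
        Fintype.card ι * exp (-(N * δ ^ 2 / 4)) := by
      refine (Finset.sum_le_card_nsmul _ _ (exp (-(N * δ ^ 2 / 4))) fun t _ => ?_).trans_eq (by
        simp)
      have hb := (tsum_mul_exp_le h0 h1 (hX t) (hE t) (l := δ / 2) (by linarith) (by linarith)).2
      calc _ ≤ exp (-(δ / 2 * (N * δ))) * exp ((δ / 2) ^ 2) ^ N := by
            gcongr
            exact tsum_nonneg fun x => mul_nonneg (h0 x) (exp_pos _).le
        _ = _ := by
            rw [← exp_nat_mul, ← exp_add]
            congr 1
            ring
    linarith
  · have hterm : ∀ t, 0 ≤ exp (-(δ / 2 * (N * δ))) *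
        ∏ j, (μ (W j) * exp (δ / 2 * (X t (W j) - E t))) := fun t =>
      mul_nonneg (exp_pos _).le (Finset.prod_nonneg fun j _ => mul_nonneg (h0 _) (exp_pos _).le)
    change productMass μ N W ≤ _
    split_ifs with h
    · exact le_add_of_nonneg_right (Finset.sum_nonneg fun t _ => hterm t)
    · rw [zero_add]
      obtain ⟨t, ht⟩ := not_forall.1 h
      refine le_trans ?_ (Finset.single_le_sum (fun t _ => hterm t) (Finset.mem_univ t))
      rw [Finset.prod_mul_distrib, mul_left_comm, ← exp_sum, ← exp_add]
      refine le_mul_of_one_le_right (hP0 W) (one_le_exp ?_)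
      rw [← Finset.mul_sum, Finset.sum_sub_distrib, Finset.sum_const, Finset.card_univ,
          Fintype.card_fin,
        nsmul_eq_mul]
      have h2 : N * δ ≤ ∑ j, X t (W j) - N * E t := by linarith [not_lt.1 ht]
      have := mul_le_mul_of_nonneg_left h2 (by linarith : 0 ≤ δ / 2)
      linarith

end Chernoff

/-! ### The search loop -/

open Classical in
/-- A strict maximizer of `F` survives the loop, although the loop lets later ties win. -/
theorem foldl_argmax {α : Type} (F : α → ℝ) (t₀ : α) (hmax : ∀ t, t ≠ t₀ → F t < F t₀)
    (l : List α) (st : Option α × ℝ) (h : st = (some t₀, F t₀) ∨ (st.2 ≤ F t₀ ∧ t₀ ∈ l)) :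
    l.foldl (fun (st : Option α × ℝ) t => if F t ≥ st.2 then (some t, F t) else st) st =
      (some t₀, F t₀) := by
  induction l generalizing st with
  | nil =>
    rcases h with rfl | ⟨-, h⟩
    · rfl
    · simp at h
  | cons a l ih =>
    rw [List.foldl_cons]
    apply ih
    by_cases ha : a = t₀
    · subst ha
      rcases h with rfl | ⟨h, -⟩
      · simp
      · simp [h]
    · rcases h with rfl | ⟨h, hm⟩
      · left
        exact if_neg (not_le.2 (hmax a ha))
      · right
        refine ⟨?_, (List.mem_cons.1 hm).resolve_left (Ne.symm ha)⟩
        split_ifs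
        · exact (hmax a ha).le
        · exact h

theorem attackOutput_eq {m g d q N : ℕ} [NeZero q] (A : Matrix (Fin m) (Fin g ⊕ Fin d) (ZMod q))
    (b : Fin m → ZMod q) (W : Fin N → Fin m → ℤ) (t₀ : Fin g → ZMod q)
    (h0 : 0 ≤ score A b W t₀) (hmax : ∀ t, t ≠ t₀ → score A b W t < score A b W t₀) :
    attackOutput A b W = some t₀ := by
  rw [attackOutput, foldl_argmax (score A b W) t₀ hmax _ _
    (Or.inr ⟨h0, Finset.mem_toList.2 (Finset.mem_univ _)⟩)]

/-! ### Discrete Gaussians and their truncations -/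

section Truncation

variable {m : ℕ}

theorem discreteGaussian_nonneg (S : Set (Fin m → ℤ)) (σ : ℝ) (z : Fin m → ℤ) :
    0 ≤ discreteGaussian S σ z := by
  rw [discreteGaussian]
  split_ifs
  · exact div_nonneg (rho_pos _ _).le (tsum_nonneg fun _ => (rho_pos _ _).le)
  · exact le_rfl

theorem hasSum_discreteGaussian {σ : ℝ} (hσ : 0 < σ) {S : Set (Fin m → ℤ)} (h0 : 0 ∈ S) :
    HasSum (discreteGaussian S σ) 1 := by
  classical
  have h : HasSum (fun z : Fin m → ℤ => if z ∈ S then rho σ ‖toE z‖ else 0) (rhoSet σ S) := by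
    rw [rhoSet_eq_tsum]
    exact (summable_ite_of_nonneg (summable_rho_toE hσ) (fun _ => (rho_pos _ _).le) _).hasSum
  have h2 := h.div_const (rhoSet σ S)
  rw [div_self (rhoSet_pos hσ h0).ne'] at h2
  have he : discreteGaussian S σ =
      fun z => (if z ∈ S then rho σ ‖toE z‖ else 0) / rhoSet σ S := by
    funext z
    rw [discreteGaussian]
    split_ifs <;> simp
  rwa [he]

variable {L : Submodule ℤ (Fin m → ℤ)} {σ R : ℝ}

theorem retainedMass_pos (hσ : 0 < σ) (hR : 0 ≤ R) : 0 < retainedMass L σ R :=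
  div_pos (rhoSet_pos hσ (zero_mem_truncated hR)) (rhoSet_pos hσ (zero_mem L))

open Classical in
theorem discreteGaussian_truncated (hσ : 0 < σ) (z : Fin m → ℤ) :
    discreteGaussian (truncated L R) σ z = if z ∈ truncated L R then
      discreteGaussian (L : Set (Fin m → ℤ)) σ z / retainedMass L σ R else 0 := by
  have hL : 0 < rhoSet σ (L : Set (Fin m → ℤ)) := rhoSet_pos hσ (zero_mem L)
  by_cases hz : z ∈ truncated L R
  · rw [discreteGaussian, if_pos hz, if_pos hz, discreteGaussian,
      if_pos (show z ∈ (L : Set _) from hz.1),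
      retainedMass, div_div_div_cancel_right₀ hL.ne']
  · rw [discreteGaussian, if_neg hz, if_neg hz]

open Classical in
theorem hasSum_retainedMass (hσ : 0 < σ) : HasSum (fun z => if z ∈ truncated L R then
    discreteGaussian (L : Set (Fin m → ℤ)) σ z else 0) (retainedMass L σ R) := by
  have h : HasSum (fun z : Fin m → ℤ => if z ∈ truncated L R then rho σ ‖toE z‖ else 0)
      (rhoSet σ (truncated L R)) := by
    rw [rhoSet_eq_tsum]
    exact (summable_ite_of_nonneg (summable_rho_toE hσ) (fun _ => (rho_pos _ _).le) _).hasSum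
  have he : (fun z => if z ∈ truncated L R then discreteGaussian (L : Set (Fin m → ℤ)) σ z else 0) =
      fun z => (if z ∈ truncated L R then rho σ ‖toE z‖ else 0) /
        rhoSet σ (L : Set (Fin m → ℤ)) := by
    funext z
    by_cases hz : z ∈ truncated L R
    · rw [if_pos hz, if_pos hz, discreteGaussian, if_pos (show z ∈ (L : Set _) from hz.1)]
    · simp [hz]
  rw [he]
  exact h.div_const _

theorem retainedMass_le_one (hσ : 0 < σ) : retainedMass L σ R ≤ 1 := by
  classical
  refine hasSum_le (fun z => ?_) (hasSum_retainedMass hσ) (hasSum_discreteGaussian hσ (zero_mem L))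
  split_ifs
  · exact le_rfl
  · exact discreteGaussian_nonneg _ _ _

theorem tvDist_truncated (hσ : 0 < σ) (hR : 0 ≤ R) :
    tvDist (discreteGaussian (L : Set (Fin m → ℤ)) σ) (discreteGaussian (truncated L R) σ) =
      1 - retainedMass L σ R := by
  classical
  exact tvDist_conditional (discreteGaussian_nonneg _ _) (hasSum_discreteGaussian hσ (zero_mem L))
    (fun z => z ∈ truncated L R) (retainedMass_pos hσ hR) (hasSum_retainedMass hσ) _
        (discreteGaussian_truncated hσ)

open Classical in
theorem hasSum_retainedMass_pow (hσ : 0 < σ) (N : ℕ) :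
    HasSum (fun W : Fin N → Fin m → ℤ => if ∀ j, W j ∈ truncated L R then
      productMass (discreteGaussian (L : Set (Fin m → ℤ)) σ) N W else 0)
      (retainedMass L σ R ^ N) := by
  convert hasSum_prod_pow (fun z => ?_) (hasSum_retainedMass (L := L) (R := R) hσ) N using 2 with W
  · exact (prod_ite_mem (discreteGaussian (L : Set (Fin m → ℤ)) σ) _ W).symm
  · split_ifs
    · exact discreteGaussian_nonneg _ _ _
    · exact le_rfl

theorem hasSum_productMass (hσ : 0 < σ) (N : ℕ) :
    HasSum (productMass (discreteGaussian (L : Set (Fin m → ℤ)) σ) N) 1 := by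
  have h := hasSum_prod_pow (discreteGaussian_nonneg _ _)
    (hasSum_discreteGaussian hσ (S := (L : Set (Fin m → ℤ))) (zero_mem L)) N
  rwa [one_pow] at h

theorem tvDist_product_truncated (hσ : 0 < σ) (hR : 0 ≤ R) (N : ℕ) :
    tvDist (productMass (discreteGaussian (L : Set (Fin m → ℤ)) σ) N)
      (productMass (discreteGaussian (truncated L R) σ) N) = 1 - retainedMass L σ R ^ N := by
  classical
  exact tvDist_conditional (productMass_nonneg (discreteGaussian_nonneg _ _) N)
    (hasSum_productMass hσ N) (fun W => ∀ j, W j ∈ truncated L R)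
    (pow_pos (retainedMass_pos hσ hR) N) (hasSum_retainedMass_pow hσ N) _
    (productMass_conditional (discreteGaussian_truncated hσ))

theorem rho_le_of_sqrt_log_le {σ t x : ℝ} (hσ : 0 < σ) (hx : 1 ≤ x) (ht : σ * √(log x / π) ≤ t) :
    rho σ t ≤ x⁻¹ := by
  have hlog : 0 ≤ log x / π := div_nonneg (log_nonneg hx) pi_pos.le
  refine (rho_anti (by positivity) ht).trans_eq ?_
  rw [rho, mul_pow, sq_sqrt hlog, ← exp_log (inv_pos.2 (by linarith : 0 < x)), log_inv]
  congr 1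
  field_simp

theorem one_sub_retainedMass_le {d q N : ℕ} [NeZero q] (M : Matrix (Fin m) (Fin d) (ZMod q))
    (hm : 0 < m) (hσ : 0 < σ) {ε : ℝ} (hN : 0 < N) (hε0 : 0 < ε) (hε1 : ε < 1)
    (hR : σ * (√(m / (2 * π)) + √(log (N / ε) / π)) ≤ R) :
    1 - retainedMass (dualQaryLattice M) σ R ≤ ε / N := by
  have hL : 0 < rhoSet σ (dualQaryLattice M : Set (Fin m → ℤ)) := rhoSet_pos hσ (zero_mem _)
  have hN1 : (1 : ℝ) ≤ N := by exact_mod_cast hN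
  have hx : 1 ≤ N / ε := (one_le_div hε0).2 (by linarith)
  rw [mul_add] at hR
  have hs : 0 ≤ σ * √(log (N / ε) / π) := by positivity
  have h1 := rhoSet_tail_le M hm hσ (by linarith : σ * √(m / (2 * π)) ≤ R)
  have h2 := rho_le_of_sqrt_log_le hσ hx (by linarith : _ ≤ R - σ * √(m / (2 * π)))
  rw [inv_div] at h2
  refine le_trans ?_ h2
  rw [retainedMass, one_sub_div hL.ne', div_le_iff₀ hL]
  exact h1

end Truncation

/-! ### Success probability of the attack -/

section Success

variable {m g d q : ℕ} (A : Matrix (Fin m) (Fin g ⊕ Fin d) (ZMod q))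

theorem mulVec_eq_toCols (x : Fin g ⊕ Fin d → ZMod q) : A *ᵥ x =
    A.toCols₁ *ᵥ (fun i => x (Sum.inl i)) + A.toCols₂ *ᵥ fun i => x (Sum.inr i) := by
  ext i
  simp [mulVec, dotProduct, Fintype.sum_sum_type]

variable [NeZero q]

theorem firstMin_le {L : Submodule ℤ (Fin m → ℤ)} {z : Fin m → ℤ} (hz : z ∈ L) (h0 : z ≠ 0) :
    firstMin L ≤ ‖toE z‖ :=
  csInf_le ⟨0, by rintro _ ⟨w, -, -, rfl⟩; exact norm_nonneg _⟩ ⟨z, hz, h0, rfl⟩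

/-- The expected score contribution of a guess `t`. -/
noncomputable def meanScore (s : ℝ) (b : Fin m → ZMod q) (t : Fin g → ZMod q) : ℝ :=
  spanMass (1 / s) A.toCols₂ (b - A.toCols₁ *ᵥ t) / spanMass (1 / s) A.toCols₂ 0

variable {s : ℝ} (e : Fin m → ℤ) (secret : Fin g ⊕ Fin d → ZMod q)

/-- The mean score of the secret. -/
theorem rho_le_meanScore (hs : 0 < s) : rho (1 / s) ‖toE e‖ ≤
    meanScore A s (A *ᵥ secret + modQ q e) fun i => secret (Sum.inl i) := by
  have hs' : 0 < 1 / s := by positivity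
  have hv : A *ᵥ secret + modQ q e - A.toCols₁ *ᵥ (fun i => secret (Sum.inl i)) =
      A.toCols₂ *ᵥ (fun i => secret (Sum.inr i)) + modQ q e := by
    rw [mulVec_eq_toCols]; abel
  rw [meanScore, hv, spanMass_mulVec_add, le_div_iff₀ (spanMass_zero_pos hs' _)]
  exact rho_mul_spanMass_le _ hs' e

/-- The mean score of a wrong guess: its coset of `L_q(A_dual)`, shifted back by `e`, consists of
nonzero vectors of `L_q(A)`. -/
theorem meanScore_le_rho (hm : 0 < m) (hs : 0 < s)
    (hind : ∀ (t : Fin g → ZMod q) (x : Fin d → ZMod q),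
      A.toCols₁ *ᵥ t = A.toCols₂ *ᵥ x → t = 0)
    (hsep : 1 / s * √(m / (2 * π)) + ‖toE e‖ ≤ firstMin (qaryLattice A))
    (t : Fin g → ZMod q) (ht : t ≠ fun i => secret (Sum.inl i)) :
    meanScore A s (A *ᵥ secret + modQ q e) t ≤
      rho (1 / s) (firstMin (qaryLattice A) - ‖toE e‖ - 1 / s * √(m / (2 * π))) := by
  have hs' : 0 < 1 / s := by positivity
  rw [meanScore, div_le_iff₀ (spanMass_zero_pos hs' _)]
  refine spanMass_le_rho_of_far _ hm hs' (by linarith) _ fun z x hz => ?_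
  have hv : modQ q (z - e) = A.toCols₁ *ᵥ ((fun i => secret (Sum.inl i)) - t) +
      A.toCols₂ *ᵥ ((fun i => secret (Sum.inr i)) + x) := by
    rw [modQ_sub, hz, mulVec_eq_toCols, mulVec_sub, mulVec_add]; abel
  have hmem : z - e ∈ qaryLattice A :=
    ⟨Sum.elim ((fun i => secret (Sum.inl i)) - t) ((fun i => secret (Sum.inr i)) + x), by
      rw [hv, mulVec_eq_toCols]; rfl⟩
  have hne : z - e ≠ 0 := fun h0 => by
    have h1 : modQ q (z - e) = 0 := by rw [h0]; ext i; simp [modQ]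
    rw [hv, add_eq_zero_iff_eq_neg, ← mulVec_neg] at h1
    exact ht (sub_eq_zero.1 (hind _ _ h1)).symm
  have h2 := firstMin_le hmem hne
  rw [toE_sub] at h2
  linarith [norm_sub_le (toE z) (toE e)]

theorem pow_le_pow_of_independent
    (hind : ∀ (t : Fin g → ZMod q) (x : Fin d → ZMod q),
      A.toCols₁ *ᵥ t = A.toCols₂ *ᵥ x → t = 0) : q ^ g ≤ q ^ m := by
  have hinj : Function.Injective fun t : Fin g → ZMod q => A.toCols₁ *ᵥ t := fun t t' h =>
    sub_eq_zero.1 (hind _ 0 (by simpa [mulVec_sub, sub_eq_zero] using h))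
  simpa [ZMod.card] using Fintype.card_le_of_injective _ hinj

open Classical in
/-- For independent samples from the untruncated discrete Gaussian, the search finds the secret with
high probability. -/
theorem success_untruncated (hm : 0 < m) (hs : 0 < s) {δ : ℝ} (hδ : 0 < δ)
    (hind : ∀ (t : Fin g → ZMod q) (x : Fin d → ZMod q),
      A.toCols₁ *ᵥ t = A.toCols₂ *ᵥ x → t = 0)
    (hsep : 1 / s * √(m / (2 * π)) + ‖toE e‖ ≤ firstMin (qaryLattice A))
    (hgap : 2 * δ < rho (1 / s) ‖toE e‖ -
      rho (1 / s) (firstMin (qaryLattice A) - ‖toE e‖ - 1 / s * √(m / (2 * π))))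
    {N : ℕ} (hN : 0 < N) :
    1 - (q : ℝ) ^ g * exp (-(N * δ ^ 2 / 4)) ≤ ∑' W : Fin N → Fin m → ℤ,
      if attackOutput A (A *ᵥ secret + modQ q e) W = some (fun i => secret (Sum.inl i)) then
        productMass (discreteGaussian (dualQaryLattice A.toCols₂ : Set (Fin m → ℤ)) (q * s)) N W
      else 0 := by
  have hq : (0 : ℝ) < q := by exact_mod_cast Nat.pos_of_ne_zero (NeZero.ne q)
  have hσ : 0 < q * s := mul_pos hq hs
  set b := A *ᵥ secret + modQ q e
  set t₀ : Fin g → ZMod q := fun i => secret (Sum.inl i) with ht₀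
  set μ := discreteGaussian (dualQaryLattice A.toCols₂ : Set (Fin m → ℤ)) (q * s)
  have h1 : HasSum μ 1 := hasSum_discreteGaussian hσ (zero_mem _)
  -- The score of the secret is to be bounded from below, all others from above.
  set sg : (Fin g → ZMod q) → ℝ := fun t => if t = t₀ then -1 else 1 with hsg
  have hsgabs : ∀ t, |sg t| = 1 := fun t => by simp only [hsg]; split_ifs <;> simp
  set c : (Fin g → ZMod q) → (Fin m → ℤ) → ℝ := fun t w =>
    cos (2 * π * ((modQ q w ⬝ᵥ (b - A.toCols₁ *ᵥ t)).val : ℝ) / q) with hc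
  have hscore : ∀ (W : Fin N → Fin m → ℤ) t, score A b W t = ∑ j, c t (W j) := fun W t => rfl
  have hmean : ∀ t, ∑' w, μ w * (sg t * c t w) = sg t * meanScore A s b t := fun t => by
    simp_rw [mul_left_comm _ (sg t)]
    rw [tsum_mul_left, mean_cos_eq hs]
    rfl
  have hδ1 : δ ≤ 1 := by
    linarith [rho_le_one (1 / s) ‖toE e‖,
      rho_pos (1 / s) (firstMin (qaryLattice A) - ‖toE e‖ - 1 / s * √(m / (2 * π)))]
  have hch := one_sub_card_mul_exp_le (discreteGaussian_nonneg _ _) h1 (fun t w => sg t * c t w)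
    (fun t w => by rw [abs_mul, hsgabs, one_mul]; exact abs_cos_le_one _) hmean hδ.le hδ1 N
  have hcard : (Fintype.card (Fin g → ZMod q) : ℝ) = (q : ℝ) ^ g := by simp [ZMod.card]
  rw [hcard] at hch
  have hP := (hasSum_productMass (L := dualQaryLattice A.toCols₂) hσ N).summable
  have hP0 : ∀ W : Fin N → Fin m → ℤ, 0 ≤ productMass μ N W :=
    productMass_nonneg (discreteGaussian_nonneg _ _) N
  refine hch.trans (Summable.tsum_le_tsum (fun W => ?_) (summable_ite_of_nonneg hP hP0 _)
    (summable_ite_of_nonneg hP hP0 _))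
  by_cases hW : ∀ t, ∑ j, sg t * c t (W j) < N * (sg t * meanScore A s b t + δ)
  · have hN' : (0 : ℝ) < N := by exact_mod_cast hN
    have hlow : N * (rho (1 / s) ‖toE e‖ - δ) < score A b W t₀ := by
      have h := hW t₀
      have hr := mul_le_mul_of_nonneg_left (rho_le_meanScore A e secret hs) hN'.le
      simp only [hsg, if_true, neg_one_mul, Finset.sum_neg_distrib] at h
      rw [hscore]
      linarith
    have hgap' := mul_lt_mul_of_pos_left hgap hN'
    have hrp := mul_pos hN'
      (rho_pos (1 / s) (firstMin (qaryLattice A) - ‖toE e‖ - 1 / s * √(m / (2 * π))))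
    have hNδ := mul_pos hN' hδ
    have hout : attackOutput A b W = some t₀ := by
      refine attackOutput_eq A b W t₀ (by linarith) fun t ht => ?_
      have h := hW t
      have hr := mul_le_mul_of_nonneg_left
        (meanScore_le_rho A e secret hm hs hind hsep t ht) hN'.le
      simp only [hsg, if_neg ht, one_mul] at h
      rw [hscore W t]
      linarith
    rw [if_pos hW, if_pos hout]
  · rw [if_neg hW]
    split_ifs
    · exact hP0 W
    · exact le_rfl

/-- Passing to truncated samples costs at most the mass `1 - α^N` that is cut off. -/
theorem success_truncated {L : Submodule ℤ (Fin m → ℤ)} {σ R : ℝ} (hσ : 0 < σ) (hR : 0 ≤ R) {N : ℕ}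
    (P : (Fin N → Fin m → ℤ) → Prop) [DecidablePred P] {p : ℝ}
    (hp : p ≤ ∑' W, if P W then productMass (discreteGaussian (L : Set (Fin m → ℤ)) σ) N W else 0) :
    p - (1 - retainedMass L σ R ^ N) ≤
      ∑' W, if P W then productMass (discreteGaussian (truncated L R) σ) N W else 0 := by
  classical
  have ha := retainedMass_pos (L := L) hσ hR
  have h1 := hasSum_productMass (L := L) hσ N
  have hS := hasSum_retainedMass_pow (L := L) (R := R) hσ N
  have hP0 : ∀ W : Fin N → Fin m → ℤ, 0 ≤
      productMass (discreteGaussian (L : Set (Fin m → ℤ)) σ) N W :=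
    productMass_nonneg (discreteGaussian_nonneg _ _) N
  have hT0 : ∀ W : Fin N → Fin m → ℤ, 0 ≤ productMass (discreteGaussian (truncated L R) σ) N W :=
    productMass_nonneg (discreteGaussian_nonneg _ _) N
  have hT : Summable (productMass (discreteGaussian (truncated L R) σ) N) := by
    have := hasSum_prod_pow (discreteGaussian_nonneg _ _)
      (hasSum_discreteGaussian hσ (zero_mem_truncated (L := L) hR)) N
    exact this.summable
  have hA := (summable_ite_of_nonneg h1.summable hP0 P).hasSum
  have hB := (summable_ite_of_nonneg hT hT0 P).hasSum
  have hle := hasSum_le (fun W => ?_) (hA.sub (h1.sub hS)) hB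
  · linarith
  · have hW := productMass_conditional (discreteGaussian_truncated (L := L) (R := R) hσ) W
    have hle1 : retainedMass L σ R ^ N ≤ 1 := pow_le_one₀ ha.le (retainedMass_le_one hσ)
    have hdiv := le_div_self (hP0 W) (pow_pos ha N) hle1
    have h0 := hP0 W
    by_cases h : P W
    · by_cases h' : ∀ j, W j ∈ truncated L R
      · rw [if_pos h'] at hW
        simp only [if_pos h, if_pos h', hW]
        linarith
      · rw [if_neg h'] at hW
        simp only [if_pos h, if_neg h', hW]
        linarith
    · simp only [if_neg h]
      split_ifs <;> linarith

theorem map_apply_toReal {α β : Type} [DecidableEq β] (p : PMF α) (f : α → β) (y : β) :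
    ((p.map f) y).toReal = ∑' x, if f x = y then (p x).toReal else 0 := by
  classical
  rw [PMF.map_apply, ENNReal.tsum_toReal_eq fun x => by
    split_ifs
    · exact p.apply_ne_top x
    · exact ENNReal.zero_ne_top]
  refine tsum_congr fun x => ?_
  by_cases h : f x = y
  · simp [h]
  · simp [h, Ne.symm h]

theorem exp_neg_le_two_rpow {x : ℝ} (hx : 0 ≤ x) : exp (-x) ≤ (2 : ℝ) ^ (-x) := by
  rw [rpow_def_of_pos two_pos, exp_le_exp]
  have : log 2 ≤ 1 := by linarith [log_two_lt_d9]
  nlinarith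

end Success

/-! ### End-to-end cost -/

/-- The cost of one sample is `O(m² + 1 / √Δ_R)`. -/
theorem qrsSample_cost_le {m : ℕ} {L : Submodule ℤ (Fin m → ℤ)} {B : Module.Basis (Fin m) ℤ L}
    {σ R : ℝ} (hgs : ∀ i, gs B i ≠ 0) (hσ : 0 < σ) (hR : 0 ≤ R) :
    ((3 + 8 * rounds (pR B σ R) + m * (2 * m + 1) : ℕ) : ℝ) ≤
      3 + m * (2 * m + 1) + 16 * (1 / √(DeltaR B σ R)) := by
  have hD := DeltaR_pos B hgs hσ hR
  have hr := rounds_le (pR_pos B hgs hσ hR) (pR_le_one B hgs hσ hR)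
  have h2 : 2 / √(pR B σ R) ≤ 2 / √(DeltaR B σ R) := by
    have := sqrt_pos.2 hD
    gcongr
    exact DeltaR_le_pR B hgs hσ hR
  have e : 2 / √(DeltaR B σ R) = 2 * (1 / √(DeltaR B σ R)) := by ring
  push_cast
  linarith

theorem search_cost_le {m g d q N : ℕ} [NeZero q] (hq : 2 ≤ q)
    (A : Matrix (Fin m) (Fin g ⊕ Fin d) (ZMod q)) (b : Fin m → ZMod q) (W : Fin N → Fin m → ℤ) :
    ((search A b W).cost : ℝ) ≤ N * (2 * m + (g * (2 * m + 1) + (2 * m + 3))) +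
      (5 + 189 * g) * ((q : ℝ) ^ g * logb 2 q) := by
  rw [search_cost, fillTable_cost]
  have h := dftAll_cost_le hq g (fillTable A b W).val
  have hl : (q : ℝ) ^ g ≤ (q : ℝ) ^ g * logb 2 q :=
    le_mul_of_one_le_right (by positivity) (one_le_logb_two hq)
  push_cast
  linarith

theorem total_cost_le {m g d N : ℕ} (hm : 0 < m) {Q D : ℝ} (hQ : 0 ≤ Q) (hD : 0 ≤ D) :
    N * (3 + (m : ℝ) * (2 * m + 1) + 16 * D) +
      (N * (2 * (m : ℝ) + (g * (2 * m + 1) + (2 * m + 3))) + (5 + 189 * g) * Q) ≤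
      200 * ((m : ℝ) + (g + d)) ^ 2 * (N + Q) + N * (200 * D) := by
  have hm1 : (1 : ℝ) ≤ m := by exact_mod_cast hm
  have hg : (0 : ℝ) ≤ g := Nat.cast_nonneg g
  have hd : (0 : ℝ) ≤ d := Nat.cast_nonneg d
  have hN : (0 : ℝ) ≤ N := Nat.cast_nonneg N
  have hX : (m : ℝ) + g ≤ (m : ℝ) + (g + d) := by linarith
  have hX2 : ((m : ℝ) + g) ^ 2 ≤ ((m : ℝ) + (g + d)) ^ 2 := by gcongr
  have h1 : 3 + (m : ℝ) * (2 * m + 1) + (2 * (m : ℝ) + (g * (2 * m + 1) + (2 * m + 3))) ≤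
      200 * ((m : ℝ) + (g + d)) ^ 2 := by nlinarith [mul_nonneg hg hg]
  have h2 : 5 + 189 * (g : ℝ) ≤ 200 * ((m : ℝ) + (g + d)) ^ 2 := by nlinarith [mul_nonneg hg hg]
  have h3 := mul_le_mul_of_nonneg_left h1 hN
  have h4 := mul_le_mul_of_nonneg_right h2 hQ
  have h5 := mul_nonneg hN hD
  linarith

end DualAttack

theorem mainTheorem3 :
    ∃ (c C : ℝ) (k : ℕ), 0 < c ∧ 0 < C ∧
      ∀ (m g d q N β : ℕ) [NeZero q] (TBKZ : ℕ → ℕ → ℕ)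
        (A : Matrix (Fin m) (Fin g ⊕ Fin d) (ZMod q)) (e : Fin m → ℤ)
        (secret : Fin g ⊕ Fin d → ZMod q) (s δ ε R : ℝ)
        (bkz : (M : Matrix (Fin m) (Fin d) (ZMod q)) →
          Timed (Module.Basis (Fin m) ℤ (dualQaryLattice M)))
        (oracle : ∀ B : Module.Basis (Fin m) ℤ (dualQaryLattice A.toCols₂),
          KleinOracle B (q * s) R),
        IsPrimePow q → 0 < N → 0 < s → 0 < δ → 0 < ε → ε < 1 →
        -- the columns of `A_guess` are independent modulo the column span of `A_dual`
        (∀ (t : Fin g → ZMod q) (x : Fin d → ZMod q),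
          A.toCols₁ *ᵥ t = A.toCols₂ *ᵥ x → t = 0) →
        -- geometric separation, with `τ = √(m / 2π) / s`
        1 / s * √(m / (2 * π)) + ‖toE e‖ ≤ firstMin (qaryLattice A) →
        2 * δ < rho (1 / s) ‖toE e‖ -
          rho (1 / s) (firstMin (qaryLattice A) - ‖toE e‖ - 1 / s * √(m / (2 * π))) →
        -- the basis subroutine
        IsBKZReduced (bkz A.toCols₂).val β → (bkz A.toCols₂).cost ≤ TBKZ m β →
        -- the truncation radius
        q * s * (√(m / (2 * π)) + √(log (N / ε) / π)) ≤ R →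
        let L := dualQaryLattice A.toCols₂
        let B := (bkz A.toCols₂).val
        let b := A *ᵥ secret + modQ q e
        let attack := dualAttack A b N bkz oracle
        -- all gates of the sampling circuit are unitary
        (∀ G : Gate, gateMatrix (oracle B) G ∈ Matrix.unitaryGroup (Reg B R) ℂ) ∧
        -- the samples used by the attack are exactly distributed as `N` independent samples
        -- from the truncated discrete Gaussian
        (∀ W : Fin N → Fin m → ℤ,
          (((repeatRuns (qrsSample (oracle B)) N).map Timed.val) W).toReal =
            productMass (discreteGaussian (truncated L R) (q * s)) N W) ∧
        -- the fast search computes the output of the search loop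
        (∀ W : Fin N → Fin m → ℤ, (search A b W).val = attackOutput A b W) ∧
        -- success probability
        (1 - (q : ℝ) ^ m * (2 : ℝ) ^ (-(c * (N * δ ^ 2))) - ε ≤
          ((attack.map Timed.val) (some fun i => secret (Sum.inl i))).toReal) ∧
        -- end-to-end cost
        (∀ r ∈ attack.support, (r.cost : ℝ) ≤
          C * ((m : ℝ) + (g + d)) ^ k * (N + (q : ℝ) ^ g * Real.logb 2 q) + TBKZ m β +
            N * (C * (1 / √(DeltaR B (q * s) R)))) ∧
        -- truncation error
        tvDist (discreteGaussian (L : Set (Fin m → ℤ)) (q * s))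
            (discreteGaussian (truncated L R) (q * s)) = 1 - retainedMass L (q * s) R ∧
        1 - retainedMass L (q * s) R ≤ ε / N ∧
        tvDist (productMass (discreteGaussian (L : Set (Fin m → ℤ)) (q * s)) N)
            (productMass (discreteGaussian (truncated L R) (q * s)) N) ≤ ε := by

  refine ⟨1 / 4, 200, 2, by norm_num, by norm_num, ?_⟩
  intro m g d q N β _ TBKZ A e secret s δ ε R bkz oracle hq hN hs hδ hε0 hε1 hind hsep hgap _ hTBKZ
      hR
    L B b attack
  classical
  have hq2 : 2 ≤ q := hq.two_le
  have hq0 : (0 : ℝ) < q := by exact_mod_cast (by omega : 0 < q)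
  have hσ : 0 < (q : ℝ) * s := mul_pos hq0 hs
  have hm : 0 < m := by
    -- For `m = 0` the lattice is trivial, its first minimum is `0` and the gap vanishes.
    rcases Nat.eq_zero_or_pos m with rfl | hm
    · exfalso
      have h1 : ∀ z : Fin 0 → ℤ, toE z = 0 := fun z => Subsingleton.elim _ _
      have h2 : firstMin (qaryLattice A) = 0 := by
        rw [firstMin, ← Real.sInf_empty]
        congr 1
        refine Set.eq_empty_of_forall_notMem ?_
        rintro r ⟨z, -, hz, -⟩
        exact hz (Subsingleton.elim _ _)
      rw [h2, h1] at hgap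
      simp [rho_zero] at hgap
      linarith
    · exact hm
  have hR0 : 0 ≤ R := le_trans (by positivity) hR
  have hgs : ∀ i, gs B i ≠ 0 := gs_ne_zero B
  have hloss := one_sub_retainedMass_le A.toCols₂ hm hσ hN hε0 hε1 hR
  have hNpos : (0 : ℝ) < N := by exact_mod_cast hN
  have hpow : 1 - retainedMass L (q * s) R ^ N ≤ ε := by
    refine (one_sub_pow_le (retainedMass_pos hσ hR0).le N).trans ?_
    calc (N : ℝ) * (1 - retainedMass L (q * s) R) ≤ N * (ε / N) := by gcongr
      _ = ε := by field_simp
  have hlaw : ∀ W : Fin N → Fin m → ℤ,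
      (((repeatRuns (qrsSample (oracle B)) N).map Timed.val) W).toReal =
      productMass (discreteGaussian (truncated L R) (q * s)) N W :=
    samples_law (oracle B) hgs hσ hR0
  refine ⟨gateMatrix_mem_unitaryGroup (oracle B)
      (fun x => ⟨accept_nonneg B hgs hσ hR0 x, accept_le_one B hgs hσ hR0 x⟩)
      (pR_pos B hgs hσ hR0) (pR_le_one B hgs hσ hR0), hlaw, search_val A b, ?_, ?_,
    tvDist_truncated hσ hR0, hloss, (tvDist_product_truncated hσ hR0 N).trans_le hpow⟩
  · have hmap : attack.map Timed.val =
        ((repeatRuns (qrsSample (oracle B)) N).map Timed.val).map fun W => attackOutput A b W := by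
      simp only [attack, dualAttack]
      rw [PMF.map_comp, PMF.map_comp]
      congr 1
      funext W
      exact search_val A b W.val
    rw [hmap, map_apply_toReal]
    simp_rw [hlaw]
    have h1 := success_truncated hσ hR0 _
      (success_untruncated A e secret hm hs hδ hind hsep hgap hN)
    refine le_trans ?_ h1
    have h2 : (q : ℝ) ^ g ≤ (q : ℝ) ^ m := by exact_mod_cast pow_le_pow_of_independent A hind
    have h3 : exp (-(N * δ ^ 2 / 4)) ≤ (2 : ℝ) ^ (-(1 / 4 * (N * δ ^ 2))) := by
      rw [show 1 / 4 * (N * δ ^ 2) = N * δ ^ 2 / 4 by ring]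
      exact exp_neg_le_two_rpow (by positivity)
    have h4 : (q : ℝ) ^ g * exp (-(N * δ ^ 2 / 4)) ≤
        (q : ℝ) ^ m * (2 : ℝ) ^ (-(1 / 4 * (N * δ ^ 2))) := by gcongr
    linarith
  · intro r hr
    obtain ⟨W, hW, rfl⟩ := (PMF.mem_support_map_iff _ _ _).1 hr
    have h1 : (W.cost : ℝ) ≤ N * ((3 + 8 * rounds (pR B (q * s) R) + m * (2 * m + 1) : ℕ) : ℝ) := by
      exact_mod_cast repeatRuns_cost_le _ _ (qrsSample_cost (oracle B)) N W hW
    have h2 := mul_le_mul_of_nonneg_left (qrsSample_cost_le hgs hσ hR0) hNpos.le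
    have h3 := search_cost_le hq2 A b W.val
    have h4 : ((bkz A.toCols₂).cost : ℝ) ≤ TBKZ m β := by exact_mod_cast hTBKZ
    have h5 := total_cost_le (g := g) (d := d) (N := N) hm
      (Q := (q : ℝ) ^ g * logb 2 q) (D := 1 / √(DeltaR B (q * s) R))
      (mul_nonneg (by positivity) (by linarith [one_le_logb_two hq2])) (by positivity)
    push_cast
    linarith
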